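/- Let $(M^n,g)$, $n\ge 3$, be a smooth Riemannian manifold (without boundary) with scalar curvature $R^M$, and write $B_g(p,r)$ for the open $g$-ball. There is a constant $C>0$, depending only on $(M,g)$, such that for every compact set $K\subset M$ there is $\delta_0>0$ with the following property. Let $p\in K$, $0<\delta<\delta_0$, $\kappa\in\mathbb R$, and suppose $R^M\ge\kappa$ on $B=B_g(p,2\delta)$. Then for every integer $j\ge 1$ and every $d>0$ there are a smooth Riemannian metric $h$ on $N=M$ and a smooth function $F_j:B\to\mathbb R$ such that, with $g_j=h|_B$ and $W_j=(B,g_j)$: * (Well.) $g_j=dF_j^2+g$ on $B$, where $F_j=\varphi\circ d_g(p,\cdot)$ for a nonincreasing function $\varphi$ on $[0,2\delta)$ that is constant near $0$ and vanishes on $[\delta,2\delta)$; moreover $h=g$ on $M\setminus B$; and $(N,h)$ is complete if $(M,g)$ is complete. * (1) The scalar curvature of $W_j$ satisfies $R^j>\kappa-\frac1j$. * (2) $g_j=g$ on $E=B_g(p,2\delta)\setminus B_g(p,\delta)$. * (3) $d\le \operatorname{diam}(W_j)<C(\delta+d)$ and $\operatorname{vol}(W_j)<C(\delta^n+d\,\delta^{n-1})$,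 where the diameter is that of the Riemannian manifold $W_j$. * (4) If in addition $R^M>\kappa-\frac1j$ on $M\setminus B$ (in particular if $R^M\ge\kappa$ on $M$), then $R^N>\kappa-\frac1j$ on all of $N$. In particular $C$ does not depend on $K$, $p$, $\delta$, $\kappa$, $j$ or $d$, and $\delta_0$ does not depend on $\kappa$, $j$ or $d$. -/

import Mathlib

open Set Filter Topology
open scoped Manifold ContDiff Bundle ENNReal

namespace Riem

/-- A smooth Riemannian metric on a smooth `n`-manifold `M` (without boundary). -/
abbrev Metric (n : ℕ) (M : Type*) [TopologicalSpace M]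
    [ChartedSpace (EuclideanSpace ℝ (Fin n)) M] [IsManifold (𝓡 n) ∞ M] :=
  Bundle.ContMDiffRiemannianMetric (𝓡 n) ∞ (EuclideanSpace ℝ (Fin n))
    (fun x : M => TangentSpace (𝓡 n) x)

section Coordinates

variable {n : ℕ}

/-- The partial derivative `∂ᵢ f (y)` of a real function on `ℝⁿ`. -/
noncomputable def pderiv (i : Fin n) (f : EuclideanSpace ℝ (Fin n) → ℝ)
    (y : EuclideanSpace ℝ (Fin n)) : ℝ :=
  fderiv ℝ f y (EuclideanSpace.single i 1)

/-- The Christoffel symbol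
`Γᵏᵢⱼ = ½ ∑ₗ Gᵏˡ (∂ᵢ Gⱼₗ + ∂ⱼ Gᵢₗ - ∂ₗ Gᵢⱼ)` of a metric with components `G`. -/
noncomputable def christoffel (G : EuclideanSpace ℝ (Fin n) → Matrix (Fin n) (Fin n) ℝ)
    (k i j : Fin n) (y : EuclideanSpace ℝ (Fin n)) : ℝ :=
  (1 / 2 : ℝ) * ∑ l, (G y)⁻¹ k l *
    (pderiv i (fun z => G z j l) y + pderiv j (fun z => G z i l) y
      - pderiv l (fun z => G z i j) y)

/-- The Ricci curvature
`Ricᵢⱼ = ∑ₖ (∂ₖ Γᵏᵢⱼ - ∂ⱼ Γᵏᵢₖ) + ∑ₖₗ (Γᵏₖₗ Γˡᵢⱼ - Γᵏⱼₗ Γˡᵢₖ)`. -/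
noncomputable def coordRicci (G : EuclideanSpace ℝ (Fin n) → Matrix (Fin n) (Fin n) ℝ)
    (i j : Fin n) (y : EuclideanSpace ℝ (Fin n)) : ℝ :=
  (∑ k, (pderiv k (christoffel G k i j) y - pderiv j (christoffel G k i k) y)) +
    ∑ k, ∑ l, (christoffel G k k l y * christoffel G l i j y
      - christoffel G k j l y * christoffel G l i k y)

/-- The scalar curvature `∑ᵢⱼ Gⁱʲ Ricᵢⱼ`. -/
noncomputable def coordScalar (G : EuclideanSpace ℝ (Fin n) → Matrix (Fin n) (Fin n) ℝ)
    (y : EuclideanSpace ℝ (Fin n)) : ℝ :=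
  ∑ i, ∑ j, (G y)⁻¹ i j * coordRicci G i j y

end Coordinates

section Manifold

variable {n : ℕ} {M : Type*} [TopologicalSpace M]
  [ChartedSpace (EuclideanSpace ℝ (Fin n)) M] [IsManifold (𝓡 n) ∞ M]

/-- The `i`-th coordinate vector field of the chart at `c`, at the point with coordinates `y`. -/
noncomputable def coordVector (c : M) (y : EuclideanSpace ℝ (Fin n)) (i : Fin n) :
    TangentSpace (𝓡 n) ((extChartAt (𝓡 n) c).symm y) :=
  mfderiv 𝓘(ℝ, EuclideanSpace ℝ (Fin n)) (𝓡 n) (extChartAt (𝓡 n) c).symm y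
    (EuclideanSpace.single i (1 : ℝ) : EuclideanSpace ℝ (Fin n))

/-- The components `gᵢⱼ` of the metric in the chart at `c`, as functions of the coordinates. -/
noncomputable def gram (g : Metric n M) (c : M) (y : EuclideanSpace ℝ (Fin n)) :
    Matrix (Fin n) (Fin n) ℝ :=
  Matrix.of fun i j =>
    g.inner ((extChartAt (𝓡 n) c).symm y) (coordVector c y i) (coordVector c y j)

/-- The scalar curvature of `g` at `x`, computed in the chart at `x`. -/
noncomputable def scalarCurvature (g : Metric n M) (x : M) : ℝ :=
  coordScalar (gram g x) (extChartAt (𝓡 n) x x)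

/-- The length for `g` of the path `γ` on `[0, 1]`. -/
noncomputable def pathLength (g : Metric n M) (γ : ℝ → M) : ℝ≥0∞ :=
  letI : Bundle.RiemannianBundle (fun x : M => TangentSpace (𝓡 n) x) := ⟨g.toRiemannianMetric⟩
  Manifold.pathELength (𝓡 n) γ 0 1

/-- The Riemannian distance of `g` (infinite between different components). -/
noncomputable def dist (g : Metric n M) (x y : M) : ℝ≥0∞ :=
  letI : Bundle.RiemannianBundle (fun x : M => TangentSpace (𝓡 n) x) := ⟨g.toRiemannianMetric⟩
  Manifold.riemannianEDist (𝓡 n) x y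

/-- The open ball `B_g(p, r)`. -/
def ball (g : Metric n M) (p : M) (r : ℝ) : Set M :=
  {x | dist g p x < ENNReal.ofReal r}

/-- `(M, g)` is complete: Cauchy sequences for the Riemannian distance converge. -/
def IsCompleteMetric (g : Metric n M) : Prop :=
  ∀ u : ℕ → M,
    (∀ ε : ℝ≥0∞, 0 < ε → ∃ N, ∀ k ≥ N, ∀ l ≥ N, dist g (u k) (u l) < ε) →
      ∃ x, Tendsto u atTop (𝓝 x)

/-- The Riemannian distance of the Riemannian manifold `(U, g|_U)`, for an open set `U`: the
infimum of the `g`-lengths of the `C¹` paths that stay in `U`. -/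
noncomputable def distIn (g : Metric n M) (U : Set M) (x y : M) : ℝ≥0∞ :=
  ⨅ (γ : ℝ → M) (_ : ContMDiffOn 𝓘(ℝ, ℝ) (𝓡 n) 1 γ (Icc 0 1))
    (_ : MapsTo γ (Icc 0 1) U) (_ : γ 0 = x) (_ : γ 1 = y), pathLength g γ

/-- The diameter of the Riemannian manifold `(U, g|_U)`, for an open set `U`. -/
noncomputable def diam (g : Metric n M) (U : Set M) : ℝ≥0∞ :=
  ⨆ (x ∈ U) (y ∈ U), distIn g U x y

/-- The Riemannian volume in a chart: `∫ √(det gᵢⱼ)` over the image of `A` in the chart at `c`. -/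
noncomputable def chartVol (g : Metric n M) (c : M) (A : Set M) : ℝ≥0∞ :=
  ∫⁻ y in extChartAt (𝓡 n) c '' A, ENNReal.ofReal (Real.sqrt (gram g c y).det)

/-- The Riemannian volume of `S` (for Borel `S`; in general, the outer measure that it induces):
the infimum of `∑ₖ ∫ √(det gᵢⱼ)` over the countable covers of `S` by sets `Aₖ`, each of which is
contained in a chart domain and is measurable there. -/
noncomputable def vol (g : Metric n M) (S : Set M) : ℝ≥0∞ :=
  ⨅ (c : ℕ → M) (A : ℕ → Set M)
    (_ : ∀ k, A k ⊆ (chartAt (EuclideanSpace ℝ (Fin n)) (c k)).source)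
    (_ : ∀ k, MeasurableSet (extChartAt (𝓡 n) (c k) '' A k))
    (_ : S ⊆ ⋃ k, A k), ∑' k, chartVol g (c k) (A k)

/-- The differential of a real function at `x`. -/
noncomputable def differential (F : M → ℝ) (x : M) (v : TangentSpace (𝓡 n) x) : ℝ :=
  mfderiv (𝓡 n) 𝓘(ℝ, ℝ) F x v

/-- `h` is on `B = B_g(p, 2δ)` the metric `dF² + g` of a rotationally symmetric graph in the
product `ℝ × B`: the smooth height function `F` is a nonincreasing function `φ` of the
`g`-distance from `p`, constant near `p`, and zero at distance at least `δ` from `p`. -/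
structure IsGraphWell (g h : Metric n M) (p : M) (δ : ℝ) (F : M → ℝ) : Prop where
  smooth : ContMDiffOn (𝓡 n) 𝓘(ℝ, ℝ) ∞ F (ball g p (2 * δ))
  radial : ∃ φ : ℝ → ℝ,
    AntitoneOn φ (Ico 0 (2 * δ)) ∧
    (∃ ρ > 0, ∀ r ∈ Ico 0 ρ, φ r = φ 0) ∧
    (∀ r ∈ Ico δ (2 * δ), φ r = 0) ∧
    ∀ x ∈ ball g p (2 * δ), F x = φ (dist g p x).toReal
  metric_eq : ∀ x ∈ ball g p (2 * δ), ∀ v w : TangentSpace (𝓡 n) x,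
    h.inner x v w = differential F x v * differential F x w + g.inner x v w

end Manifold

end Riem

/-!
The well is the graph of a function `F = φ ∘ d(p, ·)` over a small geodesic ball, with `φ` equal to
`d` near `0` and to `0` beyond `δ`. In geodesic normal coordinates at `p`, the Gauss equation for the
graph (`Riem.curv_graph`) gives for the scalar curvatures, with `r = d(p, ·)`,

  `R_h = R_g + Q · w + H · w'`,  where `w = φ'² / (1 + φ'²)` and `w' = 2 φ' φ'' / (1 + φ'²)²`

is the derivative of `w` with respect to `r` (`Riem.IsNormalForm.coordScalar_graph`). In flat space
`H = (n - 1) / r` is the mean curvature of the sphere of radius `r` and `Q = (n - 1) (n - 2) / r²`;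
in a small ball these values are almost attained, up to a factor close to `1`. Since `n ≥ 3`, the
scalar curvature drops at most by a multiple of `σ` as soon as `w' ≥ -(6 / 7) w / r - σ r`. This
allows `w` to decay like the power `-6 / 7` of `r`, or more slowly, until it is so small that the
term `σ r` pays for cutting it off. Since `w` may start with a value arbitrarily close to `1`, that
is, the slope with an arbitrarily large one, every descent `d` can be realized
(`Riem.exists_profile`).

Normal coordinates of a uniform radius exist near every point, hence at all points of a compact set
(`Riem.exists_isNormalChart`, `Riem.exists_isNormalChart_of_isCompact`). The exponential map comes
from the inverse function theorem in the Banach space of accelerations of paths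
(`Riem.exists_expMap`), and the Gauss lemma (`Riem.gauss_lemma`) makes the radial direction
orthogonal to the distance spheres. That the radius of the coordinates is the Riemannian distance
from the centre follows from the length of radii in one direction, and in the other from the fact
that functions with differential of norm at most `1` are `1`-Lipschitz (`Riem.IsNormalChart.dist_eq`).

The difference of heights bounds the diameter of the graph from below, and paths through the centre
along radii bound it from above. The volume is an integral in normal coordinates, with density at
most a constant times `1 + |φ'|`; the integral of `|φ'|` over the ball is at most a multiple of
`δ ^ (n - 1) d`. The constants depend only on the dimension.
-/

namespace Riem

/-! ### Christoffel symbols and curvature of a metric on a vector space -/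

section CoordinateCurvature

variable {E F : Type*} [NormedAddCommGroup E] [NormedSpace ℝ E]
  [NormedAddCommGroup F] [NormedSpace ℝ F]

/- Shortcut instances: without them, instance search on iterated spaces of linear maps is slow. -/
noncomputable instance : NormedAddCommGroup (E →L[ℝ] ℝ) := inferInstance
noncomputable instance : NormedSpace ℝ (E →L[ℝ] ℝ) := inferInstance
noncomputable instance : NormedAddCommGroup (E →L[ℝ] E →L[ℝ] ℝ) := inferInstance
noncomputable instance : NormedSpace ℝ (E →L[ℝ] E →L[ℝ] ℝ) := inferInstance
noncomputable instance : NormedAddCommGroup (E →L[ℝ] E →L[ℝ] E →L[ℝ] ℝ) := inferInstance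
noncomputable instance : NormedSpace ℝ (E →L[ℝ] E →L[ℝ] E →L[ℝ] ℝ) := inferInstance
noncomputable instance : AddCommGroup (E →L[ℝ] E →L[ℝ] ℝ) := inferInstance
noncomputable instance : AddCommGroup (E →L[ℝ] E →L[ℝ] E →L[ℝ] ℝ) := inferInstance

/-- The Christoffel symbols of the first kind of a metric `B`, as a trilinear expression:
`⟨∇ᵤv, w⟩` for constant vector fields `u`, `v`, `w`. -/
noncomputable def chr (B : E → E →L[ℝ] E →L[ℝ] ℝ) (x u v w : E) : ℝ :=
  (1 / 2) * (fderiv ℝ B x u v w + fderiv ℝ B x v u w - fderiv ℝ B x w u v)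

/-- The linear form `w ↦ chr B x u v w`. -/
noncomputable def chrForm (B : E → E →L[ℝ] E →L[ℝ] ℝ) (x u v : E) : E →L[ℝ] ℝ :=
  (1 / 2 : ℝ) • (fderiv ℝ B x u v + fderiv ℝ B x v u - ((fderiv ℝ B x).flip u).flip v)

theorem chrForm_apply (B : E → E →L[ℝ] E →L[ℝ] ℝ) (x u v w : E) :
    chrForm B x u v w = chr B x u v w := by
  simp [chrForm, chr]

/-- The Christoffel symbols of the second kind: the vector `∇ᵤv`. -/
noncomputable def chrVec (B : E → E →L[ℝ] E →L[ℝ] ℝ) (x u v : E) : E :=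
  (B x).inverse (chrForm B x u v)

/-- The Riemann curvature tensor `⟨R(a, u)v, w⟩` of the metric `B`, expressed through the
Christoffel symbols of the first kind and their derivatives. -/
noncomputable def curv (B : E → E →L[ℝ] E →L[ℝ] ℝ) (x a u v w : E) : ℝ :=
  fderiv ℝ (fun z => chr B z u v w) x a - fderiv ℝ (fun z => chr B z a v w) x u
    - B x (chrVec B x a w) (chrVec B x u v) + B x (chrVec B x u w) (chrVec B x a v)

theorem apply_chrVec {B : E → E →L[ℝ] E →L[ℝ] ℝ} {x : E} (hB : (B x).IsInvertible) (u v w : E) :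
    B x (chrVec B x u v) w = chr B x u v w := by
  obtain ⟨e, he⟩ := hB
  rw [chrVec, ← he, ContinuousLinearMap.inverse_equiv, ← chrForm_apply]
  simp

theorem chr_congr {B B' : E → E →L[ℝ] E →L[ℝ] ℝ} {x : E} (h : B =ᶠ[𝓝 x] B') (u v w : E) :
    chr B x u v w = chr B' x u v w := by
  simp only [chr, h.fderiv_eq]

theorem chrVec_congr {B B' : E → E →L[ℝ] E →L[ℝ] ℝ} {x : E} (h : B =ᶠ[𝓝 x] B') (u v : E) :
    chrVec B x u v = chrVec B' x u v := by
  simp only [chrVec, chrForm, h.fderiv_eq, h.eq_of_nhds]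

theorem curv_congr {B B' : E → E →L[ℝ] E →L[ℝ] ℝ} {x : E} (h : B =ᶠ[𝓝 x] B') (a u v w : E) :
    curv B x a u v w = curv B' x a u v w := by
  have key (u v w : E) : (fun z => chr B z u v w) =ᶠ[𝓝 x] fun z => chr B' z u v w := by
    filter_upwards [h.eventuallyEq_nhds] with z hz using chr_congr hz u v w
  simp only [curv, chrVec_congr h, h.eq_of_nhds, (key _ _ _).fderiv_eq]

theorem fderiv_apply_apply {B : E → E →L[ℝ] E →L[ℝ] ℝ} {x : E} (hB : DifferentiableAt ℝ B x)
    (a u v : E) : fderiv ℝ (fun z => B z u v) x a = fderiv ℝ B x a u v := by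
  rw [((hB.hasFDerivAt.clm_apply (hasFDerivAt_const u x)).clm_apply
    (hasFDerivAt_const v x)).fderiv]
  simp

theorem fderiv_symm_of_eventually {B : E → E →L[ℝ] E →L[ℝ] ℝ} {x : E}
    (hB : DifferentiableAt ℝ B x) (hs : ∀ᶠ z in 𝓝 x, ∀ u v, B z u v = B z v u) (a u v : E) :
    fderiv ℝ B x a u v = fderiv ℝ B x a v u := by
  have h2 : (fun z => B z u v) =ᶠ[𝓝 x] fun z => B z v u := hs.mono fun z hz => hz u v
  rw [← fderiv_apply_apply hB, h2.fderiv_eq, fderiv_apply_apply hB]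

theorem chr_symm {B : E → E →L[ℝ] E →L[ℝ] ℝ} {x : E}
    (hB : DifferentiableAt ℝ B x) (hs : ∀ᶠ z in 𝓝 x, ∀ u v, B z u v = B z v u) (u v w : E) :
    chr B x u v w = chr B x v u w := by
  simp only [chr, fderiv_symm_of_eventually hB hs w u v]; ring

/-- Compatibility of the Christoffel symbols with the metric. -/
theorem fderiv_eq_chr_add_chr {B : E → E →L[ℝ] E →L[ℝ] ℝ} {x : E}
    (hB : DifferentiableAt ℝ B x) (hs : ∀ᶠ z in 𝓝 x, ∀ u v, B z u v = B z v u) (a u v : E) :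
    fderiv ℝ B x a u v = chr B x a u v + chr B x a v u := by
  have := fderiv_symm_of_eventually hB hs
  simp only [chr, this a u v]; ring

theorem hasFDerivAt_form_apply {G : Type*} [NormedAddCommGroup G] [NormedSpace ℝ G]
    {B : F → F →L[ℝ] F →L[ℝ] ℝ} {Φ X Y : G → F} {Φ' X' Y' : G →L[ℝ] F} {z : G}
    (hB : DifferentiableAt ℝ B (Φ z))
    (hΦ : HasFDerivAt Φ Φ' z) (hX : HasFDerivAt X X' z) (hY : HasFDerivAt Y Y' z) (a : G) :
    DifferentiableAt ℝ (fun y => B (Φ y) (X y) (Y y)) z ∧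
    fderiv ℝ (fun y => B (Φ y) (X y) (Y y)) z a =
      fderiv ℝ B (Φ z) (Φ' a) (X z) (Y z) + B (Φ z) (X' a) (Y z) + B (Φ z) (X z) (Y' a) := by
  have h := ((hB.hasFDerivAt.comp z hΦ).clm_apply hX).clm_apply hY
  refine ⟨h.differentiableAt, ?_⟩
  have h2 := h.fderiv
  simp only [Function.comp_def] at h2
  rw [h2]
  simp
  ring

theorem differentiableAt_chr {B : E → E →L[ℝ] E →L[ℝ] ℝ} {x : E}
    (hB : ContDiffAt ℝ 2 B x) (u v w : E) : DifferentiableAt ℝ (fun z => chr B z u v w) x := by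
  have h1 : DifferentiableAt ℝ (fderiv ℝ B) x :=
    (hB.fderiv_right (m := 1) (by norm_num)).differentiableAt (by norm_num)
  unfold chr
  fun_prop

/-- The derivative of the Christoffel symbols evaluated on moving vectors. -/
theorem hasFDerivAt_chr_apply
    {B : F → F →L[ℝ] F →L[ℝ] ℝ} {Φ X Y Z : E → F} {Φ' X' Y' Z' : E →L[ℝ] F} {z : E}
    (hB : ContDiffAt ℝ 2 B (Φ z))
    (hΦ : HasFDerivAt Φ Φ' z) (hX : HasFDerivAt X X' z) (hY : HasFDerivAt Y Y' z)
    (hZ : HasFDerivAt Z Z' z) (a : E) :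
    DifferentiableAt ℝ (fun y => chr B (Φ y) (X y) (Y y) (Z y)) z ∧
    fderiv ℝ (fun y => chr B (Φ y) (X y) (Y y) (Z y)) z a =
      fderiv ℝ (fun y => chr B y (X z) (Y z) (Z z)) (Φ z) (Φ' a)
      + chr B (Φ z) (X' a) (Y z) (Z z) + chr B (Φ z) (X z) (Y' a) (Z z)
      + chr B (Φ z) (X z) (Y z) (Z' a) := by
  have h1 : DifferentiableAt ℝ (fderiv ℝ B) (Φ z) :=
    (hB.fderiv_right (m := 1) (by norm_num)).differentiableAt (by norm_num)
  have h0 := h1.hasFDerivAt.comp z hΦ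
  have key (U V W : E → F) (U' V' W' : E →L[ℝ] F) (hU : HasFDerivAt U U' z)
      (hV : HasFDerivAt V V' z) (hW : HasFDerivAt W W' z) :=
    ((h0.clm_apply hU).clm_apply hV).clm_apply hW
  have h := (((key X Y Z _ _ _ hX hY hZ).add (key Y X Z _ _ _ hY hX hZ)).sub
    (key Z X Y _ _ _ hZ hX hY)).const_mul (1 / 2 : ℝ)
  have key2 (U V W : F) := ((h1.hasFDerivAt.clm_apply (hasFDerivAt_const U (Φ z))).clm_apply
    (hasFDerivAt_const V (Φ z))).clm_apply (hasFDerivAt_const W (Φ z))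
  have h' := (((key2 (X z) (Y z) (Z z)).add (key2 (Y z) (X z) (Z z))).sub
    (key2 (Z z) (X z) (Y z))).const_mul (1 / 2 : ℝ)
  have e1 := h.fderiv
  have e2 := h'.fderiv
  simp only [Function.comp_def] at e1
  refine ⟨h.differentiableAt, ?_⟩
  unfold chr
  erw [e1, e2]
  simp
  ring

/-- The Christoffel symbols of a pulled back metric. -/
theorem chr_pullback {B : F → F →L[ℝ] F →L[ℝ] ℝ} {B' : E → E →L[ℝ] E →L[ℝ] ℝ} {Φ : E → F} {x : E}
    (hB : DifferentiableAt ℝ B (Φ x)) (hs : ∀ᶠ z in 𝓝 (Φ x), ∀ u v, B z u v = B z v u)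
    (hB' : DifferentiableAt ℝ B' x) (hΦ : ContDiffAt ℝ 2 Φ x)
    (h : ∀ᶠ z in 𝓝 x, ∀ u v, B' z u v = B (Φ z) (fderiv ℝ Φ z u) (fderiv ℝ Φ z v)) (u v w : E) :
    chr B' x u v w = chr B (Φ x) (fderiv ℝ Φ x u) (fderiv ℝ Φ x v) (fderiv ℝ Φ x w)
      + B (Φ x) (fderiv ℝ (fderiv ℝ Φ) x u v) (fderiv ℝ Φ x w) := by
  have hd : HasFDerivAt Φ (fderiv ℝ Φ x) x := (hΦ.differentiableAt (by norm_num)).hasFDerivAt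
  have hd2 : HasFDerivAt (fderiv ℝ Φ) (fderiv ℝ (fderiv ℝ Φ) x) x :=
    ((hΦ.fderiv_right (m := 1) (by norm_num)).differentiableAt (by norm_num)).hasFDerivAt
  have hsym (u v : E) : fderiv ℝ (fderiv ℝ Φ) x u v = fderiv ℝ (fderiv ℝ Φ) x v u :=
    (hΦ.isSymmSndFDerivAt (by simp)) u v
  have hbs := hs.self_of_nhds
  have key (a u v : E) : fderiv ℝ B' x a u v =
      fderiv ℝ B (Φ x) (fderiv ℝ Φ x a) (fderiv ℝ Φ x u) (fderiv ℝ Φ x v)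
      + B (Φ x) (fderiv ℝ (fderiv ℝ Φ) x a u) (fderiv ℝ Φ x v)
      + B (Φ x) (fderiv ℝ Φ x u) (fderiv ℝ (fderiv ℝ Φ) x a v) := by
    have e0 : (fun z => B' z u v) =ᶠ[𝓝 x] fun z => B (Φ z) (fderiv ℝ Φ z u) (fderiv ℝ Φ z v) :=
      h.mono fun z hz => hz u v
    have e1 := fderiv_apply_apply hB' a u v
    have e2 := (hasFDerivAt_form_apply hB hd (hd2.clm_apply (hasFDerivAt_const u x))
      (hd2.clm_apply (hasFDerivAt_const v x)) a).2
    rw [← e1, e0.fderiv_eq, e2]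
    simp
  simp only [chr, key, hsym w u, hsym w v, hsym v u]
  rw [hbs (fderiv ℝ Φ x v) (fderiv ℝ (fderiv ℝ Φ) x u w),
    hbs (fderiv ℝ Φ x u) (fderiv ℝ (fderiv ℝ Φ) x v w)]
  ring

/-- The curvature tensor is natural under pullback by a map with surjective differential. -/
theorem curv_pullback {B : F → F →L[ℝ] F →L[ℝ] ℝ} {B' : E → E →L[ℝ] E →L[ℝ] ℝ} {Φ : E → F} {x : E}
    (hB : ContDiffAt ℝ 2 B (Φ x)) (hs : ∀ᶠ z in 𝓝 (Φ x), ∀ u v, B z u v = B z v u)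
    (hi : (B (Φ x)).IsInvertible) (hi' : (B' x).IsInvertible)
    (hB' : ContDiffAt ℝ 2 B' x) (hΦ : ContDiffAt ℝ 3 Φ x)
    (hsurj : Function.Surjective (fderiv ℝ Φ x))
    (h : ∀ᶠ z in 𝓝 x, ∀ u v, B' z u v = B (Φ z) (fderiv ℝ Φ z u) (fderiv ℝ Φ z v))
    (a u v w : E) :
    curv B' x a u v w = curv B (Φ x) (fderiv ℝ Φ x a) (fderiv ℝ Φ x u) (fderiv ℝ Φ x v)
      (fderiv ℝ Φ x w) := by
  have hd : HasFDerivAt Φ (fderiv ℝ Φ x) x := (hΦ.differentiableAt (by norm_num)).hasFDerivAt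
  have hΦ1 : ContDiffAt ℝ 2 (fderiv ℝ Φ) x := hΦ.fderiv_right (m := 2) (by norm_num)
  have hΦ2 : ContDiffAt ℝ 1 (fderiv ℝ (fderiv ℝ Φ)) x := hΦ1.fderiv_right (m := 1) (by norm_num)
  have hd2 : HasFDerivAt (fderiv ℝ Φ) (fderiv ℝ (fderiv ℝ Φ) x) x :=
    (hΦ1.differentiableAt (by norm_num)).hasFDerivAt
  have hd3 : HasFDerivAt (fderiv ℝ (fderiv ℝ Φ)) (fderiv ℝ (fderiv ℝ (fderiv ℝ Φ)) x) x :=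
    (hΦ2.differentiableAt (by norm_num)).hasFDerivAt
  have hsymev : ∀ᶠ z in 𝓝 x, ∀ u v,
      fderiv ℝ (fderiv ℝ Φ) z u v = fderiv ℝ (fderiv ℝ Φ) z v u := by
    filter_upwards [hΦ.eventually (by norm_num)] with z hz u v
    exact (hz.isSymmSndFDerivAt (by simp; norm_num)) u v
  have hsym := hsymev.self_of_nhds
  have hsym3 (a u v : E) : fderiv ℝ (fderiv ℝ (fderiv ℝ Φ)) x a u v
      = fderiv ℝ (fderiv ℝ (fderiv ℝ Φ)) x u a v := by
    exact DFunLike.congr_fun (hΦ1.isSymmSndFDerivAt (by simp) a u) v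
  have hbs := hs.self_of_nhds
  have hBd : DifferentiableAt ℝ B (Φ x) := hB.differentiableAt (by norm_num)
  -- the transformation law of the Christoffel symbols of the first kind, near `x`
  have hev : ∀ᶠ z in 𝓝 x, ∀ u v w, chr B' z u v w =
      chr B (Φ z) (fderiv ℝ Φ z u) (fderiv ℝ Φ z v) (fderiv ℝ Φ z w)
      + B (Φ z) (fderiv ℝ (fderiv ℝ Φ) z u v) (fderiv ℝ Φ z w) := by
    have c := hΦ.continuousAt
    filter_upwards [h.eventually_nhds, hΦ.eventually (by norm_num), hB'.eventually (by norm_num),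
      c.eventually (hB.eventually (by norm_num)), c.eventually hs.eventually_nhds]
      with z h1 h2 h3 h4 h5 u v w
    exact chr_pullback (h4.differentiableAt (by norm_num)) h5 (h3.differentiableAt (by norm_num))
      (h2.of_le (by norm_num)) h1 u v w
  -- the transformation law of the Christoffel symbols of the second kind
  have hvec (u v : E) : fderiv ℝ Φ x (chrVec B' x u v) =
      chrVec B (Φ x) (fderiv ℝ Φ x u) (fderiv ℝ Φ x v) + fderiv ℝ (fderiv ℝ Φ) x u v := by
    apply hi.injective
    ext w'
    obtain ⟨w, rfl⟩ := hsurj w'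
    rw [← h.self_of_nhds, apply_chrVec hi', hev.self_of_nhds]
    simp [apply_chrVec hi]
  have hder (a u v w : E) : fderiv ℝ (fun z => chr B' z u v w) x a =
      fderiv ℝ (fun y => chr B y (fderiv ℝ Φ x u) (fderiv ℝ Φ x v) (fderiv ℝ Φ x w)) (Φ x)
        (fderiv ℝ Φ x a)
      + chr B (Φ x) (fderiv ℝ (fderiv ℝ Φ) x a u) (fderiv ℝ Φ x v) (fderiv ℝ Φ x w)
      + chr B (Φ x) (fderiv ℝ Φ x u) (fderiv ℝ (fderiv ℝ Φ) x a v) (fderiv ℝ Φ x w)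
      + chr B (Φ x) (fderiv ℝ Φ x u) (fderiv ℝ Φ x v) (fderiv ℝ (fderiv ℝ Φ) x a w)
      + (fderiv ℝ B (Φ x) (fderiv ℝ Φ x a) (fderiv ℝ (fderiv ℝ Φ) x u v) (fderiv ℝ Φ x w)
      + B (Φ x) (fderiv ℝ (fderiv ℝ (fderiv ℝ Φ)) x a u v) (fderiv ℝ Φ x w)
      + B (Φ x) (fderiv ℝ (fderiv ℝ Φ) x u v) (fderiv ℝ (fderiv ℝ Φ) x a w)) := by
    have e0 : (fun z => chr B' z u v w) =ᶠ[𝓝 x] _ := hev.mono fun z hz => hz u v w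
    have hu (u : E) := hd2.clm_apply (hasFDerivAt_const u x)
    have huv := (hd3.clm_apply (hasFDerivAt_const u x)).clm_apply (hasFDerivAt_const v x)
    have e1 := hasFDerivAt_chr_apply hB hd (hu u) (hu v) (hu w) a
    have e2 := hasFDerivAt_form_apply hBd hd huv (hu w) a
    rw [e0.fderiv_eq, fderiv_fun_add e1.1 e2.1, add_apply, e1.2, e2.2]
    simp
  have hcs := chr_symm hBd hs
  have hBc := fderiv_eq_chr_add_chr hBd hs
  simp only [curv, hder, h.self_of_nhds, hvec]
  simp only [map_add, add_apply, apply_chrVec hi, hsym3 u a v, hsym u a, hBc]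
  rw [hbs (fderiv ℝ (fderiv ℝ Φ) x a w) (chrVec B (Φ x) _ _),
    hbs (fderiv ℝ (fderiv ℝ Φ) x u w) (chrVec B (Φ x) _ _),
    hbs (fderiv ℝ (fderiv ℝ Φ) x a w) (fderiv ℝ (fderiv ℝ Φ) x u v),
    hbs (fderiv ℝ (fderiv ℝ Φ) x u w) (fderiv ℝ (fderiv ℝ Φ) x a v),
    apply_chrVec hi, apply_chrVec hi]
  ring

/-- The covariant Hessian of `F` for the metric `B`. -/
noncomputable def hessian (B : E → E →L[ℝ] E →L[ℝ] ℝ) (F : E → ℝ) (x u v : E) : ℝ :=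
  fderiv ℝ (fderiv ℝ F) x u v - fderiv ℝ F x (chrVec B x u v)

/-- The Christoffel symbols of the first kind of the graph metric `B + dF²`. -/
theorem chr_graph {B B' : E → E →L[ℝ] E →L[ℝ] ℝ} {F : E → ℝ} {x : E}
    (hB : DifferentiableAt ℝ B x) (hB' : DifferentiableAt ℝ B' x) (hF : ContDiffAt ℝ 2 F x)
    (h : ∀ᶠ z in 𝓝 x, ∀ u v, B' z u v = B z u v + fderiv ℝ F z u * fderiv ℝ F z v) (u v w : E) :
    chr B' x u v w = chr B x u v w + fderiv ℝ (fderiv ℝ F) x u v * fderiv ℝ F x w := by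
  have hd2 : HasFDerivAt (fderiv ℝ F) (fderiv ℝ (fderiv ℝ F) x) x :=
    ((hF.fderiv_right (m := 1) (by norm_num)).differentiableAt (by norm_num)).hasFDerivAt
  have hsym (u v : E) : fderiv ℝ (fderiv ℝ F) x u v = fderiv ℝ (fderiv ℝ F) x v u :=
    (hF.isSymmSndFDerivAt (by simp)) u v
  have key (a u v : E) : fderiv ℝ B' x a u v = fderiv ℝ B x a u v +
      (fderiv ℝ (fderiv ℝ F) x a u * fderiv ℝ F x v
        + fderiv ℝ F x u * fderiv ℝ (fderiv ℝ F) x a v) := by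
    have e0 : (fun z => B' z u v) =ᶠ[𝓝 x] fun z => B z u v + fderiv ℝ F z u * fderiv ℝ F z v :=
      h.mono fun z hz => hz u v
    have hu (u : E) := hd2.clm_apply (hasFDerivAt_const u x)
    have e2 := (hB.hasFDerivAt.clm_apply (hasFDerivAt_const u x)).clm_apply
      (hasFDerivAt_const v x)
    rw [← fderiv_apply_apply hB', e0.fderiv_eq, (e2.fun_add ((hu u).fun_mul (hu v))).fderiv]
    simp
    ring
  simp only [chr, key, hsym w u, hsym w v, hsym v u]
  ring

/-- The Gauss equation for the graph of `F`: the curvature of `B + dF²`. The vector `N` is the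
gradient of `F`, so that `1 + fderiv ℝ F x N` is `1 + |∇F|²`. -/
theorem curv_graph {B B' : E → E →L[ℝ] E →L[ℝ] ℝ} {F : E → ℝ} {x N : E}
    (hB : ContDiffAt ℝ 2 B x) (hs : ∀ u v, B x u v = B x v u)
    (hi : (B x).IsInvertible) (hi' : (B' x).IsInvertible)
    (hB' : ContDiffAt ℝ 2 B' x) (hF : ContDiffAt ℝ 3 F x)
    (hN : ∀ w, B x N w = fderiv ℝ F x w) (hN0 : 1 + fderiv ℝ F x N ≠ 0)
    (h : ∀ᶠ z in 𝓝 x, ∀ u v, B' z u v = B z u v + fderiv ℝ F z u * fderiv ℝ F z v)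
    (a u v w : E) :
    curv B' x a u v w = curv B x a u v w +
      (hessian B F x u v * hessian B F x a w - hessian B F x a v * hessian B F x u w)
        / (1 + fderiv ℝ F x N) := by
  have hF1 : ContDiffAt ℝ 2 (fderiv ℝ F) x := hF.fderiv_right (m := 2) (by norm_num)
  have hF2 : ContDiffAt ℝ 1 (fderiv ℝ (fderiv ℝ F)) x := hF1.fderiv_right (m := 1) (by norm_num)
  have hd2 : HasFDerivAt (fderiv ℝ F) (fderiv ℝ (fderiv ℝ F) x) x :=
    (hF1.differentiableAt (by norm_num)).hasFDerivAt
  have hd3 : HasFDerivAt (fderiv ℝ (fderiv ℝ F)) (fderiv ℝ (fderiv ℝ (fderiv ℝ F)) x) x :=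
    (hF2.differentiableAt (by norm_num)).hasFDerivAt
  have hsym (u v : E) : fderiv ℝ (fderiv ℝ F) x u v = fderiv ℝ (fderiv ℝ F) x v u :=
    (hF.of_le (m := 2) (by norm_num)).isSymmSndFDerivAt (by simp) u v
  have hsym3 (a u v : E) : fderiv ℝ (fderiv ℝ (fderiv ℝ F)) x a u v
      = fderiv ℝ (fderiv ℝ (fderiv ℝ F)) x u a v :=
    DFunLike.congr_fun (hF1.isSymmSndFDerivAt (by simp) a u) v
  have hev : ∀ᶠ z in 𝓝 x, ∀ u v w, chr B' z u v w =
      chr B z u v w + fderiv ℝ (fderiv ℝ F) z u v * fderiv ℝ F z w := by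
    filter_upwards [h.eventually_nhds, hF.eventually (by norm_num), hB'.eventually (by norm_num),
      hB.eventually (by norm_num)] with z h1 h2 h3 h4 u v w
    exact chr_graph (h4.differentiableAt (by norm_num)) (h3.differentiableAt (by norm_num))
      (h2.of_le (by norm_num)) h1 u v w
  have hvec (u v : E) : chrVec B' x u v =
      chrVec B x u v + (hessian B F x u v / (1 + fderiv ℝ F x N)) • N := by
    apply hi'.injective
    ext w
    rw [apply_chrVec hi', hev.self_of_nhds, h.self_of_nhds]
    simp only [map_add, map_smul, add_apply, smul_apply, apply_chrVec hi, hN, smul_eq_mul, hessian]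
    field_simp
    ring
  have hder (a u v w : E) : fderiv ℝ (fun z => chr B' z u v w) x a =
      fderiv ℝ (fun z => chr B z u v w) x a +
      (fderiv ℝ (fderiv ℝ (fderiv ℝ F)) x a u v * fderiv ℝ F x w +
        fderiv ℝ (fderiv ℝ F) x u v * fderiv ℝ (fderiv ℝ F) x a w) := by
    have e0 : (fun z => chr B' z u v w) =ᶠ[𝓝 x] _ := hev.mono fun z hz => hz u v w
    have huv := (hd3.clm_apply (hasFDerivAt_const u x)).clm_apply (hasFDerivAt_const v x)
    rw [e0.fderiv_eq, (((differentiableAt_chr hB u v w).hasFDerivAt).fun_add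
      (huv.fun_mul (hd2.clm_apply (hasFDerivAt_const w x)))).fderiv]
    simp
    ring
  simp only [curv, hder, h.self_of_nhds, hvec]
  simp only [map_add, map_smul, add_apply, smul_apply, apply_chrVec hi, hsym3 u a v,
    smul_eq_mul, hN]
  have e (u v : E) : fderiv ℝ F x (chrVec B x u v)
      = fderiv ℝ (fderiv ℝ F) x u v - hessian B F x u v := by simp [hessian]
  have e' (u v : E) : chr B x u v N = fderiv ℝ (fderiv ℝ F) x u v - hessian B F x u v := by
    rw [← apply_chrVec hi, hs, hN, e]
  simp only [e, e']
  field_simp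
  ring

end CoordinateCurvature

/-! ### Multilinearity and smoothness of Christoffel symbols and curvature -/

section Frames

variable {E : Type*} [NormedAddCommGroup E] [NormedSpace ℝ E]

theorem fderiv_chr {B : E → E →L[ℝ] E →L[ℝ] ℝ} {x : E} (hB : ContDiffAt ℝ 2 B x) (a u v w : E) :
    fderiv ℝ (fun z => chr B z u v w) x a = (1 / 2) * (fderiv ℝ (fderiv ℝ B) x a u v w
      + fderiv ℝ (fderiv ℝ B) x a v u w - fderiv ℝ (fderiv ℝ B) x a w u v) := by
  have h1 : DifferentiableAt ℝ (fderiv ℝ B) x :=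
    (hB.fderiv_right (m := 1) (by norm_num)).differentiableAt (by norm_num)
  have key (U V W : E) := ((h1.hasFDerivAt.clm_apply (hasFDerivAt_const U x)).clm_apply
    (hasFDerivAt_const V x)).clm_apply (hasFDerivAt_const W x)
  have h' := (((key u v w).fun_add (key v u w)).fun_sub (key w u v)).const_mul (1 / 2 : ℝ)
  unfold chr
  rw [h'.fderiv]
  simp

theorem chrForm_isLinearMap_left (B : E → E →L[ℝ] E →L[ℝ] ℝ) (x v : E) :
    IsLinearMap ℝ (fun u => chrForm B x u v) where
  map_add u u' := by ext w; simp [chrForm]; ring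
  map_smul c u := by ext w; simp [chrForm]; ring

theorem chrForm_isLinearMap_right (B : E → E →L[ℝ] E →L[ℝ] ℝ) (x u : E) :
    IsLinearMap ℝ (fun v => chrForm B x u v) where
  map_add u u' := by ext w; simp [chrForm]; ring
  map_smul c u := by ext w; simp [chrForm]; ring

theorem chrVec_isLinearMap_left (B : E → E →L[ℝ] E →L[ℝ] ℝ) (x v : E) :
    IsLinearMap ℝ (fun u => chrVec B x u v) where
  map_add u u' := by simp [chrVec, (chrForm_isLinearMap_left B x v).map_add]
  map_smul c u := by simp [chrVec, (chrForm_isLinearMap_left B x v).map_smul]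

theorem chrVec_isLinearMap_right (B : E → E →L[ℝ] E →L[ℝ] ℝ) (x u : E) :
    IsLinearMap ℝ (fun v => chrVec B x u v) where
  map_add v v' := by simp [chrVec, (chrForm_isLinearMap_right B x u).map_add]
  map_smul c v := by simp [chrVec, (chrForm_isLinearMap_right B x u).map_smul]

section Multilinear

variable {B : E → E →L[ℝ] E →L[ℝ] ℝ} {x : E} (hB : ContDiffAt ℝ 2 B x)
include hB

theorem curv_isLinearMap₁ (u v w : E) : IsLinearMap ℝ (fun a => curv B x a u v w) where
  map_add a a' := by
    simp [curv, fderiv_chr hB, (chrVec_isLinearMap_left B x _).map_add]; ring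
  map_smul c a := by
    simp [curv, fderiv_chr hB, (chrVec_isLinearMap_left B x _).map_smul]; ring

theorem curv_isLinearMap₂ (a v w : E) : IsLinearMap ℝ (fun u => curv B x a u v w) where
  map_add a a' := by
    simp [curv, fderiv_chr hB, (chrVec_isLinearMap_left B x _).map_add]; ring
  map_smul c a := by
    simp [curv, fderiv_chr hB, (chrVec_isLinearMap_left B x _).map_smul]; ring

theorem curv_isLinearMap₃ (a u w : E) : IsLinearMap ℝ (fun v => curv B x a u v w) where
  map_add a a' := by
    simp [curv, fderiv_chr hB, (chrVec_isLinearMap_right B x _).map_add]; ring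
  map_smul c a := by
    simp [curv, fderiv_chr hB, (chrVec_isLinearMap_right B x _).map_smul]; ring

theorem curv_isLinearMap₄ (a u v : E) : IsLinearMap ℝ (fun w => curv B x a u v w) where
  map_add a a' := by
    simp [curv, fderiv_chr hB, (chrVec_isLinearMap_right B x _).map_add]; ring
  map_smul c a := by
    simp [curv, fderiv_chr hB, (chrVec_isLinearMap_right B x _).map_smul]; ring

end Multilinear

variable [CompleteSpace E]

theorem contDiffAt_chrVec_comp {H : Type*} [NormedAddCommGroup H] [NormedSpace ℝ H]
    {B : E → E →L[ℝ] E →L[ℝ] ℝ} {Φ X Y : H → E} {x : H}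
    {m k : WithTop ℕ∞} (hB : ContDiffAt ℝ k B (Φ x)) (hmk : m + 1 ≤ k)
    (hi : (B (Φ x)).IsInvertible) (hΦ : ContDiffAt ℝ m Φ x) (hX : ContDiffAt ℝ m X x)
    (hY : ContDiffAt ℝ m Y x) : ContDiffAt ℝ m (fun z => chrVec B (Φ z) (X z) (Y z)) x := by
  have h1 : ContDiffAt ℝ m (fun z => fderiv ℝ B (Φ z)) x := (hB.fderiv_right hmk).comp x hΦ
  have h0 : ContDiffAt ℝ m B (Φ x) := hB.of_le (le_self_add.trans hmk)
  obtain ⟨e, he⟩ := hi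
  have hinv : ContDiffAt ℝ m (fun z => (B (Φ z)).inverse) x := by
    have := contDiffAt_map_inverse (𝕜 := ℝ) (n := m) e
    rw [he] at this
    exact this.comp x (h0.comp x hΦ)
  have hform : ContDiffAt ℝ m (fun z => chrForm B (Φ z) (X z) (Y z)) x := by
    unfold chrForm
    have hf : ContDiffAt ℝ m (fun z => ((fderiv ℝ B (Φ z)).flip (X z)).flip (Y z)) x := by
      have := ((ContinuousLinearMap.flipₗᵢ ℝ E E ℝ).contDiff.contDiffAt.comp x
        (((ContinuousLinearMap.flipₗᵢ ℝ E E (E →L[ℝ] ℝ)).contDiff.contDiffAt.comp x h1).clm_apply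
        hX : ContDiffAt ℝ m (fun z => (fderiv ℝ B (Φ z)).flip (X z)) x)).clm_apply hY
      exact this
    exact ContDiffAt.const_smul _ ((((h1.clm_apply hX).clm_apply hY).add
      ((h1.clm_apply hY).clm_apply hX)).sub hf)
  exact hinv.clm_apply hform

theorem contDiffAt_chrVec {B : E → E →L[ℝ] E →L[ℝ] ℝ} {x : E} {m k : WithTop ℕ∞}
    (hB : ContDiffAt ℝ k B x) (hmk : m + 1 ≤ k) (hi : (B x).IsInvertible) (u v : E) :
    ContDiffAt ℝ m (fun z => chrVec B z u v) x :=
  contDiffAt_chrVec_comp (Φ := fun z => z) hB hmk hi contDiffAt_id contDiffAt_const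
    contDiffAt_const

/-- The curvature of `B` through the Christoffel symbols of the second kind. -/
theorem form_curvature_eq_curv {B : E → E →L[ℝ] E →L[ℝ] ℝ} {x : E}
    (hB : ContDiffAt ℝ 2 B x) (hs : ∀ᶠ z in 𝓝 x, ∀ u v, B z u v = B z v u)
    (hi : ∀ᶠ z in 𝓝 x, (B z).IsInvertible) (a u v w : E) :
    B x (fderiv ℝ (fun z => chrVec B z u v) x a - fderiv ℝ (fun z => chrVec B z a v) x u
      + chrVec B x a (chrVec B x u v) - chrVec B x u (chrVec B x a v)) w = curv B x a u v w := by
  have hBd : DifferentiableAt ℝ B x := hB.differentiableAt (by norm_num)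
  have key (a u v w : E) : fderiv ℝ (fun z => chr B z u v w) x a =
      B x (fderiv ℝ (fun z => chrVec B z u v) x a) w + chr B x a (chrVec B x u v) w
        + chr B x a w (chrVec B x u v) := by
    have hd : DifferentiableAt ℝ (fun z => chrVec B z u v) x :=
      (contDiffAt_chrVec (m := 1) hB (by norm_num) hi.self_of_nhds u v).differentiableAt
        (by norm_num)
    have e : (fun z => chr B z u v w) =ᶠ[𝓝 x] fun z => B z (chrVec B z u v) w :=
      hi.mono fun z hz => (apply_chrVec hz u v w).symm
    rw [e.fderiv_eq, (hasFDerivAt_form_apply (Φ := fun z => z) hBd (hasFDerivAt_id x)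
      hd.hasFDerivAt (hasFDerivAt_const w x) a).2, fderiv_eq_chr_add_chr hBd hs]
    simp
    ring
  have hi0 := hi.self_of_nhds
  simp only [curv, key, map_add, map_sub, add_apply, sub_apply, apply_chrVec hi0]
  ring

end Frames

/-! ### The scalar curvature as a trace over an orthonormal frame -/

section Coordinates

variable {n : ℕ}

local notation "𝔼" => EuclideanSpace ℝ (Fin n)

theorem sum_smul_single (v : 𝔼) : ∑ i, v i • (EuclideanSpace.single i (1 : ℝ) : 𝔼) = v := by
  ext j
  simp [Finset.sum_apply, Pi.single_apply]

theorem _root_.IsLinearMap.eq_sum_single {f : 𝔼 → ℝ} (hf : IsLinearMap ℝ f) (v : 𝔼) :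
    f v = ∑ i, v i * f (EuclideanSpace.single i 1) := by
  conv_lhs => rw [← sum_smul_single v]
  calc _ = ∑ i, f (v i • EuclideanSpace.single i 1) := map_sum (hf.mk' f) _ _
    _ = _ := by simp [hf.map_smul]

theorem pderiv_congr {f f' : 𝔼 → ℝ} {y : 𝔼} (h : f =ᶠ[𝓝 y] f') (i : Fin n) :
    pderiv i f y = pderiv i f' y := by
  simp only [pderiv, h.fderiv_eq]

theorem christoffel_congr {G G' : 𝔼 → Matrix (Fin n) (Fin n) ℝ} {y : 𝔼} (h : G =ᶠ[𝓝 y] G')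
    (k i j : Fin n) : christoffel G k i j y = christoffel G' k i j y := by
  have key (a b : Fin n) : (fun z => G z a b) =ᶠ[𝓝 y] fun z => G' z a b :=
    h.mono fun z hz => by simp only [hz]
  simp only [christoffel, h.eq_of_nhds, pderiv_congr (key _ _)]

theorem coordScalar_congr {G G' : 𝔼 → Matrix (Fin n) (Fin n) ℝ} {y : 𝔼} (h : G =ᶠ[𝓝 y] G') :
    coordScalar G y = coordScalar G' y := by
  have key (k i j : Fin n) : christoffel G k i j =ᶠ[𝓝 y] christoffel G' k i j :=
    h.eventuallyEq_nhds.mono fun z hz => christoffel_congr hz k i j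
  simp only [coordScalar, coordRicci, h.eq_of_nhds, pderiv_congr (key _ _ _),
    christoffel_congr h]

/-- The components of a bilinear form in the standard basis. -/
noncomputable def formMatrix (B : 𝔼 →L[ℝ] 𝔼 →L[ℝ] ℝ) : Matrix (Fin n) (Fin n) ℝ :=
  Matrix.of fun i j => B (EuclideanSpace.single i 1) (EuclideanSpace.single j 1)

theorem form_eq_sum (B : 𝔼 →L[ℝ] 𝔼 →L[ℝ] ℝ) (u v : 𝔼) :
    B u v = ∑ i, ∑ j, u i * v j * formMatrix B i j := by
  have h1 : IsLinearMap ℝ fun u => B u v := ⟨by simp, by simp⟩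
  rw [h1.eq_sum_single]
  refine Finset.sum_congr rfl fun i _ => ?_
  have h2 : IsLinearMap ℝ fun v => B (EuclideanSpace.single i 1) v := ⟨by simp, by simp⟩
  rw [h2.eq_sum_single, Finset.mul_sum]
  exact Finset.sum_congr rfl fun j _ => by simp only [formMatrix, Matrix.of_apply]; ring

theorem isUnit_det_formMatrix {B : 𝔼 →L[ℝ] 𝔼 →L[ℝ] ℝ} (hi : B.IsInvertible) :
    IsUnit (formMatrix B).det := by
  rw [isUnit_iff_ne_zero]
  intro h0
  obtain ⟨v, hv, hv0⟩ := Matrix.exists_vecMul_eq_zero_iff.2 h0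
  apply hv
  have : WithLp.toLp 2 v = (0 : 𝔼) := by
    apply hi.injective
    ext w
    rw [form_eq_sum, map_zero, zero_apply, Finset.sum_comm]
    refine Finset.sum_eq_zero fun j _ => ?_
    have := congrFun hv0 j
    simp only [Matrix.vecMul, dotProduct, Pi.zero_apply] at this
    calc _ = w j * ∑ i, v i * formMatrix B i j := by
          rw [Finset.mul_sum]; exact Finset.sum_congr rfl fun i _ => by simp; ring
      _ = 0 := by rw [this, mul_zero]
  simpa using congrArg WithLp.ofLp this

theorem christoffel_eq_chrVec {B : 𝔼 → 𝔼 →L[ℝ] 𝔼 →L[ℝ] ℝ} {y : 𝔼}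
    (hB : DifferentiableAt ℝ B y) (hs : ∀ u v, B y u v = B y v u)
    (hi : (B y).IsInvertible) (k i j : Fin n) :
    christoffel (fun z => formMatrix (B z)) k i j y =
      chrVec B y (EuclideanSpace.single i 1) (EuclideanSpace.single j 1) k := by
  have hp (a b c : Fin n) : pderiv a (fun z => formMatrix (B z) b c) y =
      fderiv ℝ B y (EuclideanSpace.single a 1) (EuclideanSpace.single b 1)
        (EuclideanSpace.single c 1) := fderiv_apply_apply hB _ _ _
  set X := chrVec B y (EuclideanSpace.single i 1) (EuclideanSpace.single j 1) with hX
  have hc (l : Fin n) : ∑ m, formMatrix (B y) l m * X m =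
      chr B y (EuclideanSpace.single i 1) (EuclideanSpace.single j 1)
        (EuclideanSpace.single l 1) := by
    rw [← apply_chrVec hi, ← hX, hs, IsLinearMap.eq_sum_single (f := fun v => B y _ v)
      ⟨by simp, by simp⟩]
    exact Finset.sum_congr rfl fun m _ => by simp [formMatrix, mul_comm]
  have hmv : (formMatrix (B y)).mulVec X = fun l => chr B y (EuclideanSpace.single i 1)
      (EuclideanSpace.single j 1) (EuclideanSpace.single l 1) := funext hc
  have hX' : (X : Fin n → ℝ) = (formMatrix (B y))⁻¹.mulVec ((formMatrix (B y)).mulVec X) := by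
    rw [Matrix.mulVec_mulVec, Matrix.nonsing_inv_mul _ (isUnit_det_formMatrix hi),
      Matrix.one_mulVec]
  rw [hX', hmv]
  simp only [christoffel, hp, Matrix.mulVec, dotProduct, chr, Finset.mul_sum]
  exact Finset.sum_congr rfl fun l _ => by ring

theorem formMatrix_inv_apply {B : 𝔼 →L[ℝ] 𝔼 →L[ℝ] ℝ} {b : Fin n → 𝔼}
    (hb : ∀ a c, B (b a) (b c) = if a = c then 1 else 0) (i j : Fin n) :
    (formMatrix B)⁻¹ i j = ∑ a, b a i * b a j := by
  set Q : Matrix (Fin n) (Fin n) ℝ := Matrix.of fun i a => b a i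
  have h1 : (Q.transpose * formMatrix B) * Q = 1 := by
    ext a c
    rw [Matrix.one_apply, ← hb, form_eq_sum]
    simp only [Matrix.mul_apply, Q, Matrix.transpose_apply, Matrix.of_apply, Finset.sum_mul]
    rw [Finset.sum_comm]
    exact Finset.sum_congr rfl fun i _ => Finset.sum_congr rfl fun j _ => by ring
  have h2 : (Q * Q.transpose) * formMatrix B = 1 := by
    rw [Matrix.mul_assoc, mul_eq_one_comm, h1]
  rw [Matrix.inv_eq_left_inv h2]
  simp [Matrix.mul_apply, Q]

/-- A vector is recovered from its products with an orthonormal frame. -/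
theorem sum_form_smul_frame {B : 𝔼 →L[ℝ] 𝔼 →L[ℝ] ℝ} {b : Fin n → 𝔼} (hs : ∀ u v, B u v = B v u)
    (hi : B.IsInvertible) (hb : ∀ a c, B (b a) (b c) = if a = c then 1 else 0) (v : 𝔼) :
    ∑ c, B v (b c) • b c = v := by
  ext k
  have h := congrFun (congrArg (fun A => A.mulVec (v : Fin n → ℝ))
    (Matrix.nonsing_inv_mul _ (isUnit_det_formMatrix hi))) k
  rw [Matrix.one_mulVec, ← Matrix.mulVec_mulVec] at h
  rw [← h]
  simp only [WithLp.ofLp_sum, Finset.sum_apply, WithLp.ofLp_smul, Pi.smul_apply, smul_eq_mul,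
    Matrix.mulVec, dotProduct, formMatrix_inv_apply hb, Finset.sum_mul]
  rw [Finset.sum_comm]
  refine Finset.sum_congr rfl fun c _ => ?_
  rw [hs, form_eq_sum, Finset.sum_mul]
  refine Finset.sum_congr rfl fun i _ => ?_
  rw [Finset.sum_mul, Finset.mul_sum]
  exact Finset.sum_congr rfl fun j _ => by ring

/-- The scalar curvature in coordinates is the double trace of the curvature tensor over any
orthonormal frame. -/
theorem coordScalar_eq_sum_curv {B : 𝔼 → 𝔼 →L[ℝ] 𝔼 →L[ℝ] ℝ} {y : 𝔼} (hB : ContDiffAt ℝ 2 B y)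
    (hs : ∀ᶠ z in 𝓝 y, ∀ u v, B z u v = B z v u) (hi : ∀ᶠ z in 𝓝 y, (B z).IsInvertible)
    {b : Fin n → 𝔼} (hb : ∀ a c, B y (b a) (b c) = if a = c then 1 else 0) :
    coordScalar (fun z => formMatrix (B z)) y =
      ∑ a, ∑ c, curv B y (b c) (b a) (b a) (b c) := by
  set e : Fin n → 𝔼 := fun i => EuclideanSpace.single i 1 with he
  have hBd : DifferentiableAt ℝ B y := hB.differentiableAt (by norm_num)
  have hs0 := hs.self_of_nhds
  have hi0 := hi.self_of_nhds
  have hch : ∀ᶠ z in 𝓝 y, ∀ k i j, christoffel (fun z => formMatrix (B z)) k i j z =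
      chrVec B z (e i) (e j) k := by
    filter_upwards [hB.eventually (by norm_num), hs, hi] with z h1 h2 h3 k i j
    exact christoffel_eq_chrVec (h1.differentiableAt (by norm_num)) h2 h3 k i j
  have hsym : ∀ᶠ z in 𝓝 y, ∀ u v, chrVec B z u v = chrVec B z v u := by
    filter_upwards [hB.eventually (by norm_num), hs.eventually_nhds, hi] with z h1 h2 h3 u v
    apply h3.injective
    ext w
    rw [apply_chrVec h3, apply_chrVec h3]
    exact chr_symm (h1.differentiableAt (by norm_num)) h2 u v w
  have hsym0 := hsym.self_of_nhds
  have hd (u v : 𝔼) : DifferentiableAt ℝ (fun z => chrVec B z u v) y :=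
    (contDiffAt_chrVec (m := 1) hB (by norm_num) hi0 u v).differentiableAt (by norm_num)
  have hpd (l k i j : Fin n) : pderiv l (christoffel (fun z => formMatrix (B z)) k i j) y =
      fderiv ℝ (fun z => chrVec B z (e i) (e j)) y (e l) k := by
    rw [pderiv_congr (hch.mono fun z hz => hz k i j)]
    have := ((EuclideanSpace.proj (𝕜 := ℝ) k).hasFDerivAt.comp y (hd (e i) (e j)).hasFDerivAt)
    have h2 := this.fderiv
    simp only [Function.comp_def] at h2
    unfold pderiv
    erw [h2]
    simp [he]
  -- the curvature vector `R(a, u)v`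
  set R : 𝔼 → 𝔼 → 𝔼 → 𝔼 := fun a u v =>
    fderiv ℝ (fun z => chrVec B z u v) y a - fderiv ℝ (fun z => chrVec B z a v) y u
      + chrVec B y a (chrVec B y u v) - chrVec B y u (chrVec B y a v) with hR
  have hRc (a u v w : 𝔼) : B y (R a u v) w = curv B y a u v w :=
    form_curvature_eq_curv hB hs hi a u v w
  have hsum (k i : Fin n) (v : 𝔼) :
      ∑ l, chrVec B y (e i) (e l) k * v l = chrVec B y (e i) v k := by
    have hl : IsLinearMap ℝ fun w => chrVec B y (e i) w k :=
      ⟨fun u v => by simp [(chrVec_isLinearMap_right B y (e i)).map_add],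
        fun c v => by simp [(chrVec_isLinearMap_right B y (e i)).map_smul]⟩
    rw [hl.eq_sum_single]
    exact Finset.sum_congr rfl fun l _ => mul_comm _ _
  have hric (i j : Fin n) : coordRicci (fun z => formMatrix (B z)) i j y =
      ∑ k, R (e k) (e j) (e i) k := by
    simp only [coordRicci, hpd, hch.self_of_nhds, Finset.sum_sub_distrib]
    simp only [hsum, hR]
    rw [← Finset.sum_sub_distrib, ← Finset.sum_sub_distrib, ← Finset.sum_add_distrib]
    refine Finset.sum_congr rfl fun k _ => ?_
    have h1 : (fun z => chrVec B z (e j) (e i)) =ᶠ[𝓝 y] fun z => chrVec B z (e i) (e j) :=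
      hsym.mono fun z hz => hz _ _
    have h2 : (fun z => chrVec B z (e k) (e i)) =ᶠ[𝓝 y] fun z => chrVec B z (e i) (e k) :=
      hsym.mono fun z hz => hz _ _
    rw [h1.fderiv_eq, h2.fderiv_eq, hsym0 (e j) (e i), hsym0 (e k) (e i)]
    simp
    ring
  have htr (i j : Fin n) : ∑ k, R (e k) (e j) (e i) k =
      ∑ c, curv B y (b c) (e j) (e i) (b c) := by
    calc _ = ∑ k, ∑ c, b c k * curv B y (e k) (e j) (e i) (b c) := by
          refine Finset.sum_congr rfl fun k _ => ?_
          conv_lhs => rw [← sum_form_smul_frame hs0 hi0 hb (R (e k) (e j) (e i))]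
          simp only [hRc, WithLp.ofLp_sum, Finset.sum_apply, WithLp.ofLp_smul, Pi.smul_apply,
            smul_eq_mul]
          exact Finset.sum_congr rfl fun c _ => mul_comm _ _
      _ = _ := by
          rw [Finset.sum_comm]
          refine Finset.sum_congr rfl fun c _ => ?_
          rw [(curv_isLinearMap₁ hB (e j) (e i) (b c)).eq_sum_single (b c)]
  simp only [coordScalar, hric, htr, formMatrix_inv_apply hb]
  calc _ = ∑ i, ∑ j, ∑ a, ∑ c, b a i * b a j * curv B y (b c) (e j) (e i) (b c) := by
        simp only [Finset.sum_mul, Finset.mul_sum]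
        refine Finset.sum_congr rfl fun i _ => Finset.sum_congr rfl fun j _ => ?_
        rw [Finset.sum_comm]
    _ = ∑ a, ∑ c, ∑ i, ∑ j, b a i * b a j * curv B y (b c) (e j) (e i) (b c) := by
        rw [Finset.sum_congr rfl fun i _ => Finset.sum_comm, Finset.sum_comm]
        refine Finset.sum_congr rfl fun a _ => ?_
        rw [Finset.sum_congr rfl fun i _ => Finset.sum_comm, Finset.sum_comm]
    _ = _ := by
        refine Finset.sum_congr rfl fun a _ => Finset.sum_congr rfl fun c _ => ?_
        rw [(curv_isLinearMap₃ hB (b c) (b a) (b c)).eq_sum_single (b a)]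
        refine Finset.sum_congr rfl fun i _ => ?_
        rw [(curv_isLinearMap₂ hB (b c) _ (b c)).eq_sum_single (b a), Finset.mul_sum]
        exact Finset.sum_congr rfl fun j _ => by ring

end Coordinates

/-! ### Smooth maps acting on spaces of continuous functions -/

section Composition

universe u

variable {X : Type*} [TopologicalSpace X] [CompactSpace X]

set_option synthInstance.maxHeartbeats 200000

/-- Pointwise application of a continuous family of linear maps to a continuous family of
vectors. -/
noncomputable def applyPointwise {V W : Type*} [NormedAddCommGroup V] [NormedSpace ℝ V]
    [NormedAddCommGroup W] [NormedSpace ℝ W] (A : C(X, V →L[ℝ] W)) (h : C(X, V)) : C(X, W) :=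
  ⟨fun t => A t (h t), A.continuous.clm_apply h.continuous⟩

theorem norm_applyPointwise_le {V W : Type*} [NormedAddCommGroup V] [NormedSpace ℝ V]
    [NormedAddCommGroup W] [NormedSpace ℝ W] (A : C(X, V →L[ℝ] W)) (h : C(X, V)) :
    ‖applyPointwise A h‖ ≤ ‖A‖ * ‖h‖ := by
  have hA : 0 ≤ ‖A‖ := norm_nonneg A
  have hh : 0 ≤ ‖h‖ := norm_nonneg h
  rw [ContinuousMap.norm_le _ (mul_nonneg hA hh)]
  intro t
  have h1 : ‖A t‖ ≤ ‖A‖ := A.norm_coe_le_norm t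
  have h2 : ‖h t‖ ≤ ‖h‖ := h.norm_coe_le_norm t
  exact ((A t).le_opNorm (h t)).trans (mul_le_mul h1 h2 (norm_nonneg _) hA)

/-- Pointwise application, as a continuous bilinear map. -/
noncomputable def pointwiseApply (X : Type*) [TopologicalSpace X] [CompactSpace X]
    (V W : Type*) [NormedAddCommGroup V] [NormedSpace ℝ V]
    [NormedAddCommGroup W] [NormedSpace ℝ W] : C(X, V →L[ℝ] W) →L[ℝ] C(X, V) →L[ℝ] C(X, W) :=
  LinearMap.mkContinuous₂
    (LinearMap.mk₂ ℝ (fun (A : C(X, V →L[ℝ] W)) (h : C(X, V)) => applyPointwise A h)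
      (fun _ _ _ => by ext t; simp [applyPointwise]) (fun _ _ _ => by ext t; simp [applyPointwise])
      (fun _ _ _ => by ext t; simp [applyPointwise])
      (fun _ _ _ => by ext t; simp [applyPointwise])) 1 (by
    intro A h
    rw [one_mul]
    exact norm_applyPointwise_le A h)

/-- The error in the linear approximation is uniform on `X` because the derivative of `f` is
uniformly continuous near the compact range of `z`. -/
theorem hasFDerivAt_postcomp {V W : Type*} [NormedAddCommGroup V] [NormedSpace ℝ V]
    [NormedAddCommGroup W] [NormedSpace ℝ W] (f : C(V, W)) (f' : C(V, V →L[ℝ] W))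
    (h : ∀ x, HasFDerivAt f (f' x) x) (z : C(X, V)) :
    HasFDerivAt (fun z : C(X, V) => f.comp z) (pointwiseApply X V W (f'.comp z)) z := by
  rw [hasFDerivAt_iff_isLittleO, Asymptotics.isLittleO_iff]
  intro ε hε
  have hK : IsCompact (range z) := isCompact_range z.continuous
  have hu := hK.uniformContinuousAt_of_continuousAt f' (fun a _ => f'.continuous.continuousAt)
    (Metric.dist_mem_uniformity hε)
  obtain ⟨δ, hδ, hsub⟩ := Metric.mem_uniformity_dist.1 hu
  filter_upwards [Metric.ball_mem_nhds z hδ] with y hy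
  rw [ContinuousMap.norm_le _ (by positivity)]
  intro t
  have hyt : Dist.dist (y t) (z t) < δ := (ContinuousMap.dist_apply_le_dist t).trans_lt hy
  have := Convex.norm_image_sub_le_of_norm_hasFDerivWithin_le' (𝕜 := ℝ) (f := f) (f' := f')
    (s := Metric.ball (z t) δ) (φ := f' (z t)) (C := ε) (x := z t) (y := y t)
    (fun x _ => (h x).hasFDerivWithinAt)
    (fun x hx => by
      have := hsub (a := z t) (b := x) (by rwa [_root_.dist_comm]) (mem_range_self t)
      rw [mem_ofPred_eq, _root_.dist_comm, dist_eq_norm] at this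
      exact this.le)
    (convex_ball _ _) (Metric.mem_ball_self hδ) hyt
  refine this.trans ?_
  gcongr
  exact (y - z).norm_coe_le_norm t

/-- Composition on the left with a smooth map is a smooth map between spaces of continuous
functions on a compact space. -/
theorem contDiff_postcomp {V W : Type u} [NormedAddCommGroup V] [NormedSpace ℝ V]
    [NormedAddCommGroup W] [NormedSpace ℝ W] (f : C(V, W)) (hf : ContDiff ℝ ∞ f) :
    ContDiff ℝ ∞ (fun z : C(X, V) => f.comp z) := by
  rw [contDiff_infty]
  intro n
  induction n generalizing W with
  | zero => exact contDiff_zero.2 (ContinuousMap.continuous_postcomp f)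
  | succ n ih =>
    have hf' : ContDiff ℝ ∞ (fderiv ℝ f) := hf.fderiv_right (by simp)
    push_cast
    rw [contDiff_succ_iff_hasFDerivAt]
    refine ⟨fun z => pointwiseApply X V W
      ((⟨fderiv ℝ f, hf'.continuous⟩ : C(V, V →L[ℝ] W)).comp z), ?_, fun z => ?_⟩
    · exact (pointwiseApply X V W).contDiff.comp (ih ⟨fderiv ℝ f, hf'.continuous⟩ hf')
    · exact hasFDerivAt_postcomp f ⟨fderiv ℝ f, hf'.continuous⟩
        (fun x => (hf.differentiable (by simp) x).hasFDerivAt) z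

end Composition

/-! ### Primitives of continuous functions -/

section Primitives

universe u

variable {E : Type u} [NormedAddCommGroup E] [NormedSpace ℝ E]

local notation "𝕀" => Icc (0 : ℝ) 1

/-- The primitive `t ↦ ∫₀ᵗ a` of a continuous function on `[0, 1]`. -/
noncomputable def primitive (a : C(𝕀, E)) (t : ℝ) : E :=
  ∫ s in (0 : ℝ)..t, IccExtend zero_le_one a s

theorem continuous_extend (a : C(𝕀, E)) : Continuous (IccExtend (zero_le_one (α := ℝ)) a) :=
  a.continuous.Icc_extend'

theorem norm_extend_le (a : C(𝕀, E)) (s : ℝ) : ‖IccExtend (zero_le_one (α := ℝ)) a s‖ ≤ ‖a‖ :=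
  a.norm_coe_le_norm _

theorem norm_primitive_le (a : C(𝕀, E)) {t : ℝ} (ht : t ∈ 𝕀) : ‖primitive a t‖ ≤ ‖a‖ := by
  refine (intervalIntegral.norm_integral_le_of_norm_le_const
    (fun s _ => norm_extend_le a s)).trans ?_
  rw [sub_zero, abs_of_nonneg ht.1]
  exact mul_le_of_le_one_right (norm_nonneg _) ht.2

theorem primitive_add (a b : C(𝕀, E)) (t : ℝ) :
    primitive (a + b) t = primitive a t + primitive b t := by
  unfold primitive
  rw [← intervalIntegral.integral_add ((continuous_extend a).intervalIntegrable _ _)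
    ((continuous_extend b).intervalIntegrable _ _)]
  rfl

theorem primitive_smul (c : ℝ) (a : C(𝕀, E)) (t : ℝ) :
    primitive (c • a) t = c • primitive a t := by
  unfold primitive
  rw [← intervalIntegral.integral_smul]
  rfl

@[simp]
theorem primitive_zero (t : ℝ) : primitive (0 : C(𝕀, E)) t = 0 := by
  simpa using primitive_smul (0 : ℝ) (0 : C(𝕀, E)) t

variable [CompleteSpace E]

theorem hasDerivAt_primitive (a : C(𝕀, E)) (t : ℝ) :
    HasDerivAt (primitive a) (IccExtend zero_le_one a t) t :=
  intervalIntegral.integral_hasDerivAt_right ((continuous_extend a).intervalIntegrable _ _)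
    ((continuous_extend a).stronglyMeasurableAtFilter _ _) (continuous_extend a).continuousAt

theorem continuous_primitive (a : C(𝕀, E)) : Continuous (primitive a) :=
  continuous_iff_continuousAt.2 fun t => (hasDerivAt_primitive a t).continuousAt

/-- The primitive, as an endomorphism of the space of continuous functions on `[0, 1]`. -/
noncomputable def primitiveMap (a : C(𝕀, E)) : C(𝕀, E) :=
  ⟨fun t => primitive a t, (continuous_primitive a).comp continuous_subtype_val⟩

@[simp]
theorem primitiveMap_zero : primitiveMap (0 : C(𝕀, E)) = 0 := by
  ext t; exact primitive_zero _

/-- Position and velocity of the path with initial position `w.1.1`, initial velocity `w.1.2` and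
acceleration `w.2`. -/
noncomputable def pathState : (E × E) × C(𝕀, E) →L[ℝ] C(𝕀, E × E) :=
  LinearMap.mkContinuous
    { toFun := fun w => ⟨fun t => (w.1.1 + (t : ℝ) • w.1.2 + primitive (primitiveMap w.2) t,
        w.1.2 + primitive w.2 t), by
          have h1 := (continuous_primitive w.2).comp (continuous_subtype_val (p := (· ∈ 𝕀)))
          have h2 := (continuous_primitive (primitiveMap w.2)).comp
            (continuous_subtype_val (p := (· ∈ 𝕀)))
          simp only [Function.comp_def] at h1 h2
          fun_prop⟩
      map_add' := fun w w' => by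
        have : primitiveMap (w.2 + w'.2) = primitiveMap w.2 + primitiveMap w'.2 := by
          ext t; exact primitive_add _ _ _
        ext t <;> simp [primitive_add, this] <;> abel
      map_smul' := fun c w => by
        have : primitiveMap (c • w.2) = c • primitiveMap w.2 := by
          ext t; exact primitive_smul _ _ _
        ext t <;> simp [primitive_smul, this, smul_comm c] }
    3 (by
      intro w
      rw [ContinuousMap.norm_le _ (by positivity)]
      intro t
      have h1 : ‖w.1.1‖ ≤ ‖w‖ := (norm_fst_le w.1).trans (norm_fst_le w)
      have h2 : ‖w.1.2‖ ≤ ‖w‖ := (norm_snd_le w.1).trans (norm_fst_le w)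
      have h3 : ‖w.2‖ ≤ ‖w‖ := norm_snd_le w
      have h4 : ‖primitive w.2 t‖ ≤ ‖w.2‖ := norm_primitive_le _ t.2
      have h5 : ‖primitive (primitiveMap w.2) t‖ ≤ ‖w.2‖ :=
        (norm_primitive_le _ t.2).trans ((ContinuousMap.norm_le _ (norm_nonneg _)).2
          fun s => norm_primitive_le w.2 s.2)
      have h6 : ‖(t : ℝ) • w.1.2‖ ≤ ‖w.1.2‖ := by
        rw [norm_smul, Real.norm_eq_abs, abs_of_nonneg t.2.1]
        exact mul_le_of_le_one_left (norm_nonneg _) t.2.2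
      have h0 := norm_nonneg w
      refine max_le ((norm_add₃_le).trans (by linarith)) ((norm_add_le _ _).trans ?_)
      linarith)

theorem pathState_apply (w : (E × E) × C(𝕀, E)) (t : 𝕀) :
    pathState w t = (w.1.1 + (t : ℝ) • w.1.2 + primitive (primitiveMap w.2) t,
        w.1.2 + primitive w.2 t) := rfl

end Primitives

/-! ### Short geodesics -/

section ShortGeodesics

set_option synthInstance.maxHeartbeats 200000

universe u

variable {E : Type u} [NormedAddCommGroup E] [NormedSpace ℝ E]

local notation "𝕀" => Icc (0 : ℝ) 1

/-- The quadratic term `Γ(x)(u, u)` of the geodesic equation, as a function of `(x, u)`. -/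
noncomputable def spray (B : E → E →L[ℝ] E →L[ℝ] ℝ) (z : E × E) : E := chrVec B z.1 z.2 z.2

theorem spray_smul (B : E → E →L[ℝ] E →L[ℝ] ℝ) (x u : E) (c : ℝ) :
    spray B (x, c • u) = c ^ 2 • spray B (x, u) := by
  simp only [spray, (chrVec_isLinearMap_left B x _).map_smul,
    (chrVec_isLinearMap_right B x _).map_smul, smul_smul, sq]

variable [CompleteSpace E]

theorem contDiff_spray {B : E → E →L[ℝ] E →L[ℝ] ℝ} (hB : ContDiff ℝ ∞ B)
    (hi : ∀ x, (B x).IsInvertible) : ContDiff ℝ ∞ (spray B) :=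
  contDiff_iff_contDiffAt.2 fun z => contDiffAt_chrVec_comp hB.contDiffAt (by simp) (hi _)
    contDiffAt_fst contDiffAt_snd contDiffAt_snd

/-- The spray is quadratic in the velocity, so its differential vanishes at velocity `0`. -/
theorem fderiv_spray_zero {B : E → E →L[ℝ] E →L[ℝ] ℝ} (hB : ContDiff ℝ ∞ B)
    (hi : ∀ x, (B x).IsInvertible) (p : E) : fderiv ℝ (spray B) (p, 0) = 0 := by
  have hd := (contDiff_spray hB hi).differentiable (by simp)
  refine ContinuousLinearMap.ext fun w => ?_
  obtain ⟨x, u⟩ := w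
  have hl (t : ℝ) : HasDerivAt (fun t : ℝ => (p + t • x, u)) (x, 0) t := by
    have h1 : HasDerivAt (fun t : ℝ => p + t • x) x t := by
      simpa using ((hasDerivAt_id t).smul_const x).const_add p
    exact h1.prodMk (hasDerivAt_const t u)
  have hl' : HasDerivAt (fun t : ℝ => (p + t • x, t • u)) (x, u) 0 := by
    have h1 : HasDerivAt (fun t : ℝ => p + t • x) x 0 := by
      simpa using ((hasDerivAt_id (0 : ℝ)).smul_const x).const_add p
    have h2 : HasDerivAt (fun t : ℝ => t • u) u 0 := by
      simpa using ((hasDerivAt_id (0 : ℝ)).smul_const u)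
    exact h1.prodMk h2
  have e1 : HasDerivAt (fun t : ℝ => spray B (p + t • x, t • u))
      (fderiv ℝ (spray B) (p, 0) (x, u)) 0 := by
    have := (hd (p + (0 : ℝ) • x, (0 : ℝ) • u)).hasFDerivAt.comp_hasDerivAt (0 : ℝ) hl'
    simpa [Function.comp_def] using this
  have e2 : HasDerivAt (fun t : ℝ => spray B (p + t • x, t • u)) 0 0 := by
    simp only [spray_smul]
    have h1 := (hd (p + (0 : ℝ) • x, u)).hasFDerivAt.comp_hasDerivAt (0 : ℝ) (hl 0)
    have h2 := (hasDerivAt_pow 2 (0 : ℝ)).fun_smul h1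
    simpa using h2
  simpa using e1.unique e2

/-- The map whose zeros in the second component are the accelerations of geodesics, as a
perturbation of the identity. -/
noncomputable def geodesicMap (s : C(E × E, E)) (w : (E × E) × C(𝕀, E)) : (E × E) × C(𝕀, E) :=
  (w.1, w.2 + s.comp (pathState w))

theorem contDiff_geodesicMap (s : C(E × E, E)) (hs : ContDiff ℝ ∞ s) :
    ContDiff ℝ ∞ (geodesicMap s) :=
  contDiff_fst.prodMk (contDiff_snd.add ((contDiff_postcomp s hs).comp (pathState (E := E)).contDiff))

theorem hasFDerivAt_geodesicMap {s : C(E × E, E)} (hs : ContDiff ℝ ∞ s) {p : E}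
    (h0 : fderiv ℝ s (p, 0) = 0) :
    HasFDerivAt (geodesicMap s)
      ((ContinuousLinearEquiv.refl ℝ ((E × E) × C(𝕀, E)) : _ ≃L[ℝ] _) :
        ((E × E) × C(𝕀, E)) →L[ℝ] ((E × E) × C(𝕀, E))) ((p, 0), 0) := by
  have hc : Continuous (fderiv ℝ s) := hs.continuous_fderiv (by simp)
  have e : (⟨fderiv ℝ s, hc⟩ : C(E × E, (E × E) →L[ℝ] E)).comp
      (pathState (((p, 0), 0) : (E × E) × C(𝕀, E))) = 0 := by
    ext1 t
    simp [pathState_apply, h0]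
  have h1 := hasFDerivAt_postcomp s ⟨fderiv ℝ s, hc⟩
    (fun x => (hs.differentiable (by simp) x).hasFDerivAt)
    (pathState (((p, 0), 0) : (E × E) × C(𝕀, E)))
  rw [e, map_zero] at h1
  have h2 := h1.comp ((p, 0), 0) (pathState (E := E)).hasFDerivAt
  have h3 := (hasFDerivAt_fst (𝕜 := ℝ) (p := (((p, 0), 0) : (E × E) × C(𝕀, E)))).prodMk
    ((hasFDerivAt_snd (𝕜 := ℝ) (p := (((p, 0), 0) : (E × E) × C(𝕀, E)))).add h2)
  have e3 : (ContinuousLinearMap.fst ℝ (E × E) C(𝕀, E)).prod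
      (ContinuousLinearMap.snd ℝ (E × E) C(𝕀, E) + (0 : C(𝕀, E × E) →L[ℝ] C(𝕀, E)) ∘L pathState) =
      ((ContinuousLinearEquiv.refl ℝ ((E × E) × C(𝕀, E)) : _ ≃L[ℝ] _) :
        ((E × E) × C(𝕀, E)) →L[ℝ] ((E × E) × C(𝕀, E))) := by
    refine ContinuousLinearMap.ext fun w => ?_
    simp
  rw [e3] at h3
  exact h3

/-- Short geodesics: the accelerations solve a fixed point equation in the Banach space of
continuous functions, and depend smoothly on the initial position and velocity. -/
theorem exists_geodesic_acceleration {s : C(E × E, E)} (hs : ContDiff ℝ ∞ s) {p : E}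
    (h0 : fderiv ℝ s (p, 0) = 0) (hs0 : s (p, 0) = 0) :
    ∃ ψ : E × E → C(𝕀, E), ContDiffAt ℝ ∞ ψ (p, 0) ∧ ψ (p, 0) = 0 ∧
      (∀ᶠ w in 𝓝 (p, 0), ContDiffAt ℝ ∞ ψ w) ∧
      (∀ᶠ w in 𝓝 (p, 0), ψ w + s.comp (pathState (w, ψ w)) = 0) ∧
      ∀ᶠ w in 𝓝 ((p, 0), 0), w.2 + s.comp (pathState w) = 0 → w.2 = ψ w.1 := by
  set x0 : (E × E) × C(𝕀, E) := ((p, 0), 0) with hx0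
  have hcd := contDiff_geodesicMap s hs
  have hd := hasFDerivAt_geodesicMap hs h0
  set e := hcd.contDiffAt.toOpenPartialHomeomorph (geodesicMap s) hd (by simp : (∞ : WithTop ℕ∞) ≠ 0)
    with he
  have hecoe (w) : e w = geodesicMap s w := rfl
  have hsrc : x0 ∈ e.source := hcd.contDiffAt.mem_toOpenPartialHomeomorph_source hd _
  have hval : geodesicMap s x0 = x0 := by
    have : s.comp (pathState x0) = 0 := by
      ext t
      simp [pathState_apply, hx0, hs0]
    simp [geodesicMap, this]
  have htgt : x0 ∈ e.target := by
    have := e.map_source hsrc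
    rwa [hecoe, hval] at this
  have hsymm0 : e.symm x0 = x0 := by
    have := e.left_inv hsrc
    rwa [hecoe, hval] at this
  have hcont : Tendsto e.symm (𝓝 x0) (𝓝 x0) := by
    have := e.continuousAt_symm htgt
    rwa [ContinuousAt, hsymm0] at this
  have hj : Tendsto (fun w : E × E => (w, (0 : C(𝕀, E)))) (𝓝 (p, 0)) (𝓝 x0) :=
    (Continuous.prodMk_left (0 : C(𝕀, E))).tendsto _
  -- the differential stays invertible near the base point
  have hinv : ∀ᶠ z in 𝓝 x0, ∃ L : ((E × E) × C(𝕀, E)) ≃L[ℝ] ((E × E) × C(𝕀, E)),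
      HasFDerivAt (geodesicMap s) (L : _ →L[ℝ] _) z := by
    have hc : ContinuousAt (fderiv ℝ (geodesicMap s)) x0 :=
      (hcd.continuous_fderiv (by simp)).continuousAt
    have hn := ContinuousLinearEquiv.nhds
      (ContinuousLinearEquiv.refl ℝ ((E × E) × C(𝕀, E)))
    rw [← hd.fderiv] at hn
    filter_upwards [hc.eventually hn] with z ⟨L, hL⟩
    exact ⟨L, by rw [hL]; exact (hcd.differentiable (by simp) z).hasFDerivAt⟩
  have hsm : ∀ᶠ z in 𝓝 x0, ContDiffAt ℝ ∞ e.symm z := by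
    filter_upwards [hcont.eventually hinv, e.open_target.mem_nhds htgt] with z ⟨L, hL⟩ hz
    exact e.contDiffAt_symm hz hL hcd.contDiffAt
  have hψ : ∀ᶠ w in 𝓝 (p, (0 : E)), ContDiffAt ℝ ∞ (fun w => (e.symm (w, 0)).2) w := by
    filter_upwards [hj.eventually hsm] with w hw
    exact contDiffAt_snd.comp w (hw.comp w (contDiffAt_id.prodMk contDiffAt_const))
  refine ⟨fun w => (e.symm (w, 0)).2, hψ.self_of_nhds, ?_, hψ, ?_, ?_⟩
  · change (e.symm x0).2 = 0
    rw [hsymm0]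
  · filter_upwards [hj.eventually (e.open_target.mem_nhds htgt)] with w hw
    have := e.right_inv hw
    rw [hecoe, geodesicMap, Prod.ext_iff] at this
    obtain ⟨h1, h2⟩ := this
    have h3 : e.symm (w, 0) = (w, (e.symm (w, 0)).2) := Prod.ext h1 rfl
    rw [← h3]
    exact h2
  · have hfst : Tendsto (fun w : (E × E) × C(𝕀, E) => w.1) (𝓝 x0) (𝓝 (p, 0)) :=
      continuous_fst.tendsto _
    filter_upwards [e.open_source.mem_nhds hsrc] with w hw heq
    have h1 : e w = (w.1, 0) := by rw [hecoe, geodesicMap, heq]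
    have h2 := e.left_inv hw
    rw [h1] at h2
    rw [h2]

end ShortGeodesics

/-! ### The exponential map -/

section Exponential

set_option synthInstance.maxHeartbeats 200000

universe u

variable {E : Type u} [NormedAddCommGroup E] [NormedSpace ℝ E]

local notation "𝕀" => Icc (0 : ℝ) 1

theorem mul_mem_unit {s t : ℝ} (hs : s ∈ 𝕀) (ht : t ∈ 𝕀) : s * t ∈ 𝕀 :=
  ⟨mul_nonneg hs.1 ht.1, mul_le_one₀ hs.2 ht.1 ht.2⟩

theorem primitive_rescale {a b : C(𝕀, E)} {t c : ℝ} (ht : t ∈ 𝕀)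
    (h : ∀ s : 𝕀, b s = (c * t) • a ⟨t * s, mul_mem_unit ht s.2⟩) {s : ℝ} (hs : s ∈ 𝕀) :
    primitive b s = c • primitive a (t * s) := by
  have e : ∫ x in (0 : ℝ)..s, IccExtend (zero_le_one (α := ℝ)) b x =
      ∫ x in (0 : ℝ)..s, (c * t) • IccExtend (zero_le_one (α := ℝ)) a (t * x) := by
    refine intervalIntegral.integral_congr fun x hx => ?_
    rw [uIcc_of_le hs.1] at hx
    have hx' : x ∈ 𝕀 := ⟨hx.1, hx.2.trans hs.2⟩
    rw [IccExtend_of_mem _ _ hx', h, IccExtend_of_mem _ _ (mul_mem_unit ht hx')]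
  unfold primitive
  rw [e, intervalIntegral.integral_smul, mul_smul, intervalIntegral.smul_integral_comp_mul_left,
    mul_zero]

variable [CompleteSpace E]

/-- The exponential map of a smooth metric `B` on a vector space, near a point: a smooth family of
maps `Φ p` whose restrictions to rays are geodesics. -/
theorem exists_expMap {B : E → E →L[ℝ] E →L[ℝ] ℝ} (hB : ContDiff ℝ ∞ B)
    (hi : ∀ x, (B x).IsInvertible) (p₀ : E) :
    ∃ (Φ : E → E → E) (ρ : ℝ), 0 < ρ ∧ ∀ p ∈ Metric.ball p₀ ρ,
      (∀ v ∈ Metric.ball (0 : E) ρ, ContDiffAt ℝ ∞ (Function.uncurry Φ) (p, v)) ∧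
      Φ p 0 = p ∧ (∀ v, fderiv ℝ (Φ p) 0 v = v) ∧
      ∀ v ∈ Metric.ball (0 : E) ρ, fderiv ℝ (fderiv ℝ (Φ p)) v v v +
        chrVec B (Φ p v) (fderiv ℝ (Φ p) v v) (fderiv ℝ (Φ p) v v) = 0 := by
  set s : C(E × E, E) := ⟨spray B, (contDiff_spray hB hi).continuous⟩ with hs
  have hs0 (x : E) : s (x, 0) = 0 := by
    change spray B (x, 0) = 0
    simpa using spray_smul B x 0 0
  obtain ⟨ψ, hψc, hψ0, hψd, hψe, hψu⟩ := exists_geodesic_acceleration (s := s)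
    (contDiff_spray hB hi) (fderiv_spray_zero hB hi p₀) (hs0 p₀)
  obtain ⟨η, hη, hU⟩ := Metric.eventually_nhds_iff_ball.1 hψu
  have hsmall : ∀ᶠ w in 𝓝 (p₀, (0 : E)), ψ w ∈ Metric.ball 0 η := by
    have := hψc.continuousAt
    rw [ContinuousAt, hψ0] at this
    exact this.eventually (Metric.ball_mem_nhds 0 hη)
  obtain ⟨ρ₁, hρ₁, hall⟩ := Metric.eventually_nhds_iff_ball.1 (hψd.and (hψe.and hsmall))
  set ρ₂ : ℝ := min ρ₁ η with hρ₂
  have hρ₂0 : 0 < ρ₂ := lt_min hρ₁ hη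
  have hmem {p v : E} (hp : p ∈ Metric.ball p₀ ρ₂) (hv : v ∈ Metric.ball 0 ρ₂) :
      (p, v) ∈ Metric.ball (p₀, (0 : E)) ρ₁ ∧ (p, v) ∈ Metric.ball (p₀, (0 : E)) η := by
    rw [← ball_prod_same, ← ball_prod_same]
    exact ⟨⟨Metric.ball_subset_ball (min_le_left _ _) hp,
      Metric.ball_subset_ball (min_le_left _ _) hv⟩,
      ⟨Metric.ball_subset_ball (min_le_right _ _) hp,
      Metric.ball_subset_ball (min_le_right _ _) hv⟩⟩
  -- rescaling a geodesic
  have hscale {p v : E} (hp : p ∈ Metric.ball p₀ ρ₂) (hv : v ∈ Metric.ball 0 ρ₂) {t : ℝ}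
      (ht : t ∈ 𝕀) (σ : 𝕀) :
      pathState ((p, t • v), ψ (p, t • v)) σ =
        ((pathState ((p, v), ψ (p, v)) ⟨t * σ, mul_mem_unit ht σ.2⟩).1,
          t • (pathState ((p, v), ψ (p, v)) ⟨t * σ, mul_mem_unit ht σ.2⟩).2) := by
    set a := ψ (p, v) with ha
    set b : C(𝕀, E) := t ^ 2 • a.comp ⟨fun σ : 𝕀 => ⟨t * σ, mul_mem_unit ht σ.2⟩, by fun_prop⟩ with hb
    have htv : t • v ∈ Metric.ball (0 : E) ρ₂ := by
      rw [mem_ball_zero_iff, norm_smul, Real.norm_eq_abs, abs_of_nonneg ht.1]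
      exact (mul_le_of_le_one_left (norm_nonneg _) ht.2).trans_lt (mem_ball_zero_iff.1 hv)
    have h1 {σ : ℝ} (hσ : σ ∈ 𝕀) : primitive b σ = t • primitive a (t * σ) :=
      primitive_rescale ht (fun σ => by simp [hb, sq]) hσ
    have h2 {σ : ℝ} (hσ : σ ∈ 𝕀) :
        primitive (primitiveMap b) σ = primitive (primitiveMap a) (t * σ) := by
      have := primitive_rescale (a := primitiveMap a) (b := primitiveMap b) (c := 1) ht
        (fun σ => by rw [one_mul]; exact h1 σ.2) hσ
      rwa [one_smul] at this
    have hst (σ : 𝕀) : pathState ((p, t • v), b) σ =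
        ((pathState ((p, v), a) ⟨t * σ, mul_mem_unit ht σ.2⟩).1,
          t • (pathState ((p, v), a) ⟨t * σ, mul_mem_unit ht σ.2⟩).2) := by
      simp only [pathState_apply, h1 σ.2, h2 σ.2, smul_add, smul_smul, mul_comm]
    have hbn : ‖b‖ ≤ ‖a‖ := by
      rw [ContinuousMap.norm_le _ (norm_nonneg a)]
      intro σ
      have h3 : ‖b σ‖ = t ^ 2 * ‖a ⟨t * σ, mul_mem_unit ht σ.2⟩‖ := by
        simp [hb, norm_smul]
      rw [h3]
      have h4 : t ^ 2 ≤ 1 := pow_le_one₀ ht.1 ht.2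
      exact (mul_le_of_le_one_left (norm_nonneg _) h4).trans (a.norm_coe_le_norm _)
    have ha_small : ‖a‖ < η := mem_ball_zero_iff.1 (hall _ (hmem hp hv).1).2.2
    have hsol : b + s.comp (pathState ((p, t • v), b)) = 0 := by
      ext1 σ
      have h5 := DFunLike.congr_fun (hall _ (hmem hp hv).1).2.1 ⟨t * σ, mul_mem_unit ht σ.2⟩
      have h6 : s (pathState ((p, t • v), b) σ) = t ^ 2 •
          s (pathState ((p, v), a) ⟨t * σ, mul_mem_unit ht σ.2⟩) := by
        rw [hst]; exact spray_smul B _ _ t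
      have h7 : b σ = t ^ 2 • a ⟨t * σ, mul_mem_unit ht σ.2⟩ := rfl
      simp only [ContinuousMap.add_apply, ContinuousMap.comp_apply, ContinuousMap.zero_apply]
        at h5 ⊢
      rw [h6, h7, ← smul_add]
      rw [show a _ + s (pathState ((p, v), a) _) = 0 from h5, smul_zero]
    have hball : ((p, t • v), b) ∈ Metric.ball (((p₀, 0), 0) : (E × E) × C(𝕀, E)) η := by
      rw [← ball_prod_same]
      exact ⟨(hmem hp htv).2, mem_ball_zero_iff.2 (hbn.trans_lt ha_small)⟩
    have := hU _ hball hsol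
    simp only at this
    rw [← this]
    exact hst σ
  set Φ : E → E → E := fun p v => (pathState ((p, v), ψ (p, v)) ⟨1, by simp⟩).1 with hΦ
  have hΦd {p v : E} (hp : p ∈ Metric.ball p₀ ρ₂) (hv : v ∈ Metric.ball 0 ρ₂) :
      ContDiffAt ℝ ∞ (Function.uncurry Φ) (p, v) := by
    have h1 : ContDiffAt ℝ ∞ (fun w : E × E => pathState (w, ψ w)) (p, v) :=
      (pathState (E := E)).contDiff.contDiffAt.comp _
        (contDiffAt_id.prodMk (hall _ (hmem hp hv).1).1)
    have h2 : ContDiffAt ℝ ∞ (fun w : E × E => pathState (w, ψ w) (⟨1, by simp⟩ : 𝕀)) (p, v) :=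
      (ContinuousMap.evalCLM (M := E × E) ℝ (⟨1, by simp⟩ : 𝕀)).contDiff.contDiffAt.comp _ h1
    exact contDiffAt_fst.comp _ h2
  have hΦp {p v : E} (hp : p ∈ Metric.ball p₀ ρ₂) (hv : v ∈ Metric.ball 0 ρ₂) :
      ContDiffAt ℝ ∞ (Φ p) v :=
    (hΦd hp hv).comp v (contDiffAt_const.prodMk contDiffAt_id)
  -- rays are mapped to geodesics
  have hray {p v : E} (hp : p ∈ Metric.ball p₀ ρ₂) (hv : v ∈ Metric.ball 0 ρ₂) {t : ℝ}
      (ht : t ∈ 𝕀) : Φ p (t • v) = p + t • v + primitive (primitiveMap (ψ (p, v))) t := by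
    simp only [hΦ, hscale hp hv ht]
    simp [pathState_apply]
  have hx (p v : E) (t : ℝ) : HasDerivAt
      (fun t => p + t • v + primitive (primitiveMap (ψ (p, v))) t)
      (v + IccExtend zero_le_one (primitiveMap (ψ (p, v))) t) t := by
    have := (((hasDerivAt_id t).smul_const v).const_add p).fun_add
      (hasDerivAt_primitive (primitiveMap (ψ (p, v))) t)
    simpa using this
  have hline (v : E) (t : ℝ) : HasDerivAt (fun t : ℝ => t • v) v t := by
    simpa using (hasDerivAt_id t).smul_const v
  have hsmem {v : E} (hv : v ∈ Metric.ball (0 : E) ρ₂) {t : ℝ} (ht : t ∈ 𝕀) :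
      t • v ∈ Metric.ball (0 : E) ρ₂ := by
    rw [mem_ball_zero_iff, norm_smul, Real.norm_eq_abs, abs_of_nonneg ht.1]
    exact (mul_le_of_le_one_left (norm_nonneg _) ht.2).trans_lt (mem_ball_zero_iff.1 hv)
  have hz : (0 : ℝ) ∈ 𝕀 := by simp
  refine ⟨Φ, ρ₂ / 2, by positivity, fun p hp => ?_⟩
  have hp : p ∈ Metric.ball p₀ ρ₂ := Metric.ball_subset_ball (by linarith) hp
  have hv0 : (0 : E) ∈ Metric.ball (0 : E) ρ₂ := Metric.mem_ball_self hρ₂0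
  refine ⟨fun v hv => hΦd hp (Metric.ball_subset_ball (by linarith) hv), ?_, ?_, ?_⟩
  · have := hray hp hv0 hz
    simpa [primitive] using this
  · have key {v : E} (hv : v ∈ Metric.ball (0 : E) ρ₂) : fderiv ℝ (Φ p) 0 v = v := by
      have h1 : HasDerivWithinAt (fun t : ℝ => Φ p (t • v)) (fderiv ℝ (Φ p) 0 v) 𝕀 0 := by
        have h2 := ((hΦp hp hv0).differentiableAt (by simp)).hasFDerivAt
        rw [← zero_smul ℝ v] at h2
        have := (h2.comp_hasDerivAt (0 : ℝ) (hline v 0)).hasDerivWithinAt (s := 𝕀)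
        simpa [Function.comp_def] using this
      have h2 : HasDerivWithinAt (fun t : ℝ => Φ p (t • v)) v 𝕀 0 := by
        have h3 := (hx p v 0).hasDerivWithinAt (s := 𝕀)
        have h4 : IccExtend (zero_le_one (α := ℝ)) (primitiveMap (ψ (p, v))) 0 = 0 := by
          rw [IccExtend_of_mem _ _ hz]
          simp [primitiveMap, primitive]
        rw [h4, add_zero] at h3
        exact h3.congr (fun t ht => hray hp hv ht) (hray hp hv hz)
      exact ((uniqueDiffOn_Icc zero_lt_one) 0 hz).eq_deriv _ h1 h2
    intro v
    obtain ⟨c, hc, hcv⟩ : ∃ c : ℝ, c ≠ 0 ∧ c • v ∈ Metric.ball (0 : E) ρ₂ := by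
      refine ⟨ρ₂ / (2 * (‖v‖ + 1)), by positivity, ?_⟩
      rw [mem_ball_zero_iff, norm_smul, Real.norm_eq_abs, abs_of_pos (by positivity),
        div_mul_eq_mul_div, div_lt_iff₀ (by positivity)]
      nlinarith [norm_nonneg v]
    have := key hcv
    rw [map_smul] at this
    exact smul_right_injective E hc this
  · intro v' hv'
    set v := (2 : ℝ) • v' with hv2
    have hv : v ∈ Metric.ball (0 : E) ρ₂ := by
      rw [mem_ball_zero_iff] at hv' ⊢
      rw [hv2, norm_smul]; simp; linarith
    have hv'' : v' = (1 / 2 : ℝ) • v := by rw [hv2, smul_smul]; norm_num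
    have hIoo {t : ℝ} (ht : t ∈ Ioo (0 : ℝ) 1) : t ∈ 𝕀 := Ioo_subset_Icc_self ht
    have hd1 {t : ℝ} (ht : t ∈ Ioo (0 : ℝ) 1) :
        fderiv ℝ (Φ p) (t • v) v = v + primitive (ψ (p, v)) t := by
      have h1 : HasDerivAt (fun t : ℝ => Φ p (t • v)) (fderiv ℝ (Φ p) (t • v) v) t :=
        HasFDerivAt.comp_hasDerivAt (l := Φ p) t ((hΦp hp (hsmem hv (hIoo ht))).differentiableAt
          (by simp)).hasFDerivAt (hline v t)
      have h2 : HasDerivAt (fun t : ℝ => Φ p (t • v)) (v + primitive (ψ (p, v)) t) t := by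
        have h3 := hx p v t
        rw [IccExtend_of_mem _ _ (hIoo ht)] at h3
        refine h3.congr_of_eventuallyEq ?_
        filter_upwards [isOpen_Ioo.mem_nhds ht] with t ht using hray hp hv (hIoo ht)
      exact h1.unique h2
    have ht : (1 / 2 : ℝ) ∈ Ioo (0 : ℝ) 1 := by norm_num
    have hd2 : fderiv ℝ (fderiv ℝ (Φ p)) ((1 / 2 : ℝ) • v) v v = ψ (p, v) ⟨1 / 2, hIoo ht⟩ := by
      have h1 : HasDerivAt (fun t : ℝ => fderiv ℝ (Φ p) (t • v) v)
          (fderiv ℝ (fderiv ℝ (Φ p)) ((1 / 2 : ℝ) • v) v v) (1 / 2) := by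
        have h3 : DifferentiableAt ℝ (fderiv ℝ (Φ p)) ((1 / 2 : ℝ) • v) :=
          ((hΦp hp (hsmem hv (hIoo ht))).fderiv_right (m := 1) (by norm_num; exact ENat.LEInfty.out)).differentiableAt
            one_ne_zero
        have h4 := (h3.hasFDerivAt.comp_hasDerivAt (1 / 2 : ℝ) (hline v (1 / 2))).clm_apply
          (hasDerivAt_const (1 / 2 : ℝ) v)
        simpa [Function.comp_def] using h4
      have h2 : HasDerivAt (fun t : ℝ => fderiv ℝ (Φ p) (t • v) v)
          (ψ (p, v) ⟨1 / 2, hIoo ht⟩) (1 / 2) := by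
        have h3 := (hasDerivAt_primitive (ψ (p, v)) (1 / 2)).const_add v
        rw [IccExtend_of_mem _ _ (hIoo ht)] at h3
        refine h3.congr_of_eventuallyEq ?_
        filter_upwards [isOpen_Ioo.mem_nhds ht] with t ht using hd1 ht
      exact h1.unique h2
    have heq := DFunLike.congr_fun (hall _ (hmem hp hv).1).2.1 ⟨1 / 2, hIoo ht⟩
    have hst : pathState ((p, v), ψ (p, v)) ⟨1 / 2, hIoo ht⟩ =
        (Φ p ((1 / 2 : ℝ) • v), fderiv ℝ (Φ p) ((1 / 2 : ℝ) • v) v) := by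
      rw [hray hp hv (hIoo ht), hd1 ht, pathState_apply]
    simp only [ContinuousMap.add_apply, ContinuousMap.comp_apply, ContinuousMap.zero_apply] at heq
    rw [hst, ← hd2] at heq
    rw [hv'']
    have hsp := spray_smul B (Φ p ((1 / 2 : ℝ) • v)) (fderiv ℝ (Φ p) ((1 / 2 : ℝ) • v) v) (1 / 2)
    simp only [spray] at hsp
    simp only [map_smul, smul_apply]
    rw [hsp, smul_smul, ← sq, ← smul_add]
    rw [show _ + chrVec B _ _ _ = 0 from heq, smul_zero]

end Exponential

/-! ### The Gauss lemma -/

section Gauss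

variable {E : Type*} [NormedAddCommGroup E] [NormedSpace ℝ E]

theorem smul_mem_ball_zero {R t : ℝ} {v : E} (hv : v ∈ Metric.ball (0 : E) R)
    (ht : t ∈ Icc (0 : ℝ) 1) : t • v ∈ Metric.ball (0 : E) R := by
  rw [mem_ball_zero_iff] at hv ⊢
  rw [norm_smul, Real.norm_eq_abs, abs_of_nonneg ht.1]
  exact (mul_le_of_le_one_left (norm_nonneg _) ht.2).trans_lt hv

theorem hasDerivAt_form_ray {B : E → E →L[ℝ] E →L[ℝ] ℝ} {v : E} {t : ℝ}
    (hB : DifferentiableAt ℝ B (t • v)) (u w : E) :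
    HasDerivAt (fun t : ℝ => B (t • v) u w) (fderiv ℝ B (t • v) v u w) t := by
  have hl : HasDerivAt (fun t : ℝ => t • v) v t := by
    simpa using (hasDerivAt_id t).smul_const v
  have := ((hB.hasFDerivAt.comp_hasDerivAt t hl).clm_apply (hasDerivAt_const t u)).clm_apply
    (hasDerivAt_const t w)
  simpa [Function.comp_def] using this

/-- The Gauss lemma: if the rays from the origin are geodesics of `B`, then the radial direction
has the same products for `B v` as for `B 0`. -/
theorem gauss_lemma {B : E → E →L[ℝ] E →L[ℝ] ℝ} {R : ℝ}
    (hB : ∀ v ∈ Metric.ball (0 : E) R, DifferentiableAt ℝ B v)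
    (hs : ∀ v ∈ Metric.ball (0 : E) R, ∀ u w, B v u w = B v w u)
    (hgeo : ∀ v ∈ Metric.ball (0 : E) R, ∀ w, chr B v v v w = 0)
    {v : E} (hv : v ∈ Metric.ball (0 : E) R) (w : E) : B v v w = B 0 v w := by
  have hsev {v : E} (hv : v ∈ Metric.ball (0 : E) R) :
      ∀ᶠ z in 𝓝 v, ∀ u w, B z u w = B z w u := by
    filter_upwards [Metric.isOpen_ball.mem_nhds hv] with z hz using hs z hz
  have h0 {v : E} (hv : v ∈ Metric.ball (0 : E) R) : (0 : E) ∈ Metric.ball (0 : E) R := by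
    simpa using smul_mem_ball_zero hv (t := 0) (by simp)
  have hgeo' {v : E} (hv : v ∈ Metric.ball (0 : E) R) {t : ℝ} (ht : t ∈ Ioc (0 : ℝ) 1) (w : E) :
      fderiv ℝ B (t • v) v v w = (1 / 2) * fderiv ℝ B (t • v) w v v := by
    have := hgeo _ (smul_mem_ball_zero hv ⟨ht.1.le, ht.2⟩) w
    simp only [chr, map_smul, smul_apply, smul_eq_mul] at this
    have ht0 : t ^ 2 ≠ 0 := pow_ne_zero _ ht.1.ne'
    apply mul_left_cancel₀ ht0
    linear_combination this
  have hconst {f f' : ℝ → ℝ} (hd : ∀ t ∈ Icc (0 : ℝ) 1, HasDerivAt f (f' t) t)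
      (hz : ∀ t ∈ Ioo (0 : ℝ) 1, f' t = 0) : f 1 = f 0 := by
    have hc : ContinuousOn f (Icc 0 1) := fun t ht => (hd t ht).continuousAt.continuousWithinAt
    obtain ⟨c, hc1, hc2⟩ := exists_hasDerivAt_eq_slope f f' zero_lt_one hc
      (fun t ht => hd t (Ioo_subset_Icc_self ht))
    rw [hz c hc1] at hc2
    linarith [hc2, show (f 1 - f 0) / (1 - 0) = f 1 - f 0 by ring]
  -- the speed of the ray is constant
  have hrad {v : E} (hv : v ∈ Metric.ball (0 : E) R) : B v v v = B 0 v v := by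
    have := hconst (f := fun t => B (t • v) v v)
      (fun t ht => hasDerivAt_form_ray (hB _ (smul_mem_ball_zero hv ht)) v v)
      (fun t ht => by have := hgeo' hv ⟨ht.1, ht.2.le⟩ v; linarith)
    simpa using this
  -- differentiate the previous identity in the direction `w`
  have hdiff {v : E} (hv : v ∈ Metric.ball (0 : E) R) (w : E) :
      fderiv ℝ B v w v v + 2 * B v v w = 2 * B 0 v w := by
    have e : (fun z => B z z z) =ᶠ[𝓝 v] fun z => B 0 z z := by
      filter_upwards [Metric.isOpen_ball.mem_nhds hv] with z hz using hrad hz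
    have h1 := (hasFDerivAt_form_apply (Φ := fun z => z) (hB v hv) (hasFDerivAt_id v)
      (hasFDerivAt_id v) (hasFDerivAt_id v) w).2
    have h2 := (hasFDerivAt_form_apply (B := fun _ => B 0) (Φ := fun z => z)
      (differentiableAt_const (B 0)) (hasFDerivAt_id v) (hasFDerivAt_id v) (hasFDerivAt_id v) w).2
    simp only [id] at h1 h2
    rw [e.fderiv_eq, h2] at h1
    simp at h1
    rw [hs 0 (h0 hv) w v, hs v hv w v] at h1
    linarith
  have := hconst (f := fun t => t * (B (t • v) v w - B 0 v w))
    (f' := fun t => 1 * (B (t • v) v w - B 0 v w) + t * fderiv ℝ B (t • v) v v w)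
    (fun t ht => (hasDerivAt_id t).mul
      ((hasDerivAt_form_ray (hB _ (smul_mem_ball_zero hv ht)) v w).sub_const _))
    (fun t ht => by
      have h1 := hdiff (smul_mem_ball_zero hv (Ioo_subset_Icc_self ht)) w
      have h2 := hgeo' hv ⟨ht.1, ht.2.le⟩ w
      simp only [map_smul, smul_apply, smul_eq_mul] at h1
      have ht0 : t ≠ 0 := ht.1.ne'
      rw [h2]
      apply mul_left_cancel₀ ht0
      linear_combination (1 / 2) * h1)
  simp only [one_mul, one_smul, zero_mul] at this
  linarith

end Gauss

/-! ### Orthonormal frames -/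

section OrthonormalFrames

/-- A family that is orthonormal for an inner product `Q` extends to an orthonormal frame. -/
theorem exists_orthonormal_frame {V ι : Type*} [AddCommGroup V] [Module ℝ V]
    [FiniteDimensional ℝ V] [Fintype ι] [DecidableEq ι] (hcard : Module.finrank ℝ V = Fintype.card ι)
    (Q : V →ₗ[ℝ] V →ₗ[ℝ] ℝ) (hs : ∀ u v, Q u v = Q v u) (hpos : ∀ v, v ≠ 0 → 0 < Q v v)
    (s : Set ι) (v : ι → V) (hv : ∀ a ∈ s, ∀ c ∈ s, Q (v a) (v c) = if a = c then 1 else 0) :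
    ∃ b : ι → V, (∀ a c, Q (b a) (b c) = if a = c then 1 else 0) ∧ ∀ i ∈ s, b i = v i := by
  let core : InnerProductSpace.Core ℝ V :=
    { inner := fun u v => Q u v
      conj_inner_symm := fun u v => by simpa using hs v u
      re_inner_nonneg := fun u => by
        by_cases h : u = 0
        · simp [h]
        · simpa using (hpos u h).le
      add_left := fun u v w => by simp
      smul_left := fun u v r => by simp
      definite := fun u hu => by
        by_contra h
        exact (hpos u h).ne' hu }
  let : NormedAddCommGroup V := core.toNormedAddCommGroup
  let : InnerProductSpace ℝ V := InnerProductSpace.ofCore core.toCore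
  have hin (u v : V) : inner ℝ u v = Q u v := rfl
  have ho : Orthonormal ℝ (s.domRestrict v) := by
    rw [orthonormal_iff_ite]
    rintro ⟨a, ha⟩ ⟨c, hc⟩
    rw [hin]
    change Q (v a) (v c) = _
    simpa using hv a ha c hc
  obtain ⟨b, hb⟩ := ho.exists_orthonormalBasis_extension_of_card_eq hcard
  refine ⟨b, fun a c => ?_, hb⟩
  rw [← hin]
  exact orthonormal_iff_ite.1 b.orthonormal a c

end OrthonormalFrames

/-! ### Bounds for Christoffel symbols and curvature -/

section Bounds

variable {E F : Type*} [NormedAddCommGroup E] [NormedSpace ℝ E]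
  [NormedAddCommGroup F] [NormedSpace ℝ F]

theorem abs_apply₃_le (T : E →L[ℝ] E →L[ℝ] E →L[ℝ] ℝ) (u v w : E) :
    |T u v w| ≤ ‖T‖ * ‖u‖ * ‖v‖ * ‖w‖ := by
  refine ((T u v).le_opNorm w).trans ?_
  gcongr
  exact T.le_opNorm₂ u v

theorem abs_apply₂_le (T : E →L[ℝ] E →L[ℝ] ℝ) (u v : E) : |T u v| ≤ ‖T‖ * ‖u‖ * ‖v‖ :=
  T.le_opNorm₂ u v

theorem abs_apply₄_le (T : E →L[ℝ] E →L[ℝ] E →L[ℝ] E →L[ℝ] ℝ) (a u v w : E) :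
    |T a u v w| ≤ ‖T‖ * ‖a‖ * ‖u‖ * ‖v‖ * ‖w‖ := by
  refine (abs_apply₃_le (T a) u v w).trans ?_
  gcongr
  exact T.le_opNorm a

theorem abs_chr_le (B : E → E →L[ℝ] E →L[ℝ] ℝ) (x u v w : E) :
    |chr B x u v w| ≤ 2 * ‖fderiv ℝ B x‖ * ‖u‖ * ‖v‖ * ‖w‖ := by
  have h1 := abs_le.1 (abs_apply₃_le (fderiv ℝ B x) u v w)
  have h2 := abs_le.1 (abs_apply₃_le (fderiv ℝ B x) v u w)
  have h3 := abs_le.1 (abs_apply₃_le (fderiv ℝ B x) w u v)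
  have h4 : 0 ≤ ‖fderiv ℝ B x‖ * ‖u‖ * ‖v‖ * ‖w‖ := by positivity
  unfold chr
  rw [abs_le]
  constructor <;> nlinarith [h1.1, h1.2, h2.1, h2.2, h3.1, h3.2]

theorem norm_chrVec_le (B : E → E →L[ℝ] E →L[ℝ] ℝ) (x u v : E) :
    ‖chrVec B x u v‖ ≤ 2 * ‖(B x).inverse‖ * ‖fderiv ℝ B x‖ * ‖u‖ * ‖v‖ := by
  have h : ‖chrForm B x u v‖ ≤ 2 * ‖fderiv ℝ B x‖ * ‖u‖ * ‖v‖ :=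
    ContinuousLinearMap.opNorm_le_bound _ (by positivity) fun w => by
      rw [chrForm_apply]; exact abs_chr_le B x u v w
  calc _ ≤ ‖(B x).inverse‖ * ‖chrForm B x u v‖ := ContinuousLinearMap.le_opNorm _ _
    _ ≤ ‖(B x).inverse‖ * (2 * ‖fderiv ℝ B x‖ * ‖u‖ * ‖v‖) := by gcongr
    _ = _ := by ring

/-- A bound for the curvature in terms of the 2-jet of the metric. -/
theorem abs_curv_le {B : E → E →L[ℝ] E →L[ℝ] ℝ} {x : E} (hB : ContDiffAt ℝ 2 B x) {C : ℝ}
    (h0 : ‖B x‖ ≤ C) (h1 : ‖fderiv ℝ B x‖ ≤ C) (h2 : ‖fderiv ℝ (fderiv ℝ B) x‖ ≤ C)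
    (h3 : ‖(B x).inverse‖ ≤ C) (a u v w : E) :
    |curv B x a u v w| ≤ (4 * C + 8 * C ^ 5) * ‖a‖ * ‖u‖ * ‖v‖ * ‖w‖ := by
  have hC : 0 ≤ C := (norm_nonneg _).trans h0
  have hd (a u v w : E) : |fderiv ℝ (fun z => chr B z u v w) x a| ≤
      2 * C * ‖a‖ * ‖u‖ * ‖v‖ * ‖w‖ := by
    rw [fderiv_chr hB]
    have k (a u v w : E) : |fderiv ℝ (fderiv ℝ B) x a u v w| ≤ C * ‖a‖ * ‖u‖ * ‖v‖ * ‖w‖ :=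
      (abs_apply₄_le _ a u v w).trans (by gcongr)
    have h1 := abs_le.1 (k a u v w)
    have h2 := abs_le.1 (k a v u w)
    have h3 := abs_le.1 (k a w u v)
    have h4 : 0 ≤ C * ‖a‖ * ‖u‖ * ‖v‖ * ‖w‖ := by positivity
    rw [abs_le]
    constructor <;> nlinarith [h1.1, h1.2, h2.1, h2.2, h3.1, h3.2]
  have hv (u v : E) : ‖chrVec B x u v‖ ≤ 2 * C * C * ‖u‖ * ‖v‖ :=
    (norm_chrVec_le B x u v).trans (by gcongr)
  have hq (a w u v : E) : |B x (chrVec B x a w) (chrVec B x u v)| ≤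
      4 * C ^ 5 * ‖a‖ * ‖u‖ * ‖v‖ * ‖w‖ := by
    refine (abs_apply₂_le _ _ _).trans ?_
    calc _ ≤ C * (2 * C * C * ‖a‖ * ‖w‖) * (2 * C * C * ‖u‖ * ‖v‖) := by
          gcongr
          · exact hv a w
          · exact hv u v
      _ = _ := by ring
  have e1 := abs_le.1 (hd a u v w)
  have e2 := abs_le.1 (hd u a v w)
  have e3 := abs_le.1 (hq a w u v)
  have e4 := abs_le.1 (hq u w a v)
  unfold curv
  rw [abs_le]
  constructor <;> nlinarith [e1.1, e1.2, e2.1, e2.2, e3.1, e3.2, e4.1, e4.2]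

theorem isInvertible_of_pos [FiniteDimensional ℝ E] {Q : E →L[ℝ] E →L[ℝ] ℝ}
    (h : ∀ v, v ≠ 0 → 0 < Q v v) : Q.IsInvertible := by
  have hinj : Function.Injective (Q : E →ₗ[ℝ] E →L[ℝ] ℝ) := by
    rw [injective_iff_map_eq_zero]
    intro v hv
    by_contra hne
    have := h v hne
    rw [show Q v = 0 from hv] at this
    simp at this
  have hd : Module.finrank ℝ E = Module.finrank ℝ (E →L[ℝ] ℝ) := by
    rw [← (LinearMap.toContinuousLinearMap : (E →ₗ[ℝ] ℝ) ≃ₗ[ℝ] E →L[ℝ] ℝ).finrank_eq]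
    exact (Subspace.dual_finrank_eq (K := ℝ) (V := E)).symm
  exact ⟨((Q : E →ₗ[ℝ] E →L[ℝ] ℝ).linearEquivOfInjective hinj hd).toContinuousLinearEquiv,
    by ext; rfl⟩

theorem exists_pos_le_form [FiniteDimensional ℝ E] {Q : E →L[ℝ] E →L[ℝ] ℝ}
    (h : ∀ v, v ≠ 0 → 0 < Q v v) : ∃ m > 0, ∀ v, m * ‖v‖ ^ 2 ≤ Q v v := by
  rcases subsingleton_or_nontrivial E with hE | hE
  · exact ⟨1, one_pos, fun v => by simp [Subsingleton.elim v 0]⟩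
  obtain ⟨x, hx, hmin⟩ := (isCompact_sphere (0 : E) 1).exists_isMinOn
    (NormedSpace.sphere_nonempty.2 zero_le_one) (f := fun v => Q v v)
    (by fun_prop)
  have hx0 : x ≠ 0 := by rintro rfl; simp at hx
  refine ⟨Q x x, h x hx0, fun v => ?_⟩
  by_cases hv : v = 0
  · simp [hv]
  have hn : ‖v‖ ≠ 0 := norm_ne_zero_iff.2 hv
  have : Q x x ≤ Q (‖v‖⁻¹ • v) (‖v‖⁻¹ • v) := hmin (by simp [norm_smul, hn])
  simp only [map_smul, smul_apply, smul_eq_mul] at this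
  calc _ ≤ ‖v‖⁻¹ * (‖v‖⁻¹ * Q v v) * ‖v‖ ^ 2 := by gcongr
    _ = _ := by field_simp

/-- The pullback `Φ*B` of a metric. -/
noncomputable def pullbackForm (B : F → F →L[ℝ] F →L[ℝ] ℝ) (Φ : E → F) (v : E) :
    E →L[ℝ] E →L[ℝ] ℝ :=
  ((ContinuousLinearMap.compL ℝ E F ℝ).flip (fderiv ℝ Φ v)) ∘L ((B (Φ v)) ∘L fderiv ℝ Φ v)

@[simp]
theorem pullbackForm_apply (B : F → F →L[ℝ] F →L[ℝ] ℝ) (Φ : E → F) (v u w : E) :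
    pullbackForm B Φ v u w = B (Φ v) (fderiv ℝ Φ v u) (fderiv ℝ Φ v w) := rfl

theorem contDiffAt_pullbackForm {B : F → F →L[ℝ] F →L[ℝ] ℝ} {Φ : E → F} {v : E}
    (hB : ContDiffAt ℝ ∞ B (Φ v)) (hΦ : ContDiffAt ℝ ∞ Φ v) :
    ContDiffAt ℝ ∞ (pullbackForm B Φ) v := by
  have hd : ContDiffAt ℝ ∞ (fderiv ℝ Φ) v := hΦ.fderiv_right (by simp)
  have h1 : ContDiffAt ℝ ∞ (fun v => (ContinuousLinearMap.compL ℝ E F ℝ).flip (fderiv ℝ Φ v)) v :=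
    ((ContinuousLinearMap.compL ℝ E F ℝ).flip).contDiff.contDiffAt.comp v hd
  exact h1.clm_comp ((hB.comp v hΦ).clm_comp hd)

end Bounds

/-! ### Metrics in normal form -/

section NormalForm

variable {n : ℕ}

local notation "𝔼" => EuclideanSpace ℝ (Fin n)

/-- `B` is the expression of a metric in normal coordinates on the ball of radius `R`: the radial
direction satisfies the conclusion of the Gauss lemma, and the metric, its Christoffel symbols and
its curvature are, up to the scale `‖v‖` of the point, `ε`-close to those of the flat metric. -/
structure IsNormalForm (R ε : ℝ) (B : 𝔼 → 𝔼 →L[ℝ] 𝔼 →L[ℝ] ℝ) : Prop where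
  contDiffAt : ∀ v ∈ Metric.ball (0 : 𝔼) R, ContDiffAt ℝ ∞ B v
  symm : ∀ v ∈ Metric.ball (0 : 𝔼) R, ∀ u w, B v u w = B v w u
  gauss : ∀ v ∈ Metric.ball (0 : 𝔼) R, ∀ w, B v v w = inner ℝ v w
  close : ∀ v ∈ Metric.ball (0 : 𝔼) R, ∀ u w, |B v u w - inner ℝ u w| ≤ ε * ‖u‖ * ‖w‖
  chr_le : ∀ v ∈ Metric.ball (0 : 𝔼) R, ∀ u w z,
    ‖v‖ * |chr B v u w z| ≤ ε * ‖u‖ * ‖w‖ * ‖z‖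
  curv_le : ∀ v ∈ Metric.ball (0 : 𝔼) R, ∀ a u w z,
    ‖v‖ ^ 2 * |curv B v a u w z| ≤ ε * ‖a‖ * ‖u‖ * ‖w‖ * ‖z‖

/-- An inner product is the pullback of the standard one by a linear isomorphism. -/
theorem exists_isometry {Q : 𝔼 →L[ℝ] 𝔼 →L[ℝ] ℝ} (hs : ∀ u v, Q u v = Q v u)
    (hpos : ∀ v, v ≠ 0 → 0 < Q v v) :
    ∃ A : 𝔼 ≃L[ℝ] 𝔼, ∀ u w, Q (A u) (A w) = inner ℝ u w := by
  obtain ⟨b, hb, -⟩ := exists_orthonormal_frame (V := 𝔼) (ι := Fin n) (by simp)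
    (LinearMap.mk₂ ℝ (fun u v => Q u v) (by simp) (by simp) (by simp) (by simp))
    hs hpos ∅ (fun _ => 0) (by simp)
  set A : 𝔼 →ₗ[ℝ] 𝔼 :=
    { toFun := fun u => ∑ i, u i • b i
      map_add' := fun u v => by simp [add_smul, Finset.sum_add_distrib]
      map_smul' := fun c u => by simp [mul_smul, Finset.smul_sum] } with hA
  have hAi (u w : 𝔼) : Q (A u) (A w) = inner ℝ u w := by
    have hb' (a c : Fin n) : Q (b a) (b c) = if a = c then 1 else 0 := hb a c
    simp [hA, hb', PiLp.inner_apply, mul_comm]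
  have hinj : Function.Injective A := by
    rw [injective_iff_map_eq_zero]
    intro v hv
    have := hAi v v
    rw [hv, map_zero, real_inner_self_eq_norm_sq] at this
    simpa using this.symm
  exact ⟨(LinearEquiv.ofInjectiveEndo A hinj).toContinuousLinearEquiv, hAi⟩

end NormalForm

/-! ### Normal coordinates on a vector space -/

section NormalCoordinates

variable {n : ℕ}

local notation "𝔼" => EuclideanSpace ℝ (Fin n)

/- Shortcut instances. -/
noncomputable instance : NormedAddCommGroup (𝔼 →L[ℝ] 𝔼 →L[ℝ] 𝔼 →L[ℝ] 𝔼 →L[ℝ] ℝ) :=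
  ContinuousLinearMap.toNormedAddCommGroup (F := 𝔼 →L[ℝ] 𝔼 →L[ℝ] 𝔼 →L[ℝ] ℝ)

noncomputable instance : NormedAddCommGroup ((𝔼 →L[ℝ] ℝ) →L[ℝ] 𝔼) :=
  ContinuousLinearMap.toNormedAddCommGroup (E := 𝔼 →L[ℝ] ℝ)

/-- A map whose derivative is close to the identity on a ball is a diffeomorphism of this ball
onto its image. -/
theorem exists_openPartialHomeomorph {Φ : 𝔼 → 𝔼} {r : ℝ}
    (hΦ : ∀ v ∈ Metric.ball (0 : 𝔼) r, DifferentiableAt ℝ Φ v)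
    (hD : ∀ v ∈ Metric.ball (0 : 𝔼) r, ‖fderiv ℝ Φ v - ContinuousLinearMap.id ℝ 𝔼‖ ≤ 1 / 2) :
    ∃ e : OpenPartialHomeomorph 𝔼 𝔼, e.source = Metric.ball 0 r ∧ ∀ v, e v = Φ v := by
  have happ : ApproximatesLinearOn Φ ((ContinuousLinearEquiv.refl ℝ 𝔼 : 𝔼 ≃L[ℝ] 𝔼) : 𝔼 →L[ℝ] 𝔼)
      (Metric.ball 0 r) (1 / 2) := by
    intro x hx y hy
    have := (convex_ball (0 : 𝔼) r).norm_image_sub_le_of_norm_fderiv_le'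
      (f := Φ) (φ := ContinuousLinearMap.id ℝ 𝔼) (C := 1 / 2) hΦ hD hy hx
    simpa using this
  have hc : Subsingleton 𝔼 ∨ (1 / 2 : NNReal) <
      ‖((ContinuousLinearEquiv.refl ℝ 𝔼).symm : 𝔼 →L[ℝ] 𝔼)‖₊⁻¹ := by
    rcases subsingleton_or_nontrivial 𝔼 with h | h
    · exact Or.inl h
    · right
      have : ‖((ContinuousLinearEquiv.refl ℝ 𝔼).symm : 𝔼 →L[ℝ] 𝔼)‖₊ = 1 := by
        ext
        exact ContinuousLinearMap.norm_id
      rw [this, inv_one]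
      exact NNReal.half_lt_self one_ne_zero
  exact ⟨happ.toOpenPartialHomeomorph Φ _ hc Metric.isOpen_ball,
    rfl, fun v => rfl⟩

theorem isInvertible_fderiv_of_close {Φ : 𝔼 → 𝔼} {v : 𝔼}
    (hD : ‖fderiv ℝ Φ v - ContinuousLinearMap.id ℝ 𝔼‖ ≤ 1 / 2) :
    (fderiv ℝ Φ v).IsInvertible := by
  have hinj : Function.Injective (fderiv ℝ Φ v : 𝔼 →ₗ[ℝ] 𝔼) := by
    rw [injective_iff_map_eq_zero]
    intro w hw
    have h1 := (fderiv ℝ Φ v - ContinuousLinearMap.id ℝ 𝔼).le_opNorm w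
    have h2 : fderiv ℝ Φ v w = 0 := hw
    have h3 : (fderiv ℝ Φ v - ContinuousLinearMap.id ℝ 𝔼) w = -w := by simp [h2]
    rw [h3, norm_neg] at h1
    have h4 : ‖w‖ ≤ 1 / 2 * ‖w‖ := h1.trans (by gcongr)
    exact norm_eq_zero.1 (le_antisymm (by linarith) (norm_nonneg w))
  exact ⟨(LinearEquiv.ofInjectiveEndo _ hinj).toContinuousLinearEquiv, by ext; rfl⟩

/-- The properties of normal coordinates `e` of radius `R` centred at `p` for the metric `B`, with
image in `U`. -/
structure IsNormalCoordinates (B : 𝔼 → 𝔼 →L[ℝ] 𝔼 →L[ℝ] ℝ) (R ε : ℝ) (p : 𝔼) (U : Set 𝔼)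
    (e : OpenPartialHomeomorph 𝔼 𝔼) : Prop where
  source_eq : e.source = Metric.ball 0 R
  map_zero : e 0 = p
  mapsTo : ∀ v ∈ Metric.ball (0 : 𝔼) R, e v ∈ U
  contDiffAt : ∀ v ∈ Metric.ball (0 : 𝔼) R, ContDiffAt ℝ ∞ e v
  contDiffAt_symm : ∀ y ∈ e.target, ContDiffAt ℝ ∞ e.symm y
  isNormalForm : IsNormalForm R ε (pullbackForm B e)

set_option maxHeartbeats 1000000 in
/-- Normal coordinates from the exponential map `Φ` at `p`. A linear change of variables makes the
metric at the centre standard, and the bounds on the ball of radius `r` turn into the estimates of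
the normal form on a ball of radius `R` that depends on these bounds only. -/
theorem exists_normalCoordinates_of_bounds {B : 𝔼 → 𝔼 →L[ℝ] 𝔼 →L[ℝ] ℝ} (hB : ContDiff ℝ ∞ B)
    (hs : ∀ x u v, B x u v = B x v u) (hpos : ∀ x v, v ≠ 0 → 0 < B x v v)
    {Φ : 𝔼 → 𝔼} {p : 𝔼} {U : Set 𝔼} {r C η a R ε : ℝ} (hC : 0 ≤ C) (ha : 0 < a) (hR : 0 < R)
    (hΦ : ∀ v ∈ Metric.ball (0 : 𝔼) r, ContDiffAt ℝ ∞ Φ v)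
    (h0 : Φ 0 = p) (hd0 : ∀ v, fderiv ℝ Φ 0 v = v)
    (hgeo : ∀ v ∈ Metric.ball (0 : 𝔼) r, fderiv ℝ (fderiv ℝ Φ) v v v +
        chrVec B (Φ v) (fderiv ℝ Φ v v) (fderiv ℝ Φ v v) = 0)
    (hU : ∀ v ∈ Metric.ball (0 : 𝔼) r, Φ v ∈ U)
    (hD : ∀ v ∈ Metric.ball (0 : 𝔼) r, ‖fderiv ℝ Φ v - ContinuousLinearMap.id ℝ 𝔼‖ ≤ 1 / 2)
    (hD2 : ∀ v ∈ Metric.ball (0 : 𝔼) r, ‖fderiv ℝ (fderiv ℝ Φ) v‖ ≤ C)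
    (hB0 : ∀ v ∈ Metric.ball (0 : 𝔼) r, ‖B (Φ v)‖ ≤ C)
    (hB1 : ∀ v ∈ Metric.ball (0 : 𝔼) r, ‖fderiv ℝ B (Φ v)‖ ≤ C)
    (hB2 : ∀ v ∈ Metric.ball (0 : 𝔼) r, ‖fderiv ℝ (fderiv ℝ B) (Φ v)‖ ≤ C)
    (hB3 : ∀ v ∈ Metric.ball (0 : 𝔼) r, ‖(B (Φ v)).inverse‖ ≤ C)
    (hη : ∀ v ∈ Metric.ball (0 : 𝔼) r, ‖pullbackForm B Φ v - B p‖ ≤ η)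
    (haB : ∀ u, ‖u‖ ^ 2 ≤ a ^ 2 * B p u u)
    (hRr : a * R ≤ r) (hηε : η * a ^ 2 ≤ ε)
    (hR1 : R * (16 * C * a ^ 3 + 2 * C ^ 2 * a ^ 3) ≤ ε)
    (hR2 : R ^ 2 * ((4 * C + 8 * C ^ 5) * (2 * a) ^ 4) ≤ ε) :
    ∃ e : OpenPartialHomeomorph 𝔼 𝔼, IsNormalCoordinates B R ε p U e := by
  obtain ⟨A, hA⟩ := exists_isometry (hs p) (hpos p)
  have hAn (u : 𝔼) : ‖A u‖ ≤ a * ‖u‖ := by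
    have := haB (A u)
    rw [hA, real_inner_self_eq_norm_sq, ← mul_pow] at this
    exact (pow_le_pow_iff_left₀ (norm_nonneg _) (by positivity) two_ne_zero).1 this
  have hAb (v : 𝔼) (hv : v ∈ Metric.ball (0 : 𝔼) R) : A v ∈ Metric.ball (0 : 𝔼) r := by
    rw [mem_ball_zero_iff] at hv ⊢
    exact (hAn v).trans_lt ((mul_lt_mul_of_pos_left hv ha).trans_le hRr)
  obtain ⟨e₀, he₀s, he₀⟩ := exists_openPartialHomeomorph
    (fun v hv => (hΦ v hv).differentiableAt (by simp)) hD
  set e₁ := (A.toHomeomorph.toOpenPartialHomeomorph.trans e₀).restrOpen (Metric.ball 0 R)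
    Metric.isOpen_ball with he₁
  have hfun (v : 𝔼) : e₁ v = Φ (A v) := he₀ (A v)
  have hfun' : (e₁ : 𝔼 → 𝔼) = Φ ∘ A := funext hfun
  have hsrc : e₁.source = Metric.ball 0 R := by
    rw [he₁, OpenPartialHomeomorph.restrOpen_source, OpenPartialHomeomorph.trans_source, he₀s]
    ext v
    constructor
    · exact fun h => h.2
    · exact fun h => ⟨⟨trivial, hAb v h⟩, h⟩
  have hcd (v : 𝔼) (hv : v ∈ Metric.ball (0 : 𝔼) R) : ContDiffAt ℝ ∞ e₁ v := by
    rw [hfun']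
    exact (hΦ _ (hAb v hv)).comp v A.contDiff.contDiffAt
  have hder (v : 𝔼) (hv : v ∈ Metric.ball (0 : 𝔼) R) :
      fderiv ℝ e₁ v = fderiv ℝ Φ (A v) ∘L (A : 𝔼 →L[ℝ] 𝔼) := by
    rw [hfun', fderiv_comp v ((hΦ _ (hAb v hv)).differentiableAt (by simp))
      A.differentiableAt, A.fderiv]
  have hder2 (v : 𝔼) (hv : v ∈ Metric.ball (0 : 𝔼) R) (u w : 𝔼) :
      fderiv ℝ (fderiv ℝ e₁) v u w = fderiv ℝ (fderiv ℝ Φ) (A v) (A u) (A w) := by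
    have e1 : fderiv ℝ e₁ =ᶠ[𝓝 v] fun v => fderiv ℝ Φ (A v) ∘L (A : 𝔼 →L[ℝ] 𝔼) := by
      filter_upwards [Metric.isOpen_ball.mem_nhds hv] with z hz using hder z hz
    have e2 : HasFDerivAt (fderiv ℝ Φ) (fderiv ℝ (fderiv ℝ Φ) (A v)) (A v) :=
      (((hΦ _ (hAb v hv)).fderiv_right (m := ∞) (by simp)).differentiableAt (by simp)).hasFDerivAt
    have e3 := (e2.comp v A.hasFDerivAt).clm_comp
      (hasFDerivAt_const (A : 𝔼 →L[ℝ] 𝔼) v)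
    have e4 := (e3.congr_of_eventuallyEq e1).fderiv
    rw [e4]
    simp
  have hinv (v : 𝔼) (hv : v ∈ Metric.ball (0 : 𝔼) R) : (fderiv ℝ e₁ v).IsInvertible := by
    obtain ⟨L, hL⟩ := isInvertible_fderiv_of_close (hD _ (hAb v hv))
    exact ⟨A.trans L, by rw [hder v hv, ← hL]; rfl⟩
  have hcdB (v : 𝔼) (hv : v ∈ Metric.ball (0 : 𝔼) R) : ContDiffAt ℝ ∞ (pullbackForm B e₁) v :=
    contDiffAt_pullbackForm hB.contDiffAt (hcd v hv)
  have hDn (v : 𝔼) (hv : v ∈ Metric.ball (0 : 𝔼) R) (u : 𝔼) :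
      ‖fderiv ℝ e₁ v u‖ ≤ 2 * a * ‖u‖ := by
    have h1 := (fderiv ℝ Φ (A v) - ContinuousLinearMap.id ℝ 𝔼).le_opNorm (A u)
    have h2 : fderiv ℝ e₁ v u = (fderiv ℝ Φ (A v) - ContinuousLinearMap.id ℝ 𝔼) (A u) + A u := by
      simp [hder v hv]
    rw [h2]
    calc _ ≤ 1 / 2 * ‖A u‖ + ‖A u‖ := (norm_add_le _ _).trans (by
            gcongr
            exact h1.trans (by gcongr; exact hD _ (hAb v hv)))
      _ ≤ 2 * ‖A u‖ := by linarith [norm_nonneg (A u)]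
      _ ≤ 2 * (a * ‖u‖) := by gcongr; exact hAn u
      _ = _ := by ring
  have hle (k : ℕ) : (k : WithTop ℕ∞) ≤ (∞ : WithTop ℕ∞) := by
    exact_mod_cast (le_top : (k : ℕ∞) ≤ ⊤)
  have hchr (v : 𝔼) (hv : v ∈ Metric.ball (0 : 𝔼) R) (u w z : 𝔼) := chr_pullback
    (B := B) (B' := pullbackForm B e₁) (Φ := e₁) (x := v) (hB.differentiable (by simp) _)
    (Eventually.of_forall fun z => hs z) ((hcdB v hv).differentiableAt (by simp))
    ((hcd v hv).of_le (hle 2)) (Eventually.of_forall fun z u w => rfl) u w z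
  have hcurv (v : 𝔼) (hv : v ∈ Metric.ball (0 : 𝔼) R) (b u w z : 𝔼) := curv_pullback
    (B := B) (B' := pullbackForm B e₁) (Φ := e₁) (x := v) (hB.contDiffAt.of_le (hle 2))
    (Eventually.of_forall fun z => hs z) (isInvertible_of_pos (hpos _))
    (isInvertible_of_pos fun w hw => by
      refine hpos _ _ fun h => hw ?_
      obtain ⟨L, hL⟩ := hinv v hv
      rw [← hL] at h
      simpa using h)
    ((hcdB v hv).of_le (hle 2)) ((hcd v hv).of_le (hle 3))
    (by obtain ⟨L, hL⟩ := hinv v hv; rw [← hL]; exact L.surjective)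
    (Eventually.of_forall fun z u w => rfl) b u w z
  have h0R : (0 : 𝔼) ∈ Metric.ball (0 : 𝔼) R := by simpa using hR
  refine ⟨e₁, hsrc, ?_, fun v hv => ?_, hcd, fun y hy => ?_, hcdB, fun v _ u w => hs _ _ _,
    fun v hv w => ?_, fun v hv u w => ?_, fun v hv u w z => ?_, fun v hv b u w z => ?_⟩
  · rw [hfun, map_zero, h0]
  · rw [hfun]; exact hU _ (hAb v hv)
  · have hy' : e₁.symm y ∈ Metric.ball (0 : 𝔼) R := hsrc ▸ e₁.map_target hy
    obtain ⟨L, hL⟩ := hinv _ hy'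
    exact e₁.contDiffAt_symm hy (f₀' := L)
      (by rw [hL]; exact ((hcd _ hy').differentiableAt (by simp)).hasFDerivAt) (hcd _ hy')
  · rw [gauss_lemma (R := R) (fun v hv => (hcdB v hv).differentiableAt (by simp))
      (fun v _ u w => hs _ _ _) (fun v hv w => ?_) hv w]
    · rw [pullbackForm_apply, hfun, map_zero, h0, hder 0 h0R]
      simp [hd0, hA]
    · rw [hchr v hv, hder2 v hv, hfun, hder v hv]
      have := hgeo _ (hAb v hv)
      rw [← apply_chrVec (isInvertible_of_pos (hpos _)), ← add_apply, ← map_add]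
      simp only [ContinuousLinearMap.comp_apply, ContinuousLinearEquiv.coe_coe]
      rw [add_comm, this]
      simp
  · have h1 : pullbackForm B e₁ v u w - inner ℝ u w =
        (pullbackForm B Φ (A v) - B p) (A u) (A w) := by
      simp [hder v hv, hfun, hA]
    rw [h1]
    have hη0 : 0 ≤ η := (norm_nonneg _).trans (hη _ (hAb v hv))
    calc _ ≤ η * (a * ‖u‖) * (a * ‖w‖) := (abs_apply₂_le _ _ _).trans (by
            gcongr
            exacts [hη _ (hAb v hv), hAn u, hAn w])
      _ = η * a ^ 2 * ‖u‖ * ‖w‖ := by ring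
      _ ≤ _ := by gcongr
  · have hvR : ‖v‖ ≤ R := by rw [mem_ball_zero_iff] at hv; exact hv.le
    rw [hchr v hv, hder2 v hv]
    have k1 : |chr B (e₁ v) (fderiv ℝ e₁ v u) (fderiv ℝ e₁ v w) (fderiv ℝ e₁ v z)| ≤
        2 * C * (2 * a * ‖u‖) * (2 * a * ‖w‖) * (2 * a * ‖z‖) := by
      refine (abs_chr_le _ _ _ _ _).trans ?_
      rw [hfun]
      gcongr
      exacts [hB1 _ (hAb v hv), hDn v hv u, hDn v hv w, hDn v hv z]
    have k2 : |B (e₁ v) (fderiv ℝ (fderiv ℝ Φ) (A v) (A u) (A w)) (fderiv ℝ e₁ v z)| ≤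
        C * (C * (a * ‖u‖) * (a * ‖w‖)) * (2 * a * ‖z‖) := by
      refine (abs_apply₂_le _ _ _).trans ?_
      rw [hfun]
      gcongr
      · exact hB0 _ (hAb v hv)
      · refine ((fderiv ℝ (fderiv ℝ Φ) (A v)).le_opNorm₂ _ _).trans ?_
        gcongr
        exacts [hD2 _ (hAb v hv), hAn u, hAn w]
      · exact hDn v hv z
    calc _ ≤ R * (2 * C * (2 * a * ‖u‖) * (2 * a * ‖w‖) * (2 * a * ‖z‖) +
          C * (C * (a * ‖u‖) * (a * ‖w‖)) * (2 * a * ‖z‖)) := by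
            gcongr
            exact (abs_add_le _ _).trans (add_le_add k1 k2)
      _ = R * (16 * C * a ^ 3 + 2 * C ^ 2 * a ^ 3) * ‖u‖ * ‖w‖ * ‖z‖ := by ring
      _ ≤ _ := by gcongr
  · have hvR : ‖v‖ ≤ R := by rw [mem_ball_zero_iff] at hv; exact hv.le
    rw [hcurv v hv]
    calc _ ≤ R ^ 2 * ((4 * C + 8 * C ^ 5) * (2 * a * ‖b‖) * (2 * a * ‖u‖) * (2 * a * ‖w‖)
            * (2 * a * ‖z‖)) := by
            gcongr
            refine (abs_curv_le (C := C) (hB.contDiffAt.of_le (hle 2)) ?_ ?_ ?_ ?_ _ _ _ _).trans ?_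
            · rw [hfun]; exact hB0 _ (hAb v hv)
            · rw [hfun]; exact hB1 _ (hAb v hv)
            · rw [hfun]; exact hB2 _ (hAb v hv)
            · rw [hfun]; exact hB3 _ (hAb v hv)
            gcongr
            exacts [hDn v hv b, hDn v hv u, hDn v hv w, hDn v hv z]
      _ = R ^ 2 * ((4 * C + 8 * C ^ 5) * (2 * a) ^ 4) * ‖b‖ * ‖u‖ * ‖w‖ * ‖z‖ := by ring
      _ ≤ _ := by gcongr

set_option synthInstance.maxHeartbeats 200000 in
set_option maxHeartbeats 1000000 in
/-- Normal coordinates of a uniform radius `R` exist at all points near `p₀`. -/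
theorem exists_normalCoordinates {B : 𝔼 → 𝔼 →L[ℝ] 𝔼 →L[ℝ] ℝ} (hB : ContDiff ℝ ∞ B)
    (hs : ∀ x u v, B x u v = B x v u) (hpos : ∀ x v, v ≠ 0 → 0 < B x v v) (p₀ : 𝔼)
    {U : Set 𝔼} (hU : U ∈ 𝓝 p₀) {ε : ℝ} (hε : 0 < ε) :
    ∃ R > 0, ∀ᶠ p in 𝓝 p₀, ∃ e : OpenPartialHomeomorph 𝔼 𝔼, IsNormalCoordinates B R ε p U e := by
  obtain ⟨Φ, ρ, hρ, hΦ⟩ := exists_expMap hB (fun x => isInvertible_of_pos (hpos x)) p₀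
  have hp₀ : p₀ ∈ Metric.ball p₀ ρ := Metric.mem_ball_self hρ
  have h0ρ : (0 : 𝔼) ∈ Metric.ball (0 : 𝔼) ρ := Metric.mem_ball_self hρ
  obtain ⟨m, hm, hmB⟩ := exists_pos_le_form (hpos p₀)
  have hc0 : ContDiffAt ℝ ∞ (Function.uncurry Φ) (p₀, 0) := (hΦ p₀ hp₀).1 0 h0ρ
  have hev : ∀ᶠ q : 𝔼 × 𝔼 in 𝓝 (p₀, 0), ContDiffAt ℝ ∞ (Function.uncurry Φ) q := by
    filter_upwards [prod_mem_nhds (Metric.ball_mem_nhds p₀ hρ) (Metric.ball_mem_nhds (0 : 𝔼) hρ)]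
      with q hq using (hΦ q.1 hq.1).1 q.2 hq.2
  -- smoothness of the derivatives with respect to the second variable
  have hd (q : 𝔼 × 𝔼) (hq : ContDiffAt ℝ ∞ (Function.uncurry Φ) q) :
      ContDiffAt ℝ ∞ (fun q : 𝔼 × 𝔼 => fderiv ℝ (Φ q.1) q.2) q :=
    ContDiffAt.fderiv (f := fun q : 𝔼 × 𝔼 => Φ q.1) (g := Prod.snd) (n := ∞)
      (hq.comp (q, q.2) (contDiffAt_fst.fst.prodMk contDiffAt_snd)) contDiffAt_snd
      (by simp)
  have hd2 (q : 𝔼 × 𝔼) (hq : ContDiffAt ℝ ∞ (Function.uncurry Φ) q) :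
      ContDiffAt ℝ ∞ (fun q : 𝔼 × 𝔼 => fderiv ℝ (fderiv ℝ (Φ q.1)) q.2) q :=
    ContDiffAt.fderiv (f := fun q : 𝔼 × 𝔼 => fderiv ℝ (Φ q.1)) (g := Prod.snd) (n := ∞)
      ((hd q hq).comp (q, q.2) (contDiffAt_fst.fst.prodMk contDiffAt_snd)) contDiffAt_snd
      (by simp)
  have hΦ0 : Function.uncurry Φ (p₀, 0) = p₀ := (hΦ p₀ hp₀).2.1
  have hD0 : fderiv ℝ (Φ p₀) 0 = ContinuousLinearMap.id ℝ 𝔼 := by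
    ext v : 1
    exact (hΦ p₀ hp₀).2.2.1 v
  set a : ℝ := 1 + 2 / m with ha
  have ha0 : 0 < a := by positivity
  have hloc {X : Type} [NormedAddCommGroup X] (f : 𝔼 × 𝔼 → X) (hf : ContinuousAt f (p₀, 0)) :
      ∀ᶠ q in 𝓝 (p₀, (0 : 𝔼)), ‖f q‖ < ‖f (p₀, 0)‖ + 1 :=
    hf.norm.eventually_lt_const (by simp)
  have hBΦ {X : Type} [NormedAddCommGroup X] (f : 𝔼 → X) (hf : ContinuousAt f p₀) :
      ContinuousAt (fun q : 𝔼 × 𝔼 => f (Function.uncurry Φ q)) (p₀, 0) :=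
    ContinuousAt.comp (by rw [hΦ0]; exact hf) hc0.continuousAt
  have k2 := hloc _ (hd2 _ hc0).continuousAt
  have k3 := hloc _ (hBΦ _ hB.continuous.continuousAt)
  have k4 := hloc _ (hBΦ (fderiv ℝ B) (hB.continuous_fderiv (by simp)).continuousAt)
  have k5 := hloc _ (hBΦ (fderiv ℝ (fderiv ℝ B))
    ((hB.fderiv_right (m := ∞) (by simp)).continuous_fderiv (by simp)).continuousAt)
  have hBinv : ContinuousAt (fun x => (B x).inverse) p₀ := by
    obtain ⟨L, hL⟩ := isInvertible_of_pos (hpos p₀)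
    have h1 : ContDiffAt ℝ ∞ ContinuousLinearMap.inverse (B p₀) := by
      rw [← hL]; exact contDiffAt_map_inverse L
    exact h1.continuousAt.comp hB.continuous.continuousAt
  have k6 := hloc (X := (𝔼 →L[ℝ] ℝ) →L[ℝ] 𝔼) _ (hBΦ (fun x => (B x).inverse) hBinv)
  have k1 : ∀ᶠ q : 𝔼 × 𝔼 in 𝓝 (p₀, 0),
      ‖fderiv ℝ (Φ q.1) q.2 - ContinuousLinearMap.id ℝ 𝔼‖ < 1 / 2 := by
    refine ((hd _ hc0).continuousAt.sub continuousAt_const).norm.eventually_lt_const ?_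
    simp [hD0]
  have k7 : ∀ᶠ q : 𝔼 × 𝔼 in 𝓝 (p₀, 0), ‖pullbackForm B (Φ q.1) q.2 - B q.1‖ < ε / a ^ 2 := by
    have c1 : ContinuousAt (fun q : 𝔼 × 𝔼 => pullbackForm B (Φ q.1) q.2) (p₀, 0) := by
      have e1 : ContinuousAt (fun q : 𝔼 × 𝔼 =>
          (ContinuousLinearMap.compL ℝ 𝔼 𝔼 ℝ).flip (fderiv ℝ (Φ q.1) q.2)) (p₀, 0) :=
        (ContinuousLinearMap.compL ℝ 𝔼 𝔼 ℝ).flip.continuous.continuousAt.comp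
          (hd _ hc0).continuousAt
      exact e1.clm_comp ((hBΦ _ hB.continuous.continuousAt).clm_comp (hd _ hc0).continuousAt)
    have c2 : ContinuousAt (fun q : 𝔼 × 𝔼 => B q.1) (p₀, 0) :=
      hB.continuous.continuousAt.comp continuousAt_fst
    refine (c1.sub c2).norm.eventually_lt_const ?_
    have : pullbackForm B (Φ p₀) 0 - B p₀ = 0 := by
      ext u w
      have := (hΦ p₀ hp₀).2.1
      simp [this, hD0]
    change ‖pullbackForm B (Φ p₀) 0 - B p₀‖ < ε / a ^ 2
    rw [this, norm_zero]
    positivity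
  have k8 : ∀ᶠ q : 𝔼 × 𝔼 in 𝓝 (p₀, 0), ‖B q.1 - B p₀‖ < m / 2 := by
    have c2 : ContinuousAt (fun q : 𝔼 × 𝔼 => B q.1) (p₀, 0) :=
      hB.continuous.continuousAt.comp continuousAt_fst
    refine (c2.sub continuousAt_const).norm.eventually_lt_const ?_
    simpa using hm
  have k9 : ∀ᶠ q : 𝔼 × 𝔼 in 𝓝 (p₀, 0), Function.uncurry Φ q ∈ U :=
    hc0.continuousAt (by rw [hΦ0]; exact hU)
  have hall := ((((((((hev.and k1).and k2).and k3).and k4).and k5).and k6).and k7).and k8).and k9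
  obtain ⟨r', hr', hr⟩ := Metric.eventually_nhds_iff_ball.1 hall
  set r := min r' ρ with hrdef
  have hr0 : 0 < r := lt_min hr' hρ
  obtain ⟨C, hC0, hC2, hC3, hC4, hC5, hC6⟩ : ∃ C : ℝ, 0 ≤ C ∧
      ‖fderiv ℝ (fderiv ℝ (Φ p₀)) 0‖ + 1 ≤ C ∧ ‖B (Function.uncurry Φ (p₀, 0))‖ + 1 ≤ C ∧
      ‖fderiv ℝ B (Function.uncurry Φ (p₀, 0))‖ + 1 ≤ C ∧
      ‖fderiv ℝ (fderiv ℝ B) (Function.uncurry Φ (p₀, 0))‖ + 1 ≤ C ∧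
      ‖(B (Function.uncurry Φ (p₀, 0))).inverse‖ + 1 ≤ C := by
    refine ⟨(‖fderiv ℝ (fderiv ℝ (Φ p₀)) 0‖ + 1) + (‖B (Function.uncurry Φ (p₀, 0))‖ + 1) +
      (‖fderiv ℝ B (Function.uncurry Φ (p₀, 0))‖ + 1) +
      (‖fderiv ℝ (fderiv ℝ B) (Function.uncurry Φ (p₀, 0))‖ + 1) +
      (‖(B (Function.uncurry Φ (p₀, 0))).inverse‖ + 1), by positivity, ?_, ?_, ?_, ?_, ?_⟩
    all_goals
      have i1 := norm_nonneg (fderiv ℝ (fderiv ℝ (Φ p₀)) 0)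
      have i2 := norm_nonneg (B (Function.uncurry Φ (p₀, 0)))
      have i3 := norm_nonneg (fderiv ℝ B (Function.uncurry Φ (p₀, 0)))
      have i4 := norm_nonneg (fderiv ℝ (fderiv ℝ B) (Function.uncurry Φ (p₀, 0)))
      have i5 := norm_nonneg (B (Function.uncurry Φ (p₀, 0))).inverse
      linarith
  set K : ℝ := (16 * C * a ^ 3 + 2 * C ^ 2 * a ^ 3) + ((4 * C + 8 * C ^ 5) * (2 * a) ^ 4) + 1
    with hK
  have hK1 : (16 * C * a ^ 3 + 2 * C ^ 2 * a ^ 3) ≤ K := by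
    have : 0 ≤ (4 * C + 8 * C ^ 5) * (2 * a) ^ 4 := by positivity
    linarith
  have hK2 : ((4 * C + 8 * C ^ 5) * (2 * a) ^ 4) ≤ K := by
    have : 0 ≤ 16 * C * a ^ 3 + 2 * C ^ 2 * a ^ 3 := by positivity
    linarith
  have hK0 : 0 < K := by positivity
  set R := min (min 1 (r / a)) (ε / K) with hRdef
  have hR0 : 0 < R := by positivity
  have hRa : a * R ≤ r := by
    have : R ≤ r / a := (min_le_left _ _).trans (min_le_right _ _)
    rw [le_div_iff₀ ha0] at this
    linarith
  have hRK : R * K ≤ ε := by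
    have : R ≤ ε / K := min_le_right _ _
    rwa [le_div_iff₀ hK0] at this
  have hRone : R ≤ 1 := (min_le_left _ _).trans (min_le_left _ _)
  refine ⟨R, hR0, ?_⟩
  filter_upwards [Metric.ball_mem_nhds p₀ hr0] with p hp
  have hpρ : p ∈ Metric.ball p₀ ρ := Metric.ball_subset_ball (min_le_right _ _) hp
  have hq (v : 𝔼) (hv : v ∈ Metric.ball (0 : 𝔼) r) := hr (p, v) (by
    rw [← ball_prod_same]
    exact ⟨Metric.ball_subset_ball (min_le_left _ _) hp,
      Metric.ball_subset_ball (min_le_left _ _) hv⟩)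
  have h0r : (0 : 𝔼) ∈ Metric.ball (0 : 𝔼) r := Metric.mem_ball_self hr0
  refine exists_normalCoordinates_of_bounds (Φ := Φ p) (r := r) (C := C) (η := ε / a ^ 2) (a := a)
    hB hs hpos hC0 ha0 hR0 (fun v hv => ?_) (hΦ p hpρ).2.1 (hΦ p hpρ).2.2.1
    (fun v hv => (hΦ p hpρ).2.2.2 v (Metric.ball_subset_ball (min_le_right _ _) hv))
    ?_ ?_ ?_ ?_ ?_ ?_ ?_ ?_ ?_ hRa ?_ ?_ ?_
  · exact (hq v hv).1.1.1.1.1.1.1.1.1.comp v (contDiffAt_const.prodMk contDiffAt_id)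
  · exact fun v hv => (hq v hv).2
  · exact fun v hv => (hq v hv).1.1.1.1.1.1.1.1.2.le
  · exact fun v hv => (hq v hv).1.1.1.1.1.1.1.2.le.trans hC2
  · exact fun v hv => (hq v hv).1.1.1.1.1.1.2.le.trans hC3
  · exact fun v hv => (hq v hv).1.1.1.1.1.2.le.trans hC4
  · exact fun v hv => (hq v hv).1.1.1.1.2.le.trans hC5
  · exact fun v hv => (hq v hv).1.1.1.2.le.trans hC6
  · exact fun v hv => (hq v hv).1.1.2.le
  · intro u
    have e1 : ‖B p - B p₀‖ < m / 2 := (hq 0 h0r).1.2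
    have e2 := abs_le.1 (abs_apply₂_le (B p - B p₀) u u)
    have e3 : ‖B p - B p₀‖ * ‖u‖ * ‖u‖ ≤ m / 2 * ‖u‖ * ‖u‖ := by gcongr
    have e4 : m / 2 * ‖u‖ ^ 2 ≤ B p u u := by
      have := hmB u
      have e5 := e2.1
      simp only [sub_apply] at e5
      nlinarith
    have e6 : 1 ≤ a ^ 2 * (m / 2) := by
      rw [ha]
      field_simp
      nlinarith
    calc ‖u‖ ^ 2 ≤ a ^ 2 * (m / 2) * ‖u‖ ^ 2 := le_mul_of_one_le_left (by positivity) e6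
      _ = a ^ 2 * (m / 2 * ‖u‖ ^ 2) := by ring
      _ ≤ _ := by gcongr
  · exact (div_mul_cancel₀ ε (by positivity)).le
  · exact (mul_le_mul_of_nonneg_left hK1 hR0.le).trans hRK
  · refine le_trans ?_ hRK
    have : R ^ 2 ≤ R := by nlinarith
    gcongr

end NormalCoordinates

/-! ### The scalar curvature of a radial graph -/

section RadialGraph

variable {n : ℕ}

local notation "𝔼" => EuclideanSpace ℝ (Fin n)

theorem hasFDerivAt_norm_of_ne_zero {v : 𝔼} (hv : v ≠ 0) :
    HasFDerivAt (fun z : 𝔼 => ‖z‖) (‖v‖⁻¹ • innerSL ℝ v) v := by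
  have h1 : HasFDerivAt (fun z : 𝔼 => ‖z‖ ^ 2) (2 • innerSL ℝ v) v :=
    (hasStrictFDerivAt_norm_sq v).hasFDerivAt
  have hn : ‖v‖ ≠ 0 := norm_ne_zero_iff.2 hv
  have h2 := h1.sqrt (by positivity)
  simp only [Real.sqrt_sq (norm_nonneg _)] at h2
  have h3 : (1 / (2 * ‖v‖)) • 2 • innerSL ℝ v = ‖v‖⁻¹ • innerSL ℝ v := by
    rw [← Nat.cast_smul_eq_nsmul ℝ, smul_smul]
    congr 1
    push_cast
    field_simp
  rwa [h3] at h2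

theorem differentiableAt_deriv {φ : ℝ → ℝ} {r : ℝ} (hφ : ContDiffAt ℝ 2 φ r) :
    DifferentiableAt ℝ (deriv φ) r := by
  have h : ContDiffAt ℝ 1 (fderiv ℝ φ) r := hφ.fderiv_right (by norm_num)
  exact (h.differentiableAt (by norm_num)).clm_apply (differentiableAt_const 1)

theorem hasFDerivAt_radial {φ : ℝ → ℝ} {v : 𝔼} (hv : v ≠ 0) (hφ : DifferentiableAt ℝ φ ‖v‖) :
    HasFDerivAt (fun z : 𝔼 => φ ‖z‖) ((deriv φ ‖v‖ / ‖v‖) • innerSL ℝ v) v := by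
  have h := hφ.hasDerivAt.comp_hasFDerivAt v (hasFDerivAt_norm_of_ne_zero hv)
  rw [smul_smul] at h
  exact h

theorem fderiv_radial {φ : ℝ → ℝ} {v : 𝔼} (hv : v ≠ 0) (hφ : DifferentiableAt ℝ φ ‖v‖) (w : 𝔼) :
    fderiv ℝ (fun z : 𝔼 => φ ‖z‖) v w = deriv φ ‖v‖ / ‖v‖ * inner ℝ v w := by
  rw [(hasFDerivAt_radial hv hφ).fderiv]
  simp

theorem fderiv_fderiv_radial {φ : ℝ → ℝ} {v : 𝔼} (hv : v ≠ 0) (hφ : ContDiffAt ℝ 2 φ ‖v‖)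
    (u w : 𝔼) :
    fderiv ℝ (fderiv ℝ (fun z : 𝔼 => φ ‖z‖)) v u w =
      (deriv (deriv φ) ‖v‖ / ‖v‖ ^ 2 - deriv φ ‖v‖ / ‖v‖ ^ 3) * inner ℝ v u * inner ℝ v w +
        deriv φ ‖v‖ / ‖v‖ * inner ℝ u w := by
  have hn : ‖v‖ ≠ 0 := norm_ne_zero_iff.2 hv
  have hev : ∀ᶠ z : 𝔼 in 𝓝 v, z ≠ 0 ∧ DifferentiableAt ℝ φ ‖z‖ := by
    refine (eventually_ne_nhds hv).and ?_
    exact continuous_norm.continuousAt.eventually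
      ((hφ.eventually (by simp)).mono fun z hz => hz.differentiableAt (by norm_num))
  have h1 : fderiv ℝ (fun z : 𝔼 => φ ‖z‖) =ᶠ[𝓝 v]
      fun z => (deriv φ ‖z‖ / ‖z‖) • innerSL ℝ z := by
    filter_upwards [hev] with z hz using (hasFDerivAt_radial hz.1 hz.2).fderiv
  have hd : DifferentiableAt ℝ (deriv φ) ‖v‖ :=
    differentiableAt_deriv hφ
  have h2 : HasDerivAt (fun t => deriv φ t / t)
      ((deriv (deriv φ) ‖v‖ * ‖v‖ - deriv φ ‖v‖ * 1) / ‖v‖ ^ 2) ‖v‖ :=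
    hd.hasDerivAt.div (hasDerivAt_id _) hn
  have h3 := h2.comp_hasFDerivAt v (hasFDerivAt_norm_of_ne_zero hv)
  have h4 := h3.smul (innerSL ℝ (E := 𝔼)).hasFDerivAt
  rw [(h4.congr_of_eventuallyEq h1).fderiv]
  have e1 : innerSL ℝ u w = inner ℝ u w := rfl
  have e2 : innerSL ℝ v w = inner ℝ v w := rfl
  simp only [Function.comp_apply, add_apply, smul_apply, ContinuousLinearMap.smulRight_apply,
    innerSL_apply_apply, smul_eq_mul, e1, e2]
  field_simp
  ring

theorem IsNormalForm.sq_norm_le {R ε : ℝ} {B : 𝔼 → 𝔼 →L[ℝ] 𝔼 →L[ℝ] ℝ} {v : 𝔼}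
    (hB : IsNormalForm R ε B) (hv : v ∈ Metric.ball (0 : 𝔼) R) (u : 𝔼) :
    (1 - ε) * ‖u‖ ^ 2 ≤ B v u u := by
  have h := (abs_le.1 (hB.close v hv u u)).1
  have e : inner ℝ u u = ‖u‖ ^ 2 := real_inner_self_eq_norm_sq u
  rw [e] at h
  linear_combination h

theorem IsNormalForm.pos {R ε : ℝ} {B : 𝔼 → 𝔼 →L[ℝ] 𝔼 →L[ℝ] ℝ} {v : 𝔼}
    (hB : IsNormalForm R ε B) (hε : ε < 1) (hv : v ∈ Metric.ball (0 : 𝔼) R) (u : 𝔼)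
    (hu : u ≠ 0) : 0 < B v u u := by
  refine lt_of_lt_of_le ?_ (hB.sq_norm_le hv u)
  have := norm_pos_iff.2 hu
  have : 0 < 1 - ε := by linarith
  positivity

/-- The Hessian of `‖·‖² / 2` has the radial direction as an eigenvector. -/
theorem IsNormalForm.chr_radial {R ε : ℝ} {B : 𝔼 → 𝔼 →L[ℝ] 𝔼 →L[ℝ] ℝ} {v : 𝔼}
    (hB : IsNormalForm R ε B) (hv : v ∈ Metric.ball (0 : 𝔼) R) (w : 𝔼) :
    chr B v v w v = 0 := by
  have hd : DifferentiableAt ℝ B v := (hB.contDiffAt v hv).differentiableAt (by simp)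
  have h1 := (hasFDerivAt_form_apply (Φ := fun z : 𝔼 => z) (X := fun z : 𝔼 => z)
    (Y := fun z : 𝔼 => z) (z := v) hd (hasFDerivAt_id v) (hasFDerivAt_id v) (hasFDerivAt_id v)
    w).2
  have h2 : (fun z : 𝔼 => B z z z) =ᶠ[𝓝 v] fun z => ‖z‖ ^ 2 := by
    filter_upwards [Metric.isOpen_ball.mem_nhds hv] with z hz
    rw [hB.gauss z hz, real_inner_self_eq_norm_sq]
  have h3 : fderiv ℝ (fun z : 𝔼 => ‖z‖ ^ 2) v w = 2 * inner ℝ v w := by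
    rw [(hasStrictFDerivAt_norm_sq v).hasFDerivAt.fderiv]
    simp
  rw [h2.fderiv_eq, h3] at h1
  simp only [ContinuousLinearMap.id_apply, hB.gauss v hv, hB.symm v hv w v] at h1
  have h4 : ∀ a : 𝔼, fderiv ℝ B v a w v = fderiv ℝ B v a v w := fun a =>
    fderiv_symm_of_eventually hd (by
      filter_upwards [Metric.isOpen_ball.mem_nhds hv] with z hz using hB.symm z hz) a w v
  unfold chr
  rw [h4]
  linarith

/-- The bookkeeping behind the change of the scalar curvature when passing to a radial graph:
`T` is the table of sectional curvatures of the base and `S` the table of second fundamental forms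
of the distance spheres, the index `0` being the radial direction; `s = 1 / (1 + φ'²)`. -/
theorem sum_graph_curvature {m : ℕ} (T S : Fin (m + 1) → Fin (m + 1) → ℝ) (s p q r : ℝ)
    (hs : s * (1 + p ^ 2) = 1) (h00 : T 0 0 = 0) :
    ∑ a, ∑ c, (if a = 0 then s else 1) * (if c = 0 then s else 1) *
      (T a c + s * ((if a = 0 then q else p / r * S a a) * (if c = 0 then q else p / r * S c c)
        - (if a = 0 ∧ c = 0 then q ^ 2 else if a = 0 ∨ c = 0 then 0 else (p / r * S a c) ^ 2))) =
    ∑ a, ∑ c, T a c +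
      (r⁻¹ ^ 2 * ∑ a : Fin m, ∑ c : Fin m,
          (S a.succ a.succ * S c.succ c.succ - S a.succ c.succ ^ 2)
        - ∑ c : Fin m, (T 0 c.succ + T c.succ 0)) * (s * p ^ 2) +
      (r⁻¹ * ∑ c : Fin m, S c.succ c.succ) * (2 * p * q * s ^ 2) := by
  have hsp : s * p ^ 2 = 1 - s := by linarith
  have e1 : ∑ c : Fin m, s * (T 0 c.succ + s * (q * (p / r * S c.succ c.succ))) =
      s * ∑ c : Fin m, T 0 c.succ + s ^ 2 * q * p * r⁻¹ * ∑ c : Fin m, S c.succ c.succ := by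
    rw [Finset.mul_sum, Finset.mul_sum, ← Finset.sum_add_distrib]
    exact Finset.sum_congr rfl fun _ _ => by ring
  have e2 : ∑ c : Fin m, s * (T c.succ 0 + s * (p / r * S c.succ c.succ * q)) =
      s * ∑ c : Fin m, T c.succ 0 + s ^ 2 * q * p * r⁻¹ * ∑ c : Fin m, S c.succ c.succ := by
    rw [Finset.mul_sum, Finset.mul_sum, ← Finset.sum_add_distrib]
    exact Finset.sum_congr rfl fun _ _ => by ring
  have e3 : ∑ a : Fin m, ∑ c : Fin m, (T a.succ c.succ + s * (p / r * S a.succ a.succ *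
        (p / r * S c.succ c.succ) - (p / r * S a.succ c.succ) ^ 2)) =
      ∑ a : Fin m, ∑ c : Fin m, T a.succ c.succ + s * p ^ 2 * r⁻¹ ^ 2 *
        ∑ a : Fin m, ∑ c : Fin m, (S a.succ a.succ * S c.succ c.succ - S a.succ c.succ ^ 2) := by
    rw [Finset.mul_sum, ← Finset.sum_add_distrib]
    refine Finset.sum_congr rfl fun a _ => ?_
    rw [Finset.mul_sum, ← Finset.sum_add_distrib]
    exact Finset.sum_congr rfl fun _ _ => by ring
  simp only [Fin.sum_univ_succ, Fin.succ_ne_zero, if_true, if_false, and_false,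
    or_false, or_true, and_true, h00, one_mul, mul_one, sub_zero] at e1 e2 e3 ⊢
  rw [e1, Finset.sum_add_distrib, e2, e3, Finset.sum_add_distrib, Finset.sum_add_distrib]
  linear_combination (∑ i : Fin m, T 0 i.succ + ∑ i : Fin m, T i.succ 0) * hsp

/-- The scalar curvature of the graph of a radial function `φ ∘ ‖·‖` in normal coordinates. Here `H`
is the mean curvature of the distance sphere through `v`, and `Q` its squared mean curvature minus
the square of its second fundamental form, corrected by the radial Ricci curvature of the base; in
flat space they are `(n - 1) / r` and `(n - 1) (n - 2) / r²`. The lower bound for `Q` is where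
`3 ≤ n` is needed. -/
theorem IsNormalForm.coordScalar_graph (hn : 3 ≤ n) {R : ℝ} {B B' : 𝔼 → 𝔼 →L[ℝ] 𝔼 →L[ℝ] ℝ}
    {v : 𝔼} (hB : IsNormalForm R (1 / 100) B) (hv : v ∈ Metric.ball (0 : 𝔼) R) (hv0 : v ≠ 0)
    (hB' : ContDiffAt ℝ 2 B' v) {φ : ℝ → ℝ} (hφ : ContDiffAt ℝ 3 φ ‖v‖)
    (h : ∀ᶠ z in 𝓝 v, ∀ u w, B' z u w = B z u w +
      fderiv ℝ (fun z : 𝔼 => φ ‖z‖) z u * fderiv ℝ (fun z : 𝔼 => φ ‖z‖) z w) :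
    ∃ H Q : ℝ, |‖v‖ * H - (n - 1)| ≤ (n - 1) / 20 ∧ (n - 1) * (9 / 10) ≤ ‖v‖ ^ 2 * Q ∧
      coordScalar (fun z => formMatrix (B' z)) v = coordScalar (fun z => formMatrix (B z)) v +
        Q * (deriv φ ‖v‖ ^ 2 / (1 + deriv φ ‖v‖ ^ 2)) +
        H * (2 * deriv φ ‖v‖ * deriv (deriv φ) ‖v‖ / (1 + deriv φ ‖v‖ ^ 2) ^ 2) := by
  obtain ⟨m, rfl⟩ : ∃ m, n = m + 1 := ⟨n - 1, by omega⟩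
  set r := ‖v‖ with hr
  set p := deriv φ r with hp
  set q := deriv (deriv φ) r with hq
  have hr0 : r ≠ 0 := norm_ne_zero_iff.2 hv0
  have hrp : 0 < r := norm_pos_iff.2 hv0
  have hle (k : ℕ) : (k : WithTop ℕ∞) ≤ (∞ : WithTop ℕ∞) := by
    exact_mod_cast (le_top : (k : ℕ∞) ≤ ⊤)
  have hBv := hB.contDiffAt v hv
  have hB2 : ContDiffAt ℝ 2 B v := hBv.of_le (hle 2)
  have hpos := hB.pos (by norm_num) hv
  have hball : ∀ᶠ z in 𝓝 v, z ∈ Metric.ball (0 : EuclideanSpace ℝ (Fin (m + 1))) R :=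
    Metric.isOpen_ball.mem_nhds hv
  -- a frame adapted to the radial direction
  obtain ⟨b, hb, hb0⟩ := exists_orthonormal_frame (V := EuclideanSpace ℝ (Fin (m + 1)))
    (ι := Fin (m + 1)) (by simp)
    (LinearMap.mk₂ ℝ (fun u w => B v u w) (by simp) (by simp) (by simp) (by simp))
    (hB.symm v hv) hpos {0} (fun _ => r⁻¹ • v) (by
      rintro a rfl c rfl
      have e : inner ℝ v v = r ^ 2 := real_inner_self_eq_norm_sq v
      have e2 : B v v v = r ^ 2 := (hB.gauss v hv v).trans e
      change B v (r⁻¹ • v) (r⁻¹ • v) = _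
      rw [if_pos rfl, map_smul, map_smul, smul_apply, e2, smul_eq_mul, smul_eq_mul]
      field_simp)
  have hb (a c : Fin (m + 1)) : B v (b a) (b c) = if a = c then 1 else 0 := hb a c
  have hb0 : b 0 = r⁻¹ • v := hb0 0 rfl
  have hvb : v = r • b 0 := by rw [hb0, smul_smul, mul_inv_cancel₀ hr0, one_smul]
  have hinner (a : Fin (m + 1)) : inner ℝ v (b a) = if a = 0 then r else 0 := by
    rw [← hB.gauss v hv, hvb, ← hvb]
    nth_rw 2 [hvb]
    rw [map_smul, smul_apply, hb]
    simp [eq_comm]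
  have hnb (a : Fin (m + 1)) : ‖b a‖ ^ 2 ≤ 100 / 99 := by
    have := hB.sq_norm_le hv (b a)
    rw [hb, if_pos rfl] at this
    linarith
  have hnn (a c : Fin (m + 1)) : ‖b a‖ * ‖b c‖ ≤ 100 / 99 := by
    nlinarith [hnb a, hnb c, sq_nonneg (‖b a‖ - ‖b c‖)]
  set F : EuclideanSpace ℝ (Fin (m + 1)) → ℝ := fun z => φ ‖z‖ with hF
  have hFs : ContDiffAt ℝ 3 F v := hφ.comp v (contDiffAt_norm ℝ hv0)
  have hφd : DifferentiableAt ℝ φ r := hφ.differentiableAt (by norm_num)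
  have hDF (w) : fderiv ℝ F v w = p / r * inner ℝ v w := fderiv_radial hv0 hφd w
  have hBi : (B v).IsInvertible := isInvertible_of_pos hpos
  -- the Hessian of the height function
  have hhess (u w) : hessian B F v u w = (q / r ^ 2 - p / r ^ 3) * inner ℝ v u * inner ℝ v w +
      p / r * (inner ℝ u w - chr B v u w v) := by
    unfold hessian
    rw [hDF, fderiv_fderiv_radial hv0 (hφ.of_le (by norm_num)), ← hB.gauss v hv (chrVec _ _ _ _),
      hB.symm v hv v (chrVec _ _ _ _), apply_chrVec hBi]
    ring
  set S : Fin (m + 1) → Fin (m + 1) → ℝ := fun a c =>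
    inner ℝ (b a) (b c) - chr B v (b a) (b c) v with hS
  have hSsymm (a c) : S c a = S a c := by
    simp only [hS]
    rw [real_inner_comm, chr_symm (hBv.differentiableAt (by simp))
      (hball.mono fun z hz => hB.symm z hz)]
  have hSd (a c : Fin (m + 1)) : |S a c - if a = c then 1 else 0| ≤ 2 / 99 := by
    have h1 := hB.close v hv (b a) (b c)
    have h2 := hB.chr_le v hv (b a) (b c) v
    rw [← hr] at h2
    have h3 : |chr B v (b a) (b c) v| ≤ 1 / 100 * ‖b a‖ * ‖b c‖ := by
      have h4 : r * |chr B v (b a) (b c) v| ≤ r * (1 / 100 * ‖b a‖ * ‖b c‖) := by linarith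
      exact le_of_mul_le_mul_left h4 hrp
    rw [hb] at h1
    have h5 := hnn a c
    have e1 := abs_le.1 h1
    have e2 := abs_le.1 h3
    simp only [hS]
    rw [abs_le]
    constructor <;> nlinarith [e1.1, e1.2, e2.1, e2.2]
  have hchr0 (a : Fin (m + 1)) : chr B v (b 0) (b a) v = 0 := by
    have h1 := hB.chr_radial hv (b a)
    rw [← apply_chrVec hBi] at h1 ⊢
    rw [hb0, (chrVec_isLinearMap_left B v _).map_smul, map_smul, smul_apply, h1, smul_zero]
  have hdiag (a : Fin (m + 1)) : hessian B F v (b a) (b a) =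
      if a = 0 then q else p / r * S a a := by
    rw [hhess, hinner]
    split_ifs with ha
    · have e1 : inner ℝ (b 0) (b 0) = (1 : ℝ) := by
        nth_rw 1 [hb0]
        rw [real_inner_smul_left, hinner, if_pos rfl, inv_mul_cancel₀ hr0]
      rw [ha, hchr0, e1]
      field_simp
      ring
    · simp [hS]
  have hoff (a c : Fin (m + 1)) : hessian B F v (b c) (b a) * hessian B F v (b a) (b c) =
      if a = 0 ∧ c = 0 then q ^ 2 else if a = 0 ∨ c = 0 then 0 else (p / r * S a c) ^ 2 := by
    have hz (a : Fin (m + 1)) (ha : a ≠ 0) : hessian B F v (b 0) (b a) = 0 := by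
      have e1 : inner ℝ (b 0) (b a) = (0 : ℝ) := by
        rw [hb0, real_inner_smul_left, hinner, if_neg ha, mul_zero]
      rw [hhess, hchr0, e1, hinner a, if_neg ha]
      simp
    by_cases ha : a = 0 <;> by_cases hc : c = 0
    · have := hdiag 0
      rw [if_pos rfl] at this
      subst ha hc
      simp [this, sq]
    · subst ha
      simp [hc, hz c hc]
    · subst hc
      simp [ha, hz a ha]
    · rw [hhess, hhess, hinner, hinner, if_neg ha, if_neg hc]
      simp only [ha, hc, and_self, or_self, if_false]
      have := hSsymm a c
      simp only [hS] at this ⊢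
      rw [this]
      ring
  set s : ℝ := (1 + p ^ 2)⁻¹ with hs
  have hp0 : 0 < 1 + p ^ 2 := by positivity
  have hsp : s * (1 + p ^ 2) = 1 := inv_mul_cancel₀ hp0.ne'
  have hs0 : 0 < s := inv_pos.2 hp0
  set t : Fin (m + 1) → ℝ := fun a => if a = 0 then √s else 1 with ht
  have ht2 (a : Fin (m + 1)) : t a * t a = if a = 0 then s else 1 := by
    simp only [ht]
    split_ifs
    · exact Real.mul_self_sqrt hs0.le
    · norm_num
  have hevs : ∀ᶠ z in 𝓝 v, ∀ u w, B z u w = B z w u := hball.mono fun z hz => hB.symm z hz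
  have hevi : ∀ᶠ z in 𝓝 v, (B z).IsInvertible :=
    hball.mono fun z hz => isInvertible_of_pos (hB.pos (by norm_num) hz)
  have hevs' : ∀ᶠ z in 𝓝 v, ∀ u w, B' z u w = B' z w u := by
    filter_upwards [hevs, h] with z h1 h2 u w
    rw [h2, h2, h1, mul_comm (fderiv ℝ F z u)]
  have hevi' : ∀ᶠ z in 𝓝 v, (B' z).IsInvertible := by
    filter_upwards [hball, h] with z h1 h2
    refine isInvertible_of_pos fun u hu => ?_
    rw [h2]
    have := hB.pos (by norm_num) h1 u hu
    have := mul_self_nonneg (fderiv ℝ F z u)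
    linarith
  have hDFb (a : Fin (m + 1)) : fderiv ℝ F v (b a) = if a = 0 then p else 0 := by
    rw [hDF, hinner]
    split_ifs
    · field_simp
    · simp
  have hb' (a c : Fin (m + 1)) : B' v (t a • b a) (t c • b c) = if a = c then 1 else 0 := by
    rw [h.self_of_nhds]
    simp only [map_smul, smul_apply, smul_eq_mul, hb, hDFb]
    by_cases hac : a = c
    · subst hac
      have := ht2 a
      simp only [if_true]
      split_ifs at this ⊢ with ha
      · linear_combination (1 + p ^ 2) * this + hsp
      · linear_combination this
    · simp only [if_neg hac]
      by_cases ha : a = 0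
      · have : c ≠ 0 := fun hc => hac (ha.trans hc.symm)
        simp [this]
      · simp [ha]
  have hcurv (a c : Fin (m + 1)) : curv B' v (t c • b c) (t a • b a) (t a • b a) (t c • b c) =
      (if a = 0 then s else 1) * (if c = 0 then s else 1) *
      (curv B v (b c) (b a) (b a) (b c) + s * ((if a = 0 then q else p / r * S a a) *
        (if c = 0 then q else p / r * S c c) - (if a = 0 ∧ c = 0 then q ^ 2 else
          if a = 0 ∨ c = 0 then 0 else (p / r * S a c) ^ 2))) := by
    rw [(curv_isLinearMap₁ hB' _ _ _).map_smul, (curv_isLinearMap₂ hB' _ _ _).map_smul,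
      (curv_isLinearMap₃ hB' _ _ _).map_smul, (curv_isLinearMap₄ hB' _ _ _).map_smul,
      curv_graph (N := (p / r) • v) hB2 (hB.symm v hv) hBi hevi'.self_of_nhds hB' hFs
        (fun w => by rw [map_smul, smul_apply, hB.gauss v hv, hDF, smul_eq_mul]) ?_ h,
      hdiag, hdiag, hoff, ← ht2 a, ← ht2 c]
    · have e : inner ℝ v v = r ^ 2 := real_inner_self_eq_norm_sq v
      have : 1 + fderiv ℝ F v ((p / r) • v) = 1 + p ^ 2 := by
        rw [map_smul, hDF, e, smul_eq_mul]
        field_simp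
      rw [this, div_eq_mul_inv, ← hs]
      simp only [smul_eq_mul]
      ring
    · have e : inner ℝ v v = r ^ 2 := real_inner_self_eq_norm_sq v
      rw [map_smul, hDF, e, smul_eq_mul]
      have : p / r * (p / r * r ^ 2) = p ^ 2 := by field_simp
      rw [this]
      exact hp0.ne'
  have h1 := coordScalar_eq_sum_curv hB2 hevs hevi hb
  have h2 := coordScalar_eq_sum_curv hB' hevs' hevi' hb'
  simp only [hcurv] at h2
  have h00 : curv B v (b 0) (b 0) (b 0) (b 0) = 0 := by unfold curv; ring
  rw [sum_graph_curvature (fun a c => curv B v (b c) (b a) (b a) (b c)) S s p q r hsp h00, ← h1]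
    at h2
  refine ⟨r⁻¹ * ∑ c : Fin m, S c.succ c.succ, r⁻¹ ^ 2 * ∑ a : Fin m, ∑ c : Fin m,
    (S a.succ a.succ * S c.succ c.succ - S a.succ c.succ ^ 2) -
    ∑ c : Fin m, (curv B v (b c.succ) (b 0) (b 0) (b c.succ) +
        curv B v (b 0) (b c.succ) (b c.succ) (b 0)), ?_, ?_, h2.trans ?_⟩
  rotate_left 2
  · congr 1
    · congr 2
      rw [hs]; exact inv_mul_eq_div _ _
    · congr 1
      rw [hs, inv_pow]; exact (div_eq_mul_inv _ _).symm
  · rw [mul_inv_cancel_left₀ hr0]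
    have e1 : ∑ c : Fin m, S c.succ c.succ - ((m + 1 : ℕ) - 1) = ∑ c : Fin m, (S c.succ c.succ - 1) := by
      rw [Finset.sum_sub_distrib (fun c : Fin m => S c.succ c.succ) fun _ => (1 : ℝ),
        Finset.sum_const, Finset.card_univ, Fintype.card_fin]
      simp only [nsmul_eq_mul]
      push_cast
      ring
    rw [e1]
    refine (Finset.abs_sum_le_sum_abs _ _).trans ?_
    refine (Finset.sum_le_card_nsmul _ _ (2 / 99) fun c _ => ?_).trans ?_
    · have := hSd c.succ c.succ
      rwa [if_pos rfl] at this
    · simp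
      have : (0 : ℝ) ≤ m := by positivity
      linarith
  · have hcb (a c : Fin (m + 1)) :
        |r ^ 2 * curv B v (b c) (b a) (b a) (b c)| ≤ 1 / 100 * (100 / 99 * (100 / 99)) := by
      rw [abs_mul, abs_of_nonneg (by positivity : 0 ≤ r ^ 2)]
      refine (hB.curv_le v hv _ _ _ _).trans ?_
      have := mul_le_mul (hnn c a) (hnn a c) (by positivity) (by norm_num)
      nlinarith
    have e1 : ∑ c : Fin m, (r ^ 2 * (curv B v (b c.succ) (b 0) (b 0) (b c.succ) +
        curv B v (b 0) (b c.succ) (b c.succ) (b 0))) ≤ m * (3 / 100) := by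
      refine (Finset.sum_le_card_nsmul _ _ (3 / 100) fun c _ => ?_).trans (by simp)
      have k1 := (abs_le.1 (hcb 0 c.succ)).2
      have k2 := (abs_le.1 (hcb c.succ 0)).2
      rw [mul_add]
      linarith
    have e2 : (m : ℝ) * ((m - 1) * (95 / 100)) ≤ ∑ a : Fin m, ∑ c : Fin m,
        (S a.succ a.succ * S c.succ c.succ - S a.succ c.succ ^ 2) := by
      have k (a : Fin m) : ((m : ℝ) - 1) * (95 / 100) ≤ ∑ c : Fin m,
          (S a.succ a.succ * S c.succ c.succ - S a.succ c.succ ^ 2) := by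
        calc ((m : ℝ) - 1) * (95 / 100) = ∑ c : Fin m, if a = c then 0 else (95 / 100 : ℝ) := by
              have e (c : Fin m) : (if a = c then 0 else (95 / 100 : ℝ)) =
                  95 / 100 - if a = c then 95 / 100 else 0 := by split_ifs <;> simp
              rw [Finset.sum_congr rfl fun c _ => e c, Finset.sum_sub_distrib, Finset.sum_ite_eq]
              simp
              ring
          _ ≤ _ := Finset.sum_le_sum fun c _ => by
              split_ifs with hac
              · subst hac; apply le_of_eq; ring
              · have k1 := abs_le.1 (hSd a.succ a.succ)
                have k2 := abs_le.1 (hSd c.succ c.succ)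
                have k3 := abs_le.1 (hSd a.succ c.succ)
                simp only [if_true, Fin.succ_inj, hac, if_false, sub_zero] at k1 k2 k3
                nlinarith [mul_nonneg (sub_nonneg.2 k1.1) (sub_nonneg.2 k2.1)]
      calc (m : ℝ) * ((m - 1) * (95 / 100)) = ∑ a : Fin m, ((m : ℝ) - 1) * (95 / 100) := by simp
        _ ≤ _ := Finset.sum_le_sum fun a _ => k a
    rw [← Finset.mul_sum] at e1
    have hm : (2 : ℝ) ≤ m := by exact_mod_cast (by omega : 2 ≤ m)
    rw [mul_sub, ← mul_assoc, ← mul_pow, mul_inv_cancel₀ hr0, one_pow, one_mul]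
    push_cast
    nlinarith

end RadialGraph

/-! ### The profile of a well -/

section Profile

theorem exists_deriv_smoothTransition_le :
    ∃ K : ℝ, 0 < K ∧ ∀ x, deriv Real.smoothTransition x ≤ K := by
  have hT : ContDiff ℝ ∞ Real.smoothTransition := Real.smoothTransition.contDiff
  have hc : Continuous (deriv Real.smoothTransition) := hT.continuous_deriv (by simp)
  obtain ⟨C, hC⟩ := (isCompact_Icc (a := (0 : ℝ)) (b := 1)).exists_bound_of_continuousOn
    hc.continuousOn
  have hC0 : 0 ≤ C := (norm_nonneg _).trans (hC 0 (by simp))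
  refine ⟨C + 1, by linarith, fun x => ?_⟩
  rcases lt_or_ge x 0 with h | h
  · have : Real.smoothTransition =ᶠ[𝓝 x] fun _ => 0 := by
      filter_upwards [Iio_mem_nhds h] with y hy
        using Real.smoothTransition.zero_of_nonpos (le_of_lt hy)
    rw [this.deriv_eq, deriv_const]
    linarith
  rcases lt_or_ge 1 x with h' | h'
  · have : Real.smoothTransition =ᶠ[𝓝 x] fun _ => 1 := by
      filter_upwards [Ioi_mem_nhds h'] with y hy
        using Real.smoothTransition.one_of_one_le (le_of_lt hy)
    rw [this.deriv_eq, deriv_const]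
    linarith
  · have := (abs_le.1 (hC x ⟨h, h'⟩)).2
    linarith

/-- A cutoff function `ψ` that rises from `0` to `1` arbitrarily close to `0` and then decays to
`0` so slowly that the logarithmic derivative of `ψ²` exceeds `-6 / (7 r)`, up to an error `σ r`. -/
theorem exists_slow_cutoff {δ σ : ℝ} (hδ : 0 < δ) (hσ : 0 < σ) :
    ∃ (ψ : ℝ → ℝ) (ρ : ℝ), ContDiff ℝ ∞ ψ ∧ 0 < ρ ∧ 2 * ρ < δ ∧ (∀ r, 0 ≤ ψ r) ∧ (∀ r, ψ r ≤ 1) ∧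
      (∀ r ≤ ρ / 2, ψ r = 0) ∧ (∀ r ∈ Icc ρ (2 * ρ), ψ r = 1) ∧ (∀ r, δ ≤ r → ψ r = 0) ∧
      ∀ r, 0 < r → -(6 / 7 * ψ r ^ 2 / r) - σ * r ≤ 2 * ψ r * deriv ψ r := by
  obtain ⟨K, hK, hTK⟩ := exists_deriv_smoothTransition_le
  set T := Real.smoothTransition with hTdef
  have hT : ContDiff ℝ ∞ T := Real.smoothTransition.contDiff
  have hT0 (x : ℝ) : 0 ≤ T x := Real.smoothTransition.nonneg x
  have hT1 (x : ℝ) : T x ≤ 1 := Real.smoothTransition.le_one x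
  have hTd (x : ℝ) : HasDerivAt T (deriv T x) x := (hT.differentiable (by simp) x).hasDerivAt
  have hTn (x : ℝ) : 0 ≤ deriv T x := Real.smoothTransition.monotone.deriv_nonneg
  set e₀ : ℝ := min 1 (σ * δ ^ 2 / (16 * K)) with he₀
  have he₀0 : 0 < e₀ := by positivity
  have he₀1 : e₀ ≤ 1 := min_le_left _ _
  have he₀K : e₀ ^ 2 * (16 * K) ≤ σ * δ ^ 2 := by
    have h1 : e₀ ≤ σ * δ ^ 2 / (16 * K) := min_le_right _ _
    rw [le_div_iff₀ (by positivity)] at h1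
    nlinarith [mul_pos he₀0 hK]
  set e : ℝ := 3 / 7 * e₀ / K with he
  have he0 : 0 < e := by positivity
  set s : ℝ := δ / 4 * Real.exp (-(1 / e)) with hs
  have hs0 : 0 < s := by positivity
  have hsδ : s < δ / 4 := by
    have : Real.exp (-(1 / e)) < 1 := Real.exp_lt_one_iff.2 (by rw [neg_lt_zero]; positivity)
    rw [hs]
    nlinarith
  -- `A` switches the function on below the radius `s / 2`, `L` decreases it to `e₀` linearly in
  -- `log r`, and `D` switches it off between `δ / 2` and `δ`, where its size is only `e₀`.
  set A : ℝ → ℝ := fun r => T (4 * r / s - 1) with hA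
  set L : ℝ → ℝ := fun r => 1 - (1 - e₀) * T (e * Real.log (r / s)) with hL
  set D : ℝ → ℝ := fun r => T (2 - 2 * r / δ) with hD
  have hA0 (r : ℝ) (h : r ≤ s / 4) : A r = 0 := Real.smoothTransition.zero_of_nonpos (by
    rw [sub_nonpos, div_le_one hs0]; linarith)
  have hA1 (r : ℝ) (h : s / 2 ≤ r) : A r = 1 := Real.smoothTransition.one_of_one_le (by
    rw [le_sub_iff_add_le, le_div_iff₀ hs0]; linarith)
  have hD0 (r : ℝ) (h : δ ≤ r) : D r = 0 := Real.smoothTransition.zero_of_nonpos (by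
    rw [sub_nonpos, le_div_iff₀ hδ]; linarith)
  have hD1 (r : ℝ) (h : r ≤ δ / 2) : D r = 1 := Real.smoothTransition.one_of_one_le (by
    rw [le_sub_iff_add_le, ← le_sub_iff_add_le', div_le_iff₀ hδ]; linarith)
  have hL1 (r : ℝ) (h0 : 0 < r) (h : r ≤ s) : L r = 1 := by
    have : T (e * Real.log (r / s)) = 0 := Real.smoothTransition.zero_of_nonpos
      (mul_nonpos_of_nonneg_of_nonpos he0.le
        (Real.log_nonpos (by positivity) ((div_le_one hs0).2 h)))
    simp only [hL, this]
    ring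
  have hLe (r : ℝ) (h : δ / 4 ≤ r) : L r = e₀ := by
    have h1 : 1 / e ≤ Real.log (r / s) := by
      rw [Real.le_log_iff_exp_le (by have : 0 < r := by linarith
                                     positivity), le_div_iff₀ hs0]
      calc _ = δ / 4 * (Real.exp (1 / e) * Real.exp (-(1 / e))) := by rw [hs]; ring
        _ = δ / 4 := by rw [← Real.exp_add, add_neg_cancel, Real.exp_zero, mul_one]
        _ ≤ r := h
    have : T (e * Real.log (r / s)) = 1 := Real.smoothTransition.one_of_one_le (by
      rw [div_le_iff₀ he0] at h1; linarith)
    simp only [hL, this]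
    ring
  have hLb (r : ℝ) : e₀ ≤ L r ∧ L r ≤ 1 := by
    have h1 := hT0 (e * Real.log (r / s))
    have h2 := hT1 (e * Real.log (r / s))
    simp only [hL]
    constructor <;> nlinarith
  set ψ : ℝ → ℝ := fun r => A r * L r * D r with hψ
  have hψ0 (r : ℝ) : 0 ≤ ψ r :=
    mul_nonneg (mul_nonneg (hT0 _) (he₀0.le.trans (hLb r).1)) (hT0 _)
  have hAc : ContDiff ℝ ∞ A := hT.comp (by fun_prop)
  have hDc : ContDiff ℝ ∞ D := hT.comp (by fun_prop)
  have hsm : ContDiff ℝ ∞ ψ := by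
    rw [contDiff_iff_contDiffAt]
    intro r
    rcases lt_or_ge r (s / 4) with h | h
    · have : ψ =ᶠ[𝓝 r] fun _ => 0 := by
        filter_upwards [Iio_mem_nhds h] with y hy
        simp only [hψ, hA0 y (le_of_lt hy), zero_mul]
      exact contDiffAt_const.congr_of_eventuallyEq this
    · have hr : 0 < r := by linarith
      have hl : ContDiffAt ℝ ∞ (fun r => Real.log (r / s)) r :=
        (contDiffAt_id.div_const s).log (by positivity)
      have hLc : ContDiffAt ℝ ∞ L r := contDiffAt_const.sub
        (contDiffAt_const.mul (hT.contDiffAt.comp r (contDiffAt_const.mul hl)))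
      exact (hAc.contDiffAt.mul hLc).mul hDc.contDiffAt
  refine ⟨ψ, s / 2, hsm, by positivity, by linarith, hψ0, fun r => ?_, fun r hr => ?_,
    fun r hr => ?_, fun r hr => ?_, fun r hr => ?_⟩
  · exact mul_le_one₀ (mul_le_one₀ (hT1 _) (he₀0.le.trans (hLb r).1) (hLb r).2) (hT0 _) (hT1 _)
  · simp only [hψ, hA0 r (by linarith), zero_mul]
  · simp only [hψ, hA1 r hr.1, hL1 r (by linarith [hr.1]) (by linarith [hr.2]),
      hD1 r (by linarith [hr.2]), mul_one]
  · simp only [hψ, hD0 r hr, mul_zero]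
  · have hneg : -(6 / 7 * ψ r ^ 2 / r) - σ * r ≤ 0 := by
      have : 0 ≤ 6 / 7 * ψ r ^ 2 / r := by positivity
      nlinarith
    rcases lt_or_ge r s with h1 | h1
    · -- here `ψ` is increasing
      have hev : ψ =ᶠ[𝓝 r] A := by
        filter_upwards [Ioo_mem_nhds hr h1] with y hy
        simp only [hψ, hL1 y hy.1 hy.2.le, hD1 y (by linarith [hy.2]), mul_one]
      have hAd : 0 ≤ deriv A r := by
        have : Monotone A := fun x y hxy => Real.smoothTransition.monotone (by
          have : 4 * x / s ≤ 4 * y / s := by gcongr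
          linarith)
        exact this.deriv_nonneg
      rw [hev.deriv_eq]
      have := hψ0 r
      exact hneg.trans (by positivity)
    rcases lt_or_ge r (δ / 2) with h2 | h2
    · have hev : ψ =ᶠ[𝓝 r] L := by
        filter_upwards [Ioo_mem_nhds (by linarith : s / 2 < r) h2] with y hy
        simp only [hψ, hA1 y hy.1.le, hD1 y hy.2.le, mul_one, one_mul]
      have hLd : HasDerivAt L (-((1 - e₀) * (deriv T (e * Real.log (r / s)) * (e * (1 / r))))) r := by
        have hl : HasDerivAt (fun r => Real.log (r / s)) (1 / r) r := by
          have := ((hasDerivAt_id r).div_const s).log (by simp; constructor <;> positivity)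
          convert this using 1
          simp
          field_simp
          exact (div_self hr.ne').symm
        have := (((hTd (e * Real.log (r / s))).comp r (hl.const_mul e)).const_mul (1 - e₀)).const_sub 1
        exact this
      rw [hev.deriv_eq, hLd.deriv, hev.eq_of_nhds]
      have hLr := hLb r
      have h3 : deriv T (e * Real.log (r / s)) * (1 - e₀) ≤ K * 1 :=
        mul_le_mul (hTK _) (by linarith) (by linarith) hK.le
      have h4 : K * e = 3 / 7 * e₀ := by rw [he]; field_simp
      have h5 : (1 - e₀) * deriv T (e * Real.log (r / s)) * e ≤ 3 / 7 * L r := by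
        nlinarith
      have h6 : 0 ≤ L r := he₀0.le.trans hLr.1
      have h7 : L r * ((1 - e₀) * deriv T (e * Real.log (r / s)) * e) / r ≤
          L r * (3 / 7 * L r) / r := by gcongr
      have h8 : 0 ≤ σ * r := by positivity
      have h9 : 2 * L r * -((1 - e₀) * (deriv T (e * Real.log (r / s)) * (e * (1 / r)))) =
          -(2 * (L r * ((1 - e₀) * deriv T (e * Real.log (r / s)) * e) / r)) := by ring
      rw [h9]
      have h10 : 6 / 7 * L r ^ 2 / r = 2 * (L r * (3 / 7 * L r) / r) := by ring
      linarith
    · have hev : ψ =ᶠ[𝓝 r] fun r => e₀ * D r := by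
        filter_upwards [Ioi_mem_nhds (by linarith : δ / 4 < r)] with y hy
        have hy : δ / 4 < y := hy
        simp only [hψ, hA1 y (by linarith), hLe y hy.le, one_mul]
      have hDd : HasDerivAt (fun r => e₀ * D r) (e₀ * (deriv T (2 - 2 * r / δ) * (-(2 / δ)))) r := by
        have hl : HasDerivAt (fun r : ℝ => 2 - 2 * r / δ) (-(2 / δ)) r := by
          have := (((hasDerivAt_id r).const_mul 2).div_const δ).const_sub 2
          exact this.congr_deriv (by rw [mul_one])
        exact ((hTd _).comp r hl).const_mul e₀
      rw [hev.deriv_eq, hDd.deriv, hev.eq_of_nhds]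
      have h3 : D r * deriv T (2 - 2 * r / δ) ≤ 1 * K :=
        mul_le_mul (hT1 _) (hTK _) (hTn _) zero_le_one
      have h4 : e₀ ^ 2 * (D r * deriv T (2 - 2 * r / δ)) * 4 / δ ≤ e₀ ^ 2 * (1 * K) * 4 / δ := by
        gcongr
      have h5 : e₀ ^ 2 * (1 * K) * 4 / δ ≤ σ * (δ / 4) := by
        rw [div_le_iff₀ hδ]
        nlinarith
      have h6 : σ * (δ / 4) ≤ σ * r := by gcongr; linarith
      have h7 : 2 * (e₀ * D r) * (e₀ * (deriv T (2 - 2 * r / δ) * (-(2 / δ)))) =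
          -(e₀ ^ 2 * (D r * deriv T (2 - 2 * r / δ)) * 4 / δ) := by ring
      rw [h7]
      have : 0 ≤ 6 / 7 * (e₀ * D r) ^ 2 / r := by positivity
      linarith

/-- The profile of a well of depth `d` and radius `δ`: its slope is `-t ψ / √(1 + t² (1 - ψ²))` for
a slow cutoff function `ψ`, which makes `φ'² / (1 + φ'²)` a multiple of `ψ²` while the slope is as
large as necessary where `ψ = 1`. -/
theorem exists_profile {δ d σ : ℝ} (hδ : 0 < δ) (hd : 0 < d) (hσ : 0 < σ) :
    ∃ φ : ℝ → ℝ, ContDiff ℝ ∞ φ ∧ Antitone φ ∧ (∃ ρ > 0, ∀ r ≤ ρ, φ r = d) ∧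
      (∀ r, δ ≤ r → φ r = 0) ∧ ∀ r, 0 < r →
      -(6 / 7 * (deriv φ r ^ 2 / (1 + deriv φ r ^ 2)) / r) - σ * r ≤
        2 * deriv φ r * deriv (deriv φ) r / (1 + deriv φ r ^ 2) ^ 2 := by
  obtain ⟨ψ, ρ, hψ, hρ, hρδ, hψ0, hψ1, hz, hone, hδz, hslow⟩ := exists_slow_cutoff hδ hσ
  have hsq (r : ℝ) : 0 ≤ 1 - ψ r ^ 2 := by nlinarith [hψ0 r, hψ1 r]
  have hden (t r : ℝ) : 0 < 1 + t ^ 2 * (1 - ψ r ^ 2) := by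
    have := mul_nonneg (sq_nonneg t) (hsq r)
    linarith
  set P : ℝ → ℝ → ℝ := fun t r => t * ψ r / √(1 + t ^ 2 * (1 - ψ r ^ 2)) with hP
  have hPc : Continuous (Function.uncurry P) := by
    have h1 : Continuous fun q : ℝ × ℝ => ψ q.2 := hψ.continuous.comp continuous_snd
    refine Continuous.div (by fun_prop) (by fun_prop) fun q => ?_
    exact (Real.sqrt_pos.2 (hden q.1 q.2)).ne'
  have hPt (t : ℝ) : ContDiff ℝ ∞ (P t) := by
    refine ContDiff.div (contDiff_const.mul hψ) (ContDiff.sqrt ?_ fun r => (hden t r).ne')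
      fun r => (Real.sqrt_pos.2 (hden t r)).ne'
    exact contDiff_const.add (contDiff_const.mul (contDiff_const.sub (hψ.pow 2)))
  have hP0 (t : ℝ) (ht : 0 ≤ t) (r : ℝ) : 0 ≤ P t r :=
    div_nonneg (mul_nonneg ht (hψ0 r)) (Real.sqrt_nonneg _)
  have hint (t a b : ℝ) : IntervalIntegrable (P t) MeasureTheory.volume a b :=
    (hPt t).continuous.intervalIntegrable a b
  have hheight : Continuous fun t => ∫ r in (0 : ℝ)..δ, P t r :=
    intervalIntegral.continuous_parametric_intervalIntegral_of_continuous' hPc 0 δ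
  have hbig : d ≤ ∫ r in (0 : ℝ)..δ, P (d / ρ) r := by
    have hdρ : 0 ≤ d / ρ := by positivity
    calc d = ∫ r in ρ..2 * ρ, d / ρ := by
          rw [intervalIntegral.integral_const, smul_eq_mul]; field_simp; ring
      _ = ∫ r in ρ..2 * ρ, P (d / ρ) r := by
          refine intervalIntegral.integral_congr fun r hr => ?_
          rw [uIcc_of_le (by linarith)] at hr
          simp [hP, hone r hr]
      _ ≤ ∫ r in (0 : ℝ)..δ, P (d / ρ) r :=
          intervalIntegral.integral_mono_interval hρ.le (by linarith) hρδ.le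
            (Eventually.of_forall fun r => hP0 _ hdρ r) (hint _ _ _)
  -- The amplitude `t` is chosen so that the total descent is `d`.
  obtain ⟨t, ht, htd⟩ : ∃ t ∈ Icc 0 (d / ρ), ∫ r in (0 : ℝ)..δ, P t r = d := by
    refine intermediate_value_Icc (by positivity) hheight.continuousOn ⟨?_, hbig⟩
    simp [hP, hd.le]
  set φ : ℝ → ℝ := fun r => d - ∫ x in (0 : ℝ)..r, P t x with hφ
  have hφd (r : ℝ) : HasDerivAt φ (-P t r) r := by
    have := (intervalIntegral.integral_hasDerivAt_right (hint t 0 r)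
      ((hPt t).continuous.stronglyMeasurableAtFilter _ _) (hPt t).continuous.continuousAt).const_sub d
    exact this
  have hφ' : deriv φ = fun r => -P t r := funext fun r => (hφd r).deriv
  have hzero (r : ℝ) (hr : δ ≤ r) : φ r = 0 := by
    have h1 : ∫ x in δ..r, P t x = 0 := by
      rw [intervalIntegral.integral_congr (g := fun _ => 0) fun x hx => ?_]
      · simp
      · rw [uIcc_of_le hr] at hx
        simp [hP, hδz x hx.1]
    have h2 := intervalIntegral.integral_add_adjacent_intervals (hint t 0 δ) (hint t δ r)
    simp only [hφ]
    rw [← h2, h1, htd]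
    ring
  refine ⟨φ, ?_, ?_, ⟨ρ / 2, by positivity, fun r hr => ?_⟩, hzero, fun r hr => ?_⟩
  · rw [contDiff_infty_iff_deriv, hφ']
    exact ⟨fun r => (hφd r).differentiableAt, (hPt t).neg⟩
  · refine antitone_of_deriv_nonpos (fun r => (hφd r).differentiableAt) fun r => ?_
    rw [hφ']
    exact neg_nonpos.2 (hP0 t ht.1 r)
  · simp only [hφ]
    rw [intervalIntegral.integral_congr (g := fun _ => 0) fun x hx => ?_]
    · simp
    · have : x ≤ ρ / 2 := (hx.2).trans (max_le (by positivity) hr)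
      simp [hP, hz x this]
  · have hsq1 (r : ℝ) : 1 + P t r ^ 2 = (1 + t ^ 2) / (1 + t ^ 2 * (1 - ψ r ^ 2)) := by
      simp only [hP, div_pow, Real.sq_sqrt (hden t r).le]
      have := (hden t r).ne'
      field_simp
      ring
    have hw (r : ℝ) : P t r ^ 2 / (1 + P t r ^ 2) = t ^ 2 / (1 + t ^ 2) * ψ r ^ 2 := by
      rw [hsq1]
      simp only [hP, div_pow, Real.sq_sqrt (hden t r).le]
      have := (hden t r).ne'
      have : 1 + t ^ 2 ≠ 0 := by positivity
      field_simp
    have hPd : HasDerivAt (P t) (deriv (P t) r) r :=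
      ((hPt t).differentiable (by simp) r).hasDerivAt
    have hψd : HasDerivAt ψ (deriv ψ r) r := (hψ.differentiable (by simp) r).hasDerivAt
    have h1 : 2 * P t r * deriv (P t) r / (1 + P t r ^ 2) ^ 2 =
        t ^ 2 / (1 + t ^ 2) * (2 * ψ r * deriv ψ r) := by
      have e1 : HasDerivAt (fun r => P t r ^ 2 / (1 + P t r ^ 2))
          (2 * P t r * deriv (P t) r / (1 + P t r ^ 2) ^ 2) r := by
        have a1 := hPd.fun_pow 2
        have a2 := a1.fun_div (a1.const_add 1) (by positivity)
        refine a2.congr_deriv ?_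
        congr 1
        norm_num
        ring
      have e2 : HasDerivAt (fun r => t ^ 2 / (1 + t ^ 2) * ψ r ^ 2)
          (t ^ 2 / (1 + t ^ 2) * (2 * ψ r * deriv ψ r)) r := by
        have a1 := (hψd.fun_pow 2).const_mul (t ^ 2 / (1 + t ^ 2))
        exact a1.congr_deriv (by norm_num)
      rw [funext hw] at e1
      exact e1.unique e2
    have h2 : deriv (deriv φ) r = -deriv (P t) r := by rw [hφ']; exact hPd.neg.deriv
    have h3 : deriv φ r = -P t r := (hφd r).deriv
    rw [h2, h3, neg_sq, hw]
    have h4 : 2 * -P t r * -deriv (P t) r / (1 + P t r ^ 2) ^ 2 =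
        2 * P t r * deriv (P t) r / (1 + P t r ^ 2) ^ 2 := by ring
    rw [h4, h1]
    have hc0 : 0 ≤ t ^ 2 / (1 + t ^ 2) := by positivity
    have hc1 : t ^ 2 / (1 + t ^ 2) ≤ 1 := by rw [div_le_one (by positivity)]; linarith
    have h5 := mul_le_mul_of_nonneg_left (hslow r hr) hc0
    have h6 : t ^ 2 / (1 + t ^ 2) * (σ * r) ≤ 1 * (σ * r) := by gcongr
    have h7 : 6 / 7 * (t ^ 2 / (1 + t ^ 2) * ψ r ^ 2) / r =
        t ^ 2 / (1 + t ^ 2) * (6 / 7 * ψ r ^ 2 / r) := by ring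
    rw [h7]
    linarith

end Profile

/-! ### Graph metrics and pullbacks -/

section GraphMetric

variable {n : ℕ} {M : Type*} [TopologicalSpace M]
  [ChartedSpace (EuclideanSpace ℝ (Fin n)) M] [IsManifold (𝓡 n) ∞ M]

local notation "𝔼" => EuclideanSpace ℝ (Fin n)

/-- The derivative of a smooth map, applied to a smooth vector field. -/
theorem contMDiffAt_mfderiv_apply {E E' : Type*} [NormedAddCommGroup E] [NormedSpace ℝ E]
    [NormedAddCommGroup E'] [NormedSpace ℝ E']
    {N N' : Type*} [TopologicalSpace N] [ChartedSpace E N] [IsManifold 𝓘(ℝ, E) ∞ N]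
    [TopologicalSpace N'] [ChartedSpace E' N'] [IsManifold 𝓘(ℝ, E') ∞ N'] {f : N → N'} {x : N}
    (hf : ContMDiffAt 𝓘(ℝ, E) 𝓘(ℝ, E') ∞ f x) {V : ∀ x : N, TangentSpace 𝓘(ℝ, E) x}
    (hV : ContMDiffAt 𝓘(ℝ, E) 𝓘(ℝ, E).tangent ∞
      (fun y => (⟨y, V y⟩ : TangentBundle 𝓘(ℝ, E) N)) x) :
    ContMDiffAt 𝓘(ℝ, E) 𝓘(ℝ, E').tangent ∞
      (fun y => (⟨f y, mfderiv 𝓘(ℝ, E) 𝓘(ℝ, E') f y (V y)⟩ : TangentBundle 𝓘(ℝ, E') N')) x := by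
  have h1 := hf.mfderiv_const (m := ∞) (by simp)
  exact ContMDiffAt.clm_apply_of_inCoordinates (b₁ := id) (b₂ := f)
    (ϕ := fun y => mfderiv 𝓘(ℝ, E) 𝓘(ℝ, E') f y) (v := V) h1 hV hf

theorem contMDiffAt_mfderiv_real {F : M → ℝ} {x : M}
    (hF : ContMDiffAt (𝓡 n) 𝓘(ℝ, ℝ) ∞ F x) {V : ∀ x : M, TangentSpace (𝓡 n) x}
    (hV : ContMDiffAt (𝓡 n) (𝓡 n).tangent ∞
      (fun y => (⟨y, V y⟩ : TangentBundle (𝓡 n) M)) x) :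
    ContMDiffAt (𝓡 n) 𝓘(ℝ, ℝ) ∞ (fun y => (mfderiv (𝓡 n) 𝓘(ℝ, ℝ) F y (V y) : ℝ)) x := by
  have h := (Bundle.contMDiffAt_totalSpace.1 (contMDiffAt_mfderiv_apply hF hV)).2
  simp at h
  exact h

theorem form_eq_sum_smul (B : 𝔼 →L[ℝ] 𝔼 →L[ℝ] ℝ) :
    B = ∑ i, ∑ j, B (EuclideanSpace.single i 1) (EuclideanSpace.single j 1) •
      (EuclideanSpace.proj i : 𝔼 →L[ℝ] ℝ).smulRight (EuclideanSpace.proj j : 𝔼 →L[ℝ] ℝ) := by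
  refine ContinuousLinearMap.ext fun u => ContinuousLinearMap.ext fun w => ?_
  rw [form_eq_sum]
  simp [formMatrix]
  exact Finset.sum_congr rfl fun i _ => Finset.sum_congr rfl fun j _ => mul_comm _ _

theorem contDiffAt_form {B : 𝔼 → 𝔼 →L[ℝ] 𝔼 →L[ℝ] ℝ} {v : 𝔼}
    (h : ∀ u w, ContDiffAt ℝ ∞ (fun z => B z u w) v) : ContDiffAt ℝ ∞ B v := by
  rw [show B = fun z => _ from funext fun z => form_eq_sum_smul (B z)]
  exact ContDiffAt.sum fun i _ => ContDiffAt.sum fun j _ => (h _ _).smul contDiffAt_const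

/-- The graph metric `g + dF²` of a smooth function. -/
noncomputable def graphInner (g : Metric n M) (F : M → ℝ) (x : M) : TangentSpace (𝓡 n) x →L[ℝ]
    TangentSpace (𝓡 n) x →L[ℝ] ℝ :=
  let D : TangentSpace (𝓡 n) x →L[ℝ] ℝ := mfderiv (𝓡 n) 𝓘(ℝ, ℝ) F x
  g.inner x + D.smulRight D

theorem graphInner_apply (g : Metric n M) (F : M → ℝ) (x : M) (u w : TangentSpace (𝓡 n) x) :
    graphInner g F x u w = g.inner x u w + differential F x u * differential F x w := by
  rfl

/-- Smoothness of the graph metric, from that of its components in a trivialization. -/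
theorem contMDiff_graphInner (g : Metric n M) {F : M → ℝ} (hF : ContMDiff (𝓡 n) 𝓘(ℝ, ℝ) ∞ F) :
    ContMDiff (𝓡 n) ((𝓡 n).prod 𝓘(ℝ, 𝔼 →L[ℝ] 𝔼 →L[ℝ] ℝ)) ∞ (fun x =>
      Bundle.TotalSpace.mk' (𝔼 →L[ℝ] 𝔼 →L[ℝ] ℝ) (E := fun x : M => TangentSpace (𝓡 n) x →L[ℝ]
          TangentSpace (𝓡 n) x →L[ℝ] ℝ) x (graphInner g F x)) := by
  intro x₀
  rw [contMDiffAt_hom_bundle]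
  refine ⟨contMDiffAt_id, ?_⟩
  have hs (u : 𝔼) : ContMDiffAt (𝓡 n) (𝓡 n).tangent ∞
      (fun x => (⟨x, (trivializationAt 𝔼 (TangentSpace (𝓡 n)) x₀).symmL ℝ x u⟩ :
        TangentBundle (𝓡 n) M)) x₀ := by
    have h1 := (trivializationAt 𝔼 (TangentSpace (𝓡 n) : M → Type _) x₀).contMDiffAt_symmL
      (IB := 𝓡 n) (n := ∞) (x := x₀) (FiberBundle.mem_baseSet_trivializationAt' x₀)
    have h2 := ContMDiffAt.clm_bundle_apply (F₁ := 𝔼) (E₁ := Bundle.Trivial M 𝔼) (F₂ := 𝔼)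
      (E₂ := (TangentSpace (𝓡 n) : M → Type _)) (v := fun _ => u) (b := fun x => x) h1
      (Bundle.contMDiffAt_totalSpace.2 ⟨contMDiffAt_id, by simpa using contMDiffAt_const⟩)
    exact h2
  set e := trivializationAt 𝔼 (TangentSpace (𝓡 n) : M → Type _) x₀ with he
  have h1 (u w : 𝔼) : ContMDiffAt (𝓡 n) 𝓘(ℝ, ℝ) ∞
      (fun x => graphInner g F x (e.symmL ℝ x u) (e.symmL ℝ x w)) x₀ := by
    simp only [graphInner_apply]
    have k1 := ContMDiffAt.clm_bundle_apply₂ (F₁ := 𝔼) (F₂ := 𝔼)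
      (E₃ := Bundle.Trivial M ℝ) g.contMDiff.contMDiffAt (hs u) (hs w)
    have k2 := (Bundle.contMDiffAt_totalSpace.1 k1).2
    simp at k2
    exact k2.add ((contMDiffAt_mfderiv_real hF.contMDiffAt (hs u)).mul
      (contMDiffAt_mfderiv_real hF.contMDiffAt (hs w)))
  have h2 : ContMDiffAt (𝓡 n) 𝓘(ℝ, 𝔼 →L[ℝ] 𝔼 →L[ℝ] ℝ) ∞ (fun x => ∑ i, ∑ j,
      graphInner g F x (e.symmL ℝ x (EuclideanSpace.single i (1 : ℝ) : 𝔼))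
        (e.symmL ℝ x (EuclideanSpace.single j (1 : ℝ) : 𝔼)) •
      (EuclideanSpace.proj i : 𝔼 →L[ℝ] ℝ).smulRight (EuclideanSpace.proj j : 𝔼 →L[ℝ] ℝ)) x₀ :=
    ContMDiffAt.sum fun i _ => ContMDiffAt.sum fun j _ => (h1 _ _).smul contMDiffAt_const
  refine h2.congr_of_eventuallyEq ?_
  filter_upwards [e.open_baseSet.mem_nhds (FiberBundle.mem_baseSet_trivializationAt' x₀)] with x hx
  refine (form_eq_sum_smul _).trans ?_
  refine Finset.sum_congr rfl fun i _ => Finset.sum_congr rfl fun j _ => ?_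
  congr 1
  have hx' : x ∈ (trivializationAt (𝔼 →L[ℝ] ℝ)
      (fun b : M => TangentSpace (𝓡 n) b →L[ℝ] ℝ) x₀).baseSet := ⟨hx, trivial⟩
  simp only [ContinuousLinearMap.inCoordinates, ContinuousLinearMap.comp_apply,
    Bundle.Trivialization.continuousLinearMapAt_apply,
    Bundle.Trivialization.coe_linearMapAt_of_mem _ hx', hom_trivializationAt_apply]
  simp [he]

/-- The pullback of a Riemannian metric under a map from the model space, as a family of bilinear
forms on the model space. -/
noncomputable def pull (g : Metric n M) (Ψ : 𝔼 → M) (v : 𝔼) : 𝔼 →L[ℝ] 𝔼 →L[ℝ] ℝ :=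
  let D : 𝔼 →L[ℝ] 𝔼 := mfderiv 𝓘(ℝ, 𝔼) (𝓡 n) Ψ v
  let G : 𝔼 →L[ℝ] 𝔼 →L[ℝ] ℝ := g.inner (Ψ v)
  ((ContinuousLinearMap.compL ℝ 𝔼 𝔼 ℝ).flip D) ∘L (G ∘L D)

theorem pull_apply (g : Metric n M) (Ψ : 𝔼 → M) (v u w : 𝔼) :
    pull g Ψ v u w = g.inner (Ψ v) (mfderiv 𝓘(ℝ, 𝔼) (𝓡 n) Ψ v u)
      (mfderiv 𝓘(ℝ, 𝔼) (𝓡 n) Ψ v w) := rfl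

theorem contDiffAt_pull (g : Metric n M) {Ψ : 𝔼 → M} {v : 𝔼}
    (hΨ : ContMDiffAt 𝓘(ℝ, 𝔼) (𝓡 n) ∞ Ψ v) : ContDiffAt ℝ ∞ (pull g Ψ) v := by
  have hconst (u : 𝔼) : ContMDiffAt 𝓘(ℝ, 𝔼) 𝓘(ℝ, 𝔼).tangent ∞
      (fun y => (⟨y, u⟩ : TangentBundle 𝓘(ℝ, 𝔼) 𝔼)) v :=
    contMDiffAt_vectorSpace_iff_contDiffAt.2 contDiffAt_const
  have key (u w : 𝔼) : ContDiffAt ℝ ∞ (fun v => pull g Ψ v u w) v := by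
    have h1 := contMDiffAt_mfderiv_apply hΨ (hconst u)
    have h2 := contMDiffAt_mfderiv_apply hΨ (hconst w)
    have h3 : ContMDiffAt 𝓘(ℝ, 𝔼) ((𝓡 n).prod 𝓘(ℝ, 𝔼 →L[ℝ] 𝔼 →L[ℝ] ℝ)) ∞ (fun y =>
        Bundle.TotalSpace.mk' (𝔼 →L[ℝ] 𝔼 →L[ℝ] ℝ) (E := fun x : M => TangentSpace (𝓡 n) x →L[ℝ]
          TangentSpace (𝓡 n) x →L[ℝ] ℝ) (Ψ y) (g.inner (Ψ y))) v :=
      ContMDiffAt.comp v g.contMDiff.contMDiffAt hΨ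
    have h4 := ContMDiffAt.clm_bundle_apply₂ (F₁ := 𝔼) (F₂ := 𝔼)
      (E₃ := Bundle.Trivial M ℝ) h3 h1 h2
    have h5 := (Bundle.contMDiffAt_totalSpace.1 h4).2
    simp at h5
    exact contMDiffAt_iff_contDiffAt.1 h5
  exact contDiffAt_form key

end GraphMetric

/-! ### Lengths of paths -/

section Length

variable {n : ℕ} {M : Type*} [TopologicalSpace M]
  [ChartedSpace (EuclideanSpace ℝ (Fin n)) M]

local notation "𝔼" => EuclideanSpace ℝ (Fin n)

/-- The derivative of the expression of a path in coordinates. -/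
theorem mfderiv_comp_curve {Ψ : 𝔼 → M} {c : ℝ → 𝔼} {t : ℝ}
    (hΨ : MDifferentiableAt 𝓘(ℝ, 𝔼) (𝓡 n) Ψ (c t)) (hc : DifferentiableAt ℝ c t) :
    mfderiv 𝓘(ℝ, ℝ) (𝓡 n) (fun t => Ψ (c t)) t (1 : ℝ) =
      mfderiv 𝓘(ℝ, 𝔼) (𝓡 n) Ψ (c t) (deriv c t) := by
  have h1 := mfderiv_comp t hΨ hc.mdifferentiableAt
  rw [mfderiv_eq_fderiv] at h1
  have h4 := congrArg (fun L => L (1 : ℝ)) h1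
  exact h4

variable [IsManifold (𝓡 n) ∞ M]

/-- The Riemannian metric `g + dF²`, induced from `g + dt²` on the graph of `F` in `M × ℝ`. -/
noncomputable def graphMetric (g : Metric n M) (F : M → ℝ)
    (hF : ContMDiff (𝓡 n) 𝓘(ℝ, ℝ) ∞ F) : Metric n M where
  inner := graphInner g F
  symm x v w := by rw [graphInner_apply, graphInner_apply, g.symm, mul_comm (differential F x v)]
  pos x v hv := by
    rw [graphInner_apply]
    exact add_pos_of_pos_of_nonneg (g.pos x v hv) (mul_self_nonneg _)
  isVonNBounded x := (g.isVonNBounded x).subset fun v hv => by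
    have h1 : graphInner g F x v v < 1 := hv
    rw [graphInner_apply] at h1
    have h2 := mul_self_nonneg (differential F x v)
    change g.inner x v v < 1
    linarith
  contMDiff := contMDiff_graphInner g hF

theorem graphMetric_inner_apply (g : Metric n M) (F : M → ℝ)
    (hF : ContMDiff (𝓡 n) 𝓘(ℝ, ℝ) ∞ F) (x : M) (u w : TangentSpace (𝓡 n) x) :
    (graphMetric g F hF).inner x u w =
      g.inner x u w + differential F x u * differential F x w :=
  graphInner_apply g F x u w

theorem pathLength_eq (g : Metric n M) (γ : ℝ → M) :
    pathLength g γ = ∫⁻ t in Icc (0 : ℝ) 1, ENNReal.ofReal (√(g.inner (γ t)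
      (mfderiv 𝓘(ℝ, ℝ) (𝓡 n) γ t (1 : ℝ)) (mfderiv 𝓘(ℝ, ℝ) (𝓡 n) γ t (1 : ℝ)))) := by
  let _ : Bundle.RiemannianBundle (fun x : M => TangentSpace (𝓡 n) x) := ⟨g.toRiemannianMetric⟩
  unfold pathLength
  rw [Manifold.pathELength_eq_lintegral_mfderiv_Icc]
  refine MeasureTheory.lintegral_congr fun t => ?_
  rw [← ofReal_norm]
  rfl

theorem dist_le_pathLength (g : Metric n M) {γ : ℝ → M}
    (hγ : ContMDiffOn 𝓘(ℝ, ℝ) (𝓡 n) 1 γ (Icc 0 1)) :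
    dist g (γ 0) (γ 1) ≤ pathLength g γ := by
  let _ : Bundle.RiemannianBundle (fun x : M => TangentSpace (𝓡 n) x) := ⟨g.toRiemannianMetric⟩
  exact Manifold.riemannianEDist_le_pathELength hγ rfl rfl zero_le_one

theorem exists_path_of_dist_lt (g : Metric n M) {x y : M} {r : ℝ≥0∞} (h : dist g x y < r) :
    ∃ γ : ℝ → M, γ 0 = x ∧ γ 1 = y ∧ ContMDiffOn 𝓘(ℝ, ℝ) (𝓡 n) 1 γ (Icc 0 1) ∧
      pathLength g γ < r := by
  let _ : Bundle.RiemannianBundle (fun x : M => TangentSpace (𝓡 n) x) := ⟨g.toRiemannianMetric⟩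
  exact Manifold.exists_lt_of_riemannianEDist_lt h

theorem pathLength_mono {g h : Metric n M} (hgh : ∀ x v, g.inner x v v ≤ h.inner x v v)
    (γ : ℝ → M) : pathLength g γ ≤ pathLength h γ := by
  rw [pathLength_eq, pathLength_eq]
  exact MeasureTheory.lintegral_mono fun t =>
    ENNReal.ofReal_le_ofReal (Real.sqrt_le_sqrt (hgh _ _))

theorem dist_mono {g h : Metric n M} (hgh : ∀ x v, g.inner x v v ≤ h.inner x v v) (x y : M) :
    dist g x y ≤ dist h x y := by
  refine le_of_forall_gt fun r hr => ?_
  obtain ⟨γ, rfl, rfl, hγ, hl⟩ := exists_path_of_dist_lt h hr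
  exact (dist_le_pathLength g hγ).trans_lt ((pathLength_mono hgh γ).trans_lt hl)

theorem isCompleteMetric_of_le {g h : Metric n M} (hgh : ∀ x v, g.inner x v v ≤ h.inner x v v)
    (hg : IsCompleteMetric g) : IsCompleteMetric h := by
  intro u hu
  refine hg u fun ε hε => ?_
  obtain ⟨N, hN⟩ := hu ε hε
  exact ⟨N, fun k hk l hl => (dist_mono hgh _ _).trans_lt (hN k hk l hl)⟩

theorem le_graphMetric (g : Metric n M) (F : M → ℝ) (hF : ContMDiff (𝓡 n) 𝓘(ℝ, ℝ) ∞ F) (x : M)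
    (v : TangentSpace (𝓡 n) x) : g.inner x v v ≤ (graphMetric g F hF).inner x v v := by
  rw [graphMetric_inner_apply]
  have := mul_self_nonneg (differential F x v)
  linarith

/-- A function whose differential has norm at most `1` is `1`-Lipschitz along paths. -/
theorem ofReal_abs_sub_le_pathLength (g : Metric n M) {f : M → ℝ}
    (hf : ContMDiff (𝓡 n) 𝓘(ℝ, ℝ) 1 f)
    (h : ∀ x v, differential f x v ^ 2 ≤ g.inner x v v) {γ : ℝ → M}
    (hγ : ContMDiffOn 𝓘(ℝ, ℝ) (𝓡 n) 1 γ (Icc 0 1)) :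
    ENNReal.ofReal |f (γ 1) - f (γ 0)| ≤ pathLength g γ := by
  have h1 : ContDiffOn ℝ 1 (f ∘ γ) (Icc 0 1) :=
    contMDiffOn_iff_contDiffOn.1 (hf.comp_contMDiffOn hγ)
  have h2 := enorm_sub_le_lintegral_deriv_of_contDiffOn_Icc h1 zero_le_one
  rw [← ofReal_norm, Real.norm_eq_abs] at h2
  refine h2.trans ?_
  rw [pathLength_eq, ← MeasureTheory.restrict_Ioo_eq_restrict_Icc]
  refine MeasureTheory.setLIntegral_mono_ae' measurableSet_Ioo (Eventually.of_forall fun t ht => ?_)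
  rw [← ofReal_norm, Real.norm_eq_abs]
  refine ENNReal.ofReal_le_ofReal ?_
  have hγt : MDifferentiableAt 𝓘(ℝ, ℝ) (𝓡 n) γ t :=
    ((hγ t ⟨ht.1.le, ht.2.le⟩).contMDiffAt (Icc_mem_nhds ht.1 ht.2)).mdifferentiableAt one_ne_zero
  have hft : MDifferentiableAt (𝓡 n) 𝓘(ℝ, ℝ) f (γ t) := hf.mdifferentiableAt one_ne_zero
  have h3 : deriv (f ∘ γ) t = differential f (γ t) (mfderiv 𝓘(ℝ, ℝ) (𝓡 n) γ t (1 : ℝ)) := by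
    have := mfderiv_comp t hft hγt
    rw [mfderiv_eq_fderiv] at this
    have h4 := congrArg (fun L => L (1 : ℝ)) this
    exact h4
  rw [h3]
  exact Real.abs_le_sqrt (h _ _)

theorem pathLength_comp (g : Metric n M) {Ψ : 𝔼 → M} {c : ℝ → 𝔼} (hc : Differentiable ℝ c)
    (hΨ : ∀ t ∈ Icc (0 : ℝ) 1, MDifferentiableAt 𝓘(ℝ, 𝔼) (𝓡 n) Ψ (c t)) :
    pathLength g (fun t => Ψ (c t)) = ∫⁻ t in Icc (0 : ℝ) 1,
      ENNReal.ofReal (√(pull g Ψ (c t) (deriv c t) (deriv c t))) := by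
  rw [pathLength_eq]
  refine MeasureTheory.setLIntegral_congr_fun measurableSet_Icc fun t ht => ?_
  simp only [pull_apply, mfderiv_comp_curve (hΨ t ht) (hc t)]
  rfl

end Length

/-! ### Parametrizations and the invariance of the scalar curvature -/

section Parametrizations

variable {n : ℕ} {M : Type*} [TopologicalSpace M]
  [ChartedSpace (EuclideanSpace ℝ (Fin n)) M]

local notation "𝔼" => EuclideanSpace ℝ (Fin n)

/-- A smooth parametrization of an open subset of `M` by an open subset of the model space. -/
structure IsParam (Ψ : OpenPartialHomeomorph 𝔼 M) : Prop where
  contMDiffOn : ContMDiffOn 𝓘(ℝ, 𝔼) (𝓡 n) ∞ Ψ Ψ.source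
  contMDiffOn_symm : ContMDiffOn (𝓡 n) 𝓘(ℝ, 𝔼) ∞ Ψ.symm Ψ.target

theorem IsParam.contMDiffAt {Ψ : OpenPartialHomeomorph 𝔼 M} (hΨ : IsParam Ψ) {v : 𝔼}
    (hv : v ∈ Ψ.source) : ContMDiffAt 𝓘(ℝ, 𝔼) (𝓡 n) ∞ Ψ v :=
  (hΨ.contMDiffOn v hv).contMDiffAt (Ψ.open_source.mem_nhds hv)

theorem IsParam.contMDiffAt_symm {Ψ : OpenPartialHomeomorph 𝔼 M} (hΨ : IsParam Ψ) {x : M}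
    (hx : x ∈ Ψ.target) : ContMDiffAt (𝓡 n) 𝓘(ℝ, 𝔼) ∞ Ψ.symm x :=
  (hΨ.contMDiffOn_symm x hx).contMDiffAt (Ψ.open_target.mem_nhds hx)

theorem IsParam.mfderiv_injective {Ψ : OpenPartialHomeomorph 𝔼 M} (hΨ : IsParam Ψ) {v : 𝔼}
    (hv : v ∈ Ψ.source) (u : 𝔼) (hu : u ≠ 0) : mfderiv 𝓘(ℝ, 𝔼) (𝓡 n) Ψ v u ≠ 0 := by
  intro h0
  have h1 : MDifferentiableAt 𝓘(ℝ, 𝔼) (𝓡 n) Ψ v := (hΨ.contMDiffAt hv).mdifferentiableAt (by simp)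
  have h2 : MDifferentiableAt (𝓡 n) 𝓘(ℝ, 𝔼) Ψ.symm (Ψ v) :=
    (hΨ.contMDiffAt_symm (Ψ.map_source hv)).mdifferentiableAt (by simp)
  have h3 := mfderiv_comp v h2 h1
  have h4 : (Ψ.symm ∘ Ψ : 𝔼 → 𝔼) =ᶠ[𝓝 v] id := by
    filter_upwards [Ψ.open_source.mem_nhds hv] with z hz using Ψ.left_inv hz
  rw [h4.mfderiv_eq, mfderiv_id] at h3
  have h5 := congrArg (fun L => L u) h3
  have h6 : u = mfderiv (𝓡 n) 𝓘(ℝ, 𝔼) Ψ.symm (Ψ v) (mfderiv 𝓘(ℝ, 𝔼) (𝓡 n) Ψ v u) := h5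
  rw [h0, map_zero] at h6
  exact hu h6

/-- The change of coordinates between two parametrizations. -/
theorem IsParam.contDiffAt_transition {Ψ Ψ' : OpenPartialHomeomorph 𝔼 M} (hΨ : IsParam Ψ)
    (hΨ' : IsParam Ψ') {v : 𝔼} (hv : v ∈ Ψ.source) (hv' : Ψ v ∈ Ψ'.target) :
    ContDiffAt ℝ ∞ (fun z => Ψ'.symm (Ψ z)) v :=
  contMDiffAt_iff_contDiffAt.1 ((hΨ'.contMDiffAt_symm hv').comp v (hΨ.contMDiffAt hv))

variable [IsManifold (𝓡 n) ∞ M]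

theorem pull_symm (g : Metric n M) (Ψ : 𝔼 → M) (v u w : 𝔼) : pull g Ψ v u w = pull g Ψ v w u :=
  g.symm _ _ _

theorem IsParam.pull_pos (g : Metric n M) {Ψ : OpenPartialHomeomorph 𝔼 M} (hΨ : IsParam Ψ) {v : 𝔼}
    (hv : v ∈ Ψ.source) (u : 𝔼) (hu : u ≠ 0) : 0 < pull g Ψ v u u :=
  g.pos _ _ (hΨ.mfderiv_injective hv u hu)

theorem IsParam.contDiffAt_pull (g : Metric n M) {Ψ : OpenPartialHomeomorph 𝔼 M} (hΨ : IsParam Ψ)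
    {v : 𝔼} (hv : v ∈ Ψ.source) : ContDiffAt ℝ ∞ (pull g Ψ) v :=
  Riem.contDiffAt_pull g (hΨ.contMDiffAt hv)

theorem isParam_chartAt_symm (c : M) : IsParam (chartAt 𝔼 c).symm where
  contMDiffOn := contMDiffOn_chart_symm
  contMDiffOn_symm := by
    rw [OpenPartialHomeomorph.symm_symm]
    exact contMDiffOn_chart

theorem pull_comp (g : Metric n M) {Ψ Ψ' : 𝔼 → M} {κ : 𝔼 → 𝔼} {v : 𝔼}
    (hΨ' : MDifferentiableAt 𝓘(ℝ, 𝔼) (𝓡 n) Ψ' (κ v)) (hκ : DifferentiableAt ℝ κ v)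
    (h : Ψ =ᶠ[𝓝 v] fun z => Ψ' (κ z)) : pull g Ψ v = pullbackForm (pull g Ψ') κ v := by
  have h1 := mfderiv_comp v hΨ' hκ.mdifferentiableAt
  rw [mfderiv_eq_fderiv] at h1
  have h2 (u : 𝔼) : mfderiv 𝓘(ℝ, 𝔼) (𝓡 n) Ψ v u =
      mfderiv 𝓘(ℝ, 𝔼) (𝓡 n) Ψ' (κ v) (fderiv ℝ κ v u) := by
    have := h.mfderiv_eq (I := 𝓘(ℝ, 𝔼)) (I' := 𝓡 n)
    rw [this]
    exact congrArg (fun L => L u) h1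
  have h3 : Ψ v = Ψ' (κ v) := h.eq_of_nhds
  refine ContinuousLinearMap.ext fun u => ContinuousLinearMap.ext fun w => ?_
  rw [pullbackForm_apply, pull_apply, pull_apply, h2, h2]
  have (x y : M) (hxy : x = y) (a b : 𝔼) : (g.inner x : 𝔼 →L[ℝ] 𝔼 →L[ℝ] ℝ) a b =
      (g.inner y : 𝔼 →L[ℝ] 𝔼 →L[ℝ] ℝ) a b := by rw [hxy]
  exact this _ _ h3 _ _

theorem IsParam.pull_eq_pullbackForm (g : Metric n M) {Ψ Ψ' : OpenPartialHomeomorph 𝔼 M}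
    (hΨ : IsParam Ψ) (hΨ' : IsParam Ψ') {v : 𝔼} (hv : v ∈ Ψ.source) (hv' : Ψ v ∈ Ψ'.target) :
    pull g Ψ v = pullbackForm (pull g Ψ') (fun z => Ψ'.symm (Ψ z)) v := by
  refine pull_comp g ((hΨ'.contMDiffAt (Ψ'.map_target hv')).mdifferentiableAt (by simp))
    ((hΨ.contDiffAt_transition hΨ' hv hv').differentiableAt (by simp)) ?_
  filter_upwards [(Ψ.continuousAt hv) (Ψ'.open_target.mem_nhds hv')] with z hz
  exact (Ψ'.right_inv hz).symm

theorem IsParam.eventually_pull_eq_pullbackForm (g : Metric n M) {Ψ Ψ' : OpenPartialHomeomorph 𝔼 M}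
    (hΨ : IsParam Ψ) (hΨ' : IsParam Ψ') {v : 𝔼} (hv : v ∈ Ψ.source) (hv' : Ψ v ∈ Ψ'.target) :
    ∀ᶠ z in 𝓝 v, pull g Ψ z = pullbackForm (pull g Ψ') (fun z => Ψ'.symm (Ψ z)) z := by
  filter_upwards [(Ψ.continuousAt hv) (Ψ'.open_target.mem_nhds hv'), Ψ.open_source.mem_nhds hv]
    with z hz hz'
  exact hΨ.pull_eq_pullbackForm g hΨ' hz' hz

/-- The scalar curvature does not depend on the coordinates used to compute it. -/
theorem IsParam.coordScalar_eq (g : Metric n M) {Ψ Ψ' : OpenPartialHomeomorph 𝔼 M}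
    (hΨ : IsParam Ψ) (hΨ' : IsParam Ψ') {v : 𝔼} (hv : v ∈ Ψ.source) (hv' : Ψ v ∈ Ψ'.target) :
    coordScalar (fun z => formMatrix (pull g Ψ z)) v =
      coordScalar (fun z => formMatrix (pull g Ψ' z)) (Ψ'.symm (Ψ v)) := by
  have hle (k : ℕ) : (k : WithTop ℕ∞) ≤ (∞ : WithTop ℕ∞) := by
    exact_mod_cast (le_top : (k : ℕ∞) ≤ ⊤)
  set κ : 𝔼 → 𝔼 := fun z => Ψ'.symm (Ψ z) with hκ
  have hκv : κ v ∈ Ψ'.source := Ψ'.map_target hv'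
  have hpos := hΨ.pull_pos g hv
  obtain ⟨b, hb, -⟩ := exists_orthonormal_frame (V := 𝔼) (ι := Fin n) (by simp)
    (LinearMap.mk₂ ℝ (fun u w => pull g Ψ v u w) (by simp) (by simp) (by simp) (by simp))
    (pull_symm g Ψ v) hpos ∅ (fun _ => 0) (by simp)
  have hb (a c : Fin n) : pull g Ψ v (b a) (b c) = if a = c then 1 else 0 := hb a c
  have heq := hΨ.eventually_pull_eq_pullbackForm g hΨ' hv hv'
  have hb' (a c : Fin n) : pull g Ψ' (κ v) (fderiv ℝ κ v (b a)) (fderiv ℝ κ v (b c)) =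
      if a = c then 1 else 0 := by
    rw [← hb, heq.self_of_nhds, pullbackForm_apply]
  have hinv {Ψ : OpenPartialHomeomorph 𝔼 M} (hΨ : IsParam Ψ) {v : 𝔼} (hv : v ∈ Ψ.source) :
      ∀ᶠ z in 𝓝 v, (pull g Ψ z).IsInvertible := by
    filter_upwards [Ψ.open_source.mem_nhds hv] with z hz
    exact isInvertible_of_pos (hΨ.pull_pos g hz)
  have hκc : ContDiffAt ℝ ∞ κ v := hΨ.contDiffAt_transition hΨ' hv hv'
  have hsurj : Function.Surjective (fderiv ℝ κ v) := by
    have hinj : Function.Injective (fderiv ℝ κ v : 𝔼 →ₗ[ℝ] 𝔼) := by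
      rw [injective_iff_map_eq_zero]
      intro u hu
      by_contra hne
      have h1 := hpos u hne
      rw [heq.self_of_nhds, pullbackForm_apply] at h1
      have h2 : fderiv ℝ κ v u = 0 := hu
      rw [h2] at h1
      simp at h1
    exact LinearMap.injective_iff_surjective.1 hinj
  rw [coordScalar_eq_sum_curv ((hΨ.contDiffAt_pull g hv).of_le (hle 2))
      (Eventually.of_forall fun z => pull_symm g Ψ z) (hinv hΨ hv) hb,
    coordScalar_eq_sum_curv ((hΨ'.contDiffAt_pull g hκv).of_le (hle 2))
      (Eventually.of_forall fun z => pull_symm g Ψ' z) (hinv hΨ' hκv) hb']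
  refine Finset.sum_congr rfl fun a _ => Finset.sum_congr rfl fun c _ => ?_
  exact curv_pullback ((hΨ'.contDiffAt_pull g hκv).of_le (hle 2))
    (Eventually.of_forall fun z => pull_symm g Ψ' z) (hinv hΨ' hκv).self_of_nhds
    (hinv hΨ hv).self_of_nhds ((hΨ.contDiffAt_pull g hv).of_le (hle 2)) (hκc.of_le (hle 3)) hsurj
    (heq.mono fun z hz u w => by rw [hz, pullbackForm_apply]) _ _ _ _

theorem gram_eq (g : Metric n M) (c : M) (y : 𝔼) :
    gram g c y = formMatrix (pull g (chartAt 𝔼 c).symm y) := rfl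

theorem IsParam.scalarCurvature_eq (g : Metric n M) {Ψ : OpenPartialHomeomorph 𝔼 M}
    (hΨ : IsParam Ψ) {v : 𝔼} (hv : v ∈ Ψ.source) :
    scalarCurvature g (Ψ v) = coordScalar (fun z => formMatrix (pull g Ψ z)) v :=
  (hΨ.coordScalar_eq g (isParam_chartAt_symm (Ψ v)) hv (mem_chart_source 𝔼 (Ψ v))).symm

theorem IsNormalForm.congr {R ε : ℝ} {B B' : 𝔼 → 𝔼 →L[ℝ] 𝔼 →L[ℝ] ℝ} (hB : IsNormalForm R ε B)
    (h : ∀ v ∈ Metric.ball (0 : 𝔼) R, B' v = B v) : IsNormalForm R ε B' := by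
  have hev (v) (hv : v ∈ Metric.ball (0 : 𝔼) R) : B' =ᶠ[𝓝 v] B := by
    filter_upwards [Metric.isOpen_ball.mem_nhds hv] with z hz using h z hz
  exact
  { contDiffAt := fun v hv => (hB.contDiffAt v hv).congr_of_eventuallyEq (hev v hv)
    symm := fun v hv u w => by rw [h v hv, hB.symm v hv]
    gauss := fun v hv w => by rw [h v hv, hB.gauss v hv]
    close := fun v hv u w => by rw [h v hv]; exact hB.close v hv u w
    chr_le := fun v hv u w z => by
      rw [chr_congr (hev v hv)]; exact hB.chr_le v hv u w z
    curv_le := fun v hv a u w z => by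
      rw [curv_congr (hev v hv)]; exact hB.curv_le v hv a u w z }

end Parametrizations

/-! ### Normal coordinates on a manifold -/

section NormalCharts

variable {n : ℕ} {M : Type*} [TopologicalSpace M]
  [ChartedSpace (EuclideanSpace ℝ (Fin n)) M] [IsManifold (𝓡 n) ∞ M]

local notation "𝔼" => EuclideanSpace ℝ (Fin n)

/-- Geodesic normal coordinates of `g` at `p` on the ball of radius `R`, given as a parametrization
of a neighbourhood of `p`. The bounds in the normal form are those with the constant `1 / 100`. -/
structure IsNormalChart (g : Metric n M) (R : ℝ) (p : M) (Ψ : OpenPartialHomeomorph 𝔼 M) :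
    Prop where
  isParam : IsParam Ψ
  source_eq : Ψ.source = Metric.ball 0 R
  map_zero : Ψ 0 = p
  isNormalForm : IsNormalForm R (1 / 100) (pull g Ψ)

/-- Near every point, normal coordinates exist on balls of a uniform radius. -/
theorem exists_isNormalChart (g : Metric n M) (p₀ : M) :
    ∃ R > 0, ∀ᶠ p in 𝓝 p₀, ∃ Ψ : OpenPartialHomeomorph 𝔼 M, IsNormalChart g R p Ψ ∧
      Ψ.target ⊆ (chartAt 𝔼 p₀).source := by
  set κ := chartAt 𝔼 p₀ with hκ
  have hpar : IsParam κ.symm := isParam_chartAt_symm p₀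
  have hy₀ : κ p₀ ∈ κ.target := mem_chart_target 𝔼 p₀
  obtain ⟨r, hr, hrt⟩ := Metric.isOpen_iff.1 κ.open_target _ hy₀
  -- Away from `κ p₀` the metric of the chart is replaced by the flat one, so that it is defined on
  -- the whole vector space.
  let χ : ContDiffBump (κ p₀) := ⟨r / 3, r / 2, by positivity, by linarith⟩
  have hχt : Metric.closedBall (κ p₀) (r / 2) ⊆ κ.target :=
    (Metric.closedBall_subset_ball (by linarith)).trans hrt
  let B₀ : 𝔼 →L[ℝ] 𝔼 →L[ℝ] ℝ := innerSL ℝ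
  set B : 𝔼 → 𝔼 →L[ℝ] 𝔼 →L[ℝ] ℝ := fun y => χ y • pull g κ.symm y + (1 - χ y) • B₀ with hBdef
  have hBapp (y u w : 𝔼) : B y u w = χ y * pull g κ.symm y u w + (1 - χ y) * inner ℝ u w := rfl
  have hBsmooth : ContDiff ℝ ∞ B := by
    rw [contDiff_iff_contDiffAt]
    intro y
    refine ContDiffAt.add ?_ (((contDiff_const.sub χ.contDiff).smul contDiff_const).contDiffAt)
    by_cases hy : y ∈ tsupport χ
    · rw [χ.tsupport_eq] at hy
      exact χ.contDiff.contDiffAt.smul (hpar.contDiffAt_pull g (hχt hy))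
    · have h0 : (fun y => χ y • pull g κ.symm y) =ᶠ[𝓝 y] fun _ => (0 : 𝔼 →L[ℝ] 𝔼 →L[ℝ] ℝ) := by
        filter_upwards [notMem_tsupport_iff_eventuallyEq.1 hy] with z hz
        rw [hz]; exact zero_smul ℝ (pull g κ.symm z)
      exact contDiffAt_const.congr_of_eventuallyEq h0
  have hBsymm (y u w : 𝔼) : B y u w = B y w u := by
    rw [hBapp, hBapp, pull_symm, real_inner_comm]
  have hBpos (y u : 𝔼) (hu : u ≠ 0) : 0 < B y u u := by
    rw [hBapp]
    have hin : 0 < inner ℝ u u := real_inner_self_pos.2 hu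
    have h1 := χ.nonneg (x := y)
    have h2 := χ.le_one (x := y)
    rcases h1.eq_or_lt with h | h
    · rw [← h]; simpa using hin
    · have hy : y ∈ κ.target := by
        refine hχt (Metric.ball_subset_closedBall ?_)
        rw [← χ.support_eq]; exact h.ne'
      have := hpar.pull_pos g (v := y) hy u hu
      have h3 : 0 ≤ (1 - χ y) * inner ℝ u u := mul_nonneg (by linarith) hin.le
      have h4 := mul_pos h this
      linarith
  obtain ⟨R, hR, hev⟩ := exists_normalCoordinates hBsmooth hBsymm hBpos (κ p₀)
    (Metric.ball_mem_nhds (κ p₀) (by positivity : 0 < r / 3)) (by norm_num : (0 : ℝ) < 1 / 100)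
  refine ⟨R, hR, ?_⟩
  filter_upwards [(κ.continuousAt (mem_chart_source 𝔼 p₀)).eventually hev,
    κ.open_source.mem_nhds (mem_chart_source 𝔼 p₀)] with p ⟨e, he⟩ hp
  have hUt : Metric.ball (κ p₀) (r / 3) ⊆ κ.target :=
    (Metric.ball_subset_ball (by linarith)).trans hrt
  have hmaps (v) (hv : v ∈ Metric.ball (0 : 𝔼) R) : e v ∈ κ.target := hUt (he.mapsTo v hv)
  have hsrc : (e.trans κ.symm).source = Metric.ball 0 R := by
    rw [OpenPartialHomeomorph.trans_source, he.source_eq]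
    exact inter_eq_left.2 hmaps
  have hpar' : IsParam (e.trans κ.symm) := by
    constructor
    · rw [hsrc]
      intro v hv
      exact ((hpar.contMDiffAt (hmaps v hv)).comp v
        (he.contDiffAt v hv).contMDiffAt).contMDiffWithinAt
    · intro x hx
      rw [OpenPartialHomeomorph.trans_target] at hx
      exact ((he.contDiffAt_symm _ hx.2).contMDiffAt.comp x
        (hpar.contMDiffAt_symm hx.1)).contMDiffWithinAt
  refine ⟨e.trans κ.symm, ⟨hpar', hsrc, ?_, ?_⟩, ?_⟩
  · change κ.symm (e 0) = p
    rw [he.map_zero, κ.left_inv hp]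
  · refine he.isNormalForm.congr fun v hv => ?_
    have hpull := pull_comp g (Ψ := e.trans κ.symm) (Ψ' := κ.symm) (κ := e)
      ((hpar.contMDiffAt (hmaps v hv)).mdifferentiableAt (by simp))
      ((he.contDiffAt v hv).differentiableAt (by simp)) (Eventually.of_forall fun z => rfl)
    rw [hpull]
    refine ContinuousLinearMap.ext fun u => ContinuousLinearMap.ext fun w => ?_
    rw [pullbackForm_apply, pullbackForm_apply, hBapp,
      χ.one_of_mem_closedBall (Metric.ball_subset_closedBall (he.mapsTo v hv))]
    ring
  · rw [OpenPartialHomeomorph.trans_target]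
    intro x hx
    exact hx.1

end NormalCharts

/-! ### Radial functions and the distance from the centre -/

section Radial

variable {n : ℕ} {M : Type*} [TopologicalSpace M]

local notation "𝔼" => EuclideanSpace ℝ (Fin n)

theorem contDiff_radial {η : ℝ → ℝ} (hη : ContDiff ℝ ∞ η) {ρ : ℝ} (hρ : 0 < ρ)
    (h0 : ∀ r ≤ ρ, η r = η 0) : ContDiff ℝ ∞ (fun z : EuclideanSpace ℝ (Fin n) => η ‖z‖) := by
  rw [contDiff_iff_contDiffAt]
  intro v
  by_cases hv : v = 0
  · subst hv
    refine (contDiffAt_const (c := η 0)).congr_of_eventuallyEq ?_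
    filter_upwards [Metric.ball_mem_nhds (0 : 𝔼) hρ] with z hz
    exact h0 _ (mem_ball_zero_iff.1 hz).le
  · exact hη.contDiffAt.comp v (contDiffAt_norm ℝ hv)

open Classical in
/-- The function `η ∘ ‖·‖` on the domain of a parametrization, extended to the whole manifold by
the value of `η` at the radius `R` of this domain. -/
noncomputable def radialExtension (Ψ : OpenPartialHomeomorph (EuclideanSpace ℝ (Fin n)) M) (R : ℝ)
    (η : ℝ → ℝ) (x : M) : ℝ :=
  if x ∈ Ψ.target then η ‖Ψ.symm x‖ else η R

variable {Ψ : OpenPartialHomeomorph (EuclideanSpace ℝ (Fin n)) M} {R R' : ℝ} {η : ℝ → ℝ}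

theorem radialExtension_apply {v : EuclideanSpace ℝ (Fin n)} (hv : v ∈ Ψ.source) :
    radialExtension Ψ R η (Ψ v) = η ‖v‖ := by
  rw [radialExtension, if_pos (Ψ.map_source hv), Ψ.left_inv hv]

theorem radialExtension_eventually_const [T2Space M] (hs : Ψ.source = Metric.ball 0 R)
    (hR : R' < R) (h1 : ∀ r, R' ≤ r → η r = η R) {x : M} (hx : x ∉ Ψ '' Metric.closedBall 0 R') :
    radialExtension Ψ R η =ᶠ[𝓝 x] fun _ => η R := by
  have hsub : Metric.closedBall (0 : 𝔼) R' ⊆ Ψ.source := by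
    rw [hs]; exact Metric.closedBall_subset_ball hR
  have hc : IsClosed (Ψ '' Metric.closedBall 0 R') :=
    ((isCompact_closedBall (0 : 𝔼) R').image_of_continuousOn
      (Ψ.continuousOn.mono hsub)).isClosed
  filter_upwards [hc.isOpen_compl.mem_nhds hx] with y hy
  by_cases hyt : y ∈ Ψ.target
  · rw [radialExtension, if_pos hyt]
    refine h1 _ ?_
    by_contra hlt
    exact hy ⟨Ψ.symm y, mem_closedBall_zero_iff.2 (not_le.1 hlt).le, Ψ.right_inv hyt⟩
  · rw [radialExtension, if_neg hyt]

variable [ChartedSpace (EuclideanSpace ℝ (Fin n)) M]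

theorem contMDiff_radialExtension [T2Space M] (hΨ : IsParam Ψ) (hs : Ψ.source = Metric.ball 0 R)
    (hη : ContDiff ℝ ∞ η) {ρ : ℝ} (hρ : 0 < ρ) (h0 : ∀ r ≤ ρ, η r = η 0)
    (hR : R' < R) (h1 : ∀ r, R' ≤ r → η r = η R) :
    ContMDiff (𝓡 n) 𝓘(ℝ, ℝ) ∞ (radialExtension Ψ R η) := by
  intro x
  by_cases hx : x ∈ Ψ '' Metric.closedBall 0 R'
  · obtain ⟨v, hv, rfl⟩ := hx
    have hv' : v ∈ Ψ.source := by
      rw [hs]; exact Metric.closedBall_subset_ball hR hv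
    have h2 : ContMDiffAt (𝓡 n) 𝓘(ℝ, ℝ) ∞ (fun x => η ‖Ψ.symm x‖) (Ψ v) :=
      ((contDiff_radial hη hρ h0).contDiffAt.contMDiffAt).comp (Ψ v)
        (hΨ.contMDiffAt_symm (Ψ.map_source hv'))
    refine h2.congr_of_eventuallyEq ?_
    filter_upwards [Ψ.open_target.mem_nhds (Ψ.map_source hv')] with y hy
    rw [radialExtension, if_pos hy]
  · exact contMDiffAt_const.congr_of_eventuallyEq (radialExtension_eventually_const hs hR h1 hx)

theorem differential_eq_zero_of_eventually_const {F : M → ℝ} {c : ℝ} {x : M}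
    (h : F =ᶠ[𝓝 x] fun _ => c) (u : TangentSpace (𝓡 n) x) : differential F x u = 0 := by
  rw [differential, h.mfderiv_eq, mfderiv_const]
  rfl

theorem differential_radialExtension (hΨ : IsParam Ψ) {v : EuclideanSpace ℝ (Fin n)}
    (hF : MDifferentiableAt (𝓡 n) 𝓘(ℝ, ℝ) (radialExtension Ψ R η) (Ψ v)) (hv : v ∈ Ψ.source)
    (w : EuclideanSpace ℝ (Fin n)) :
    differential (radialExtension Ψ R η) (Ψ v) (mfderiv 𝓘(ℝ, 𝔼) (𝓡 n) Ψ v w) =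
      fderiv ℝ (fun z : 𝔼 => η ‖z‖) v w := by
  have h1 := mfderiv_comp v hF ((hΨ.contMDiffAt hv).mdifferentiableAt (by simp))
  have h2 : radialExtension Ψ R η ∘ Ψ =ᶠ[𝓝 v] fun z => η ‖z‖ := by
    filter_upwards [Ψ.open_source.mem_nhds hv] with z hz using radialExtension_apply hz
  rw [h2.mfderiv_eq, mfderiv_eq_fderiv] at h1
  exact (congrArg (fun L => L w) h1).symm

theorem IsParam.mfderiv_surjective (hΨ : IsParam Ψ) {v : EuclideanSpace ℝ (Fin n)}
    (hv : v ∈ Ψ.source) (u : EuclideanSpace ℝ (Fin n)) :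
    ∃ w : 𝔼, mfderiv 𝓘(ℝ, 𝔼) (𝓡 n) Ψ v w = u := by
  let D : 𝔼 →L[ℝ] 𝔼 := mfderiv 𝓘(ℝ, 𝔼) (𝓡 n) Ψ v
  let L : 𝔼 →ₗ[ℝ] 𝔼 := D
  have hinj : Function.Injective L := by
    rw [injective_iff_map_eq_zero]
    intro u hu
    by_contra hne
    exact hΨ.mfderiv_injective hv u hne hu
  exact LinearMap.injective_iff_surjective.1 hinj u

variable [IsManifold (𝓡 n) ∞ M] {g : Metric n M} {p : M}

/-- In normal coordinates the distance from the centre has gradient of length `1`. -/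
theorem IsNormalChart.sq_inner_le (hΨ : IsNormalChart g R p Ψ) {v : EuclideanSpace ℝ (Fin n)}
    (hv : v ∈ Metric.ball 0 R) (w : EuclideanSpace ℝ (Fin n)) :
    (inner ℝ v w : ℝ) ^ 2 ≤ ‖v‖ ^ 2 * pull g Ψ v w w := by
  by_cases hv0 : v = 0
  · subst hv0; simp
  have hs : v ∈ Ψ.source := by rw [hΨ.source_eq]; exact hv
  have hn : 0 < ‖v‖ ^ 2 := by positivity
  set t : ℝ := inner ℝ v w / ‖v‖ ^ 2 with ht
  have h1 : 0 ≤ pull g Ψ v (w - t • v) (w - t • v) := by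
    by_cases h0 : w - t • v = 0
    · rw [h0]; simp
    · exact (hΨ.isParam.pull_pos g hs _ h0).le
  have e : inner ℝ v v = ‖v‖ ^ 2 := real_inner_self_eq_norm_sq v
  have h2 : pull g Ψ v (w - t • v) (w - t • v) =
      pull g Ψ v w w - 2 * t * inner ℝ v w + t ^ 2 * ‖v‖ ^ 2 := by
    have g1 := hΨ.isNormalForm.gauss v hv w
    have g2 := hΨ.isNormalForm.gauss v hv v
    have g3 := pull_symm g Ψ v w v
    simp only [map_sub, map_smul, sub_apply, smul_apply, smul_eq_mul, g3, g1, g2, e]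
    ring
  rw [h2] at h1
  have h3 : t * ‖v‖ ^ 2 = inner ℝ v w := by rw [ht]; field_simp
  nlinarith

theorem IsNormalChart.sq_differential_radialExtension_le [T2Space M]
    (hΨ : IsNormalChart g R p Ψ) (hη : ContDiff ℝ ∞ η) {ρ : ℝ} (hρ : 0 < ρ)
    (h0 : ∀ r ≤ ρ, η r = η 0) (hR : R' < R) (h1 : ∀ r, R' ≤ r → η r = η R)
    (hd : ∀ r, |deriv η r| ≤ 1) (x : M) (u : TangentSpace (𝓡 n) x) :
    differential (radialExtension Ψ R η) x u ^ 2 ≤ g.inner x u u := by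
  have hnn : 0 ≤ g.inner x u u := by
    by_cases hu : u = 0
    · subst hu; simp
    · exact (g.pos x u hu).le
  by_cases hx : x ∈ Ψ '' Metric.closedBall 0 R'
  · obtain ⟨v, hv, rfl⟩ := hx
    have hvR : v ∈ Metric.ball (0 : 𝔼) R := Metric.closedBall_subset_ball hR hv
    have hv' : v ∈ Ψ.source := by rw [hΨ.source_eq]; exact hvR
    obtain ⟨w, rfl⟩ := hΨ.isParam.mfderiv_surjective hv' u
    have hF := contMDiff_radialExtension hΨ.isParam hΨ.source_eq hη hρ h0 hR h1
    rw [differential_radialExtension hΨ.isParam (hF.mdifferentiableAt (by simp)) hv']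
    change _ ≤ pull g Ψ v w w
    by_cases hv0 : v = 0
    · subst hv0
      have : (fun z : 𝔼 => η ‖z‖) =ᶠ[𝓝 0] fun _ => η 0 := by
        filter_upwards [Metric.ball_mem_nhds (0 : 𝔼) hρ] with z hz
        exact h0 _ (mem_ball_zero_iff.1 hz).le
      have hp : 0 ≤ pull g Ψ 0 w w := hnn
      rw [this.fderiv_eq]
      simpa using hp
    · rw [fderiv_radial hv0 (hη.differentiable (by simp)).differentiableAt]
      have h2 := hΨ.sq_inner_le hvR w
      have h3 : deriv η ‖v‖ ^ 2 ≤ 1 := (sq_le_one_iff_abs_le_one _).2 (hd _)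
      have hp : 0 ≤ pull g Ψ v w w := hnn
      have hn : 0 < ‖v‖ ^ 2 := by positivity
      have h4 : (deriv η ‖v‖ / ‖v‖ * inner ℝ v w) ^ 2 =
          deriv η ‖v‖ ^ 2 * ((inner ℝ v w : ℝ) ^ 2 / ‖v‖ ^ 2) := by ring
      rw [h4]
      have h5 : (inner ℝ v w : ℝ) ^ 2 / ‖v‖ ^ 2 ≤ pull g Ψ v w w := by
        rw [div_le_iff₀ hn]; linarith
      calc _ ≤ 1 * ((inner ℝ v w : ℝ) ^ 2 / ‖v‖ ^ 2) := by gcongr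
        _ ≤ _ := by linarith
  · rw [differential_eq_zero_of_eventually_const
      (radialExtension_eventually_const hΨ.source_eq hR h1 hx)]
    simpa using hnn

/-- A smooth nondecreasing `1`-Lipschitz function that is constant near `0` and beyond `s`, and
grows almost by `s`. -/
theorem exists_cutoff_distance {s ε : ℝ} (hε : 0 < ε) (hs : 2 * ε < s) :
    ∃ η : ℝ → ℝ, ContDiff ℝ ∞ η ∧ (∀ r ≤ ε / 2, η r = η 0) ∧ (∀ r, s - ε / 2 ≤ r → η r = η s) ∧
      (∀ r, |deriv η r| ≤ 1) ∧ s - 2 * ε ≤ η s - η 0 := by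
  let χ : ContDiffBump (s / 2 : ℝ) := ⟨s / 2 - ε, s / 2 - ε / 2, by linarith, by linarith⟩
  set η : ℝ → ℝ := fun r => ∫ t in (0 : ℝ)..r, χ t with hη
  have hc : Continuous χ := χ.continuous
  have hd (r : ℝ) : HasDerivAt η (χ r) r := (hc.integral_hasStrictDerivAt 0 r).hasDerivAt
  have hdη : deriv η = χ := funext fun r => (hd r).deriv
  have hsub (a b : ℝ) : η b - η a = ∫ t in a..b, χ t :=
    intervalIntegral.integral_interval_sub_left (hc.intervalIntegrable _ _)
      (hc.intervalIntegrable _ _)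
  have hmono : Monotone η := monotone_of_deriv_nonneg (fun r => (hd r).differentiableAt)
    fun r => by rw [hdη]; exact χ.nonneg
  have hz (t : ℝ) (ht : t ≤ ε / 2 ∨ s - ε / 2 ≤ t) : χ t = 0 := by
    refine χ.zero_of_le_dist ?_
    change s / 2 - ε / 2 ≤ _
    rw [Real.dist_eq]
    rcases ht with ht | ht
    · exact le_trans (by linarith) (neg_le_abs _)
    · exact le_trans (by linarith) (le_abs_self _)
  refine ⟨η, ?_, fun r hr => ?_, fun r hr => ?_, fun r => ?_, ?_⟩
  · rw [contDiff_infty_iff_deriv]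
    exact ⟨fun r => (hd r).differentiableAt, by rw [hdη]; exact χ.contDiff⟩
  · rw [← sub_eq_zero, hsub, intervalIntegral.integral_congr (g := fun _ => (0 : ℝ)),
      intervalIntegral.integral_zero]
    intro t ht
    exact hz t (Or.inl ((mem_uIcc.1 ht).elim (fun h => h.2.trans hr) fun h => by linarith [h.2]))
  · rw [← sub_eq_zero, hsub, intervalIntegral.integral_congr (g := fun _ => (0 : ℝ)),
      intervalIntegral.integral_zero]
    intro t ht
    exact hz t (Or.inr ((mem_uIcc.1 ht).elim (fun h => by linarith [h.1]) fun h => hr.trans h.1))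
  · rw [hdη, abs_of_nonneg χ.nonneg]
    exact χ.le_one
  · have h1 : η (s - ε) - η ε = s - 2 * ε := by
      rw [hsub, intervalIntegral.integral_congr (g := fun _ => (1 : ℝ))]
      · simp; ring
      · intro t ht
        rw [uIcc_of_le (by linarith)] at ht
        refine χ.one_of_mem_closedBall ?_
        rw [Metric.mem_closedBall, Real.dist_eq, abs_le]
        change -(s / 2 - ε) ≤ _ ∧ _ ≤ s / 2 - ε
        constructor <;> linarith [ht.1, ht.2]
    have h2 := hmono (by linarith : s - ε ≤ s)
    have h3 := hmono (by linarith : 0 ≤ ε)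
    linarith

/-- Points outside a coordinate ball are at least as far from the centre as its radius. -/
theorem IsNormalChart.le_dist [T2Space M] (hΨ : IsNormalChart g R p Ψ) {s : ℝ} (hs : s < R) {x : M}
    (hx : x ∉ Ψ '' Metric.ball 0 s) : ENNReal.ofReal s ≤ dist g p x := by
  rcases le_or_gt s 0 with hs0 | hs0
  · simp [ENNReal.ofReal_of_nonpos hs0]
  have h0s : (0 : 𝔼) ∈ Ψ.source := by rw [hΨ.source_eq]; exact Metric.mem_ball_self (hs0.trans hs)
  refine le_of_forall_gt fun r hr => ?_
  obtain ⟨γ, hγ0, hγ1, hγ, hl⟩ := exists_path_of_dist_lt g hr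
  refine lt_of_le_of_lt ?_ hl
  have key (ε : ℝ) (hε : 0 < ε) (hεs : 2 * ε < s) :
      ENNReal.ofReal (s - 2 * ε) ≤ pathLength g γ := by
    obtain ⟨η, hη, h0, h1, hd, hgr⟩ := exists_cutoff_distance hε hεs
    have h1' : ∀ r, s - ε / 2 ≤ r → η r = η R := fun r hr => by
      rw [h1 r hr, h1 R (by linarith)]
    have hF := contMDiff_radialExtension hΨ.isParam hΨ.source_eq hη (half_pos hε) h0
      (by linarith : s - ε / 2 < R) h1'
    have h2 := ofReal_abs_sub_le_pathLength g (hF.of_le (by simp))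
      (hΨ.sq_differential_radialExtension_le hη (half_pos hε) h0
        (by linarith : s - ε / 2 < R) h1' hd) hγ
    refine (ENNReal.ofReal_le_ofReal ?_).trans h2
    rw [hγ0, hγ1]
    have e0 : radialExtension Ψ R η p = η 0 := by
      rw [← hΨ.map_zero, radialExtension_apply h0s, norm_zero]
    have e1 : radialExtension Ψ R η x = η s := by
      by_cases hxt : x ∈ Ψ.target
      · rw [radialExtension, if_pos hxt]
        refine h1 _ ?_
        by_contra hlt
        exact hx ⟨Ψ.symm x, mem_ball_zero_iff.2 (by linarith), Ψ.right_inv hxt⟩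
      · rw [radialExtension, if_neg hxt, h1 R (by linarith)]
    rw [e0, e1]
    exact hgr.trans (le_abs_self _)
  have ht : Tendsto (fun ε : ℝ => ENNReal.ofReal (s - 2 * ε)) (𝓝[>] 0)
      (𝓝 (ENNReal.ofReal (s - 2 * 0))) := by
    refine (ENNReal.continuous_ofReal.comp (by fun_prop)).continuousAt.mono_left nhdsWithin_le_nhds
  rw [mul_zero, sub_zero] at ht
  refine le_of_tendsto ht ?_
  filter_upwards [Ioo_mem_nhdsGT (by linarith : (0 : ℝ) < s / 2)] with ε hε
  exact key ε hε.1 (by linarith [hε.2])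

end Radial

/-! ### Paths along radii and geodesic balls -/

section RadialPaths

variable {n : ℕ} {M : Type*} [TopologicalSpace M]
  [ChartedSpace (EuclideanSpace ℝ (Fin n)) M] [IsManifold (𝓡 n) ∞ M]

local notation "𝔼" => EuclideanSpace ℝ (Fin n)

variable {Ψ : OpenPartialHomeomorph (EuclideanSpace ℝ (Fin n)) M} {R : ℝ} {g h : Metric n M} {p : M}
  {φ : ℝ → ℝ}

/-- The metric `h` is given by `g + dF²`, with `F = φ ∘ ‖·‖`, in the coordinates `Ψ`. -/
def IsRadialGraph (g h : Metric n M) (Ψ : OpenPartialHomeomorph (EuclideanSpace ℝ (Fin n)) M)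
    (φ : ℝ → ℝ) : Prop :=
  ∀ v ∈ Ψ.source, ∀ u w : EuclideanSpace ℝ (Fin n), pull h Ψ v u w = pull g Ψ v u w +
    fderiv ℝ (fun z : EuclideanSpace ℝ (Fin n) => φ ‖z‖) v u *
      fderiv ℝ (fun z : EuclideanSpace ℝ (Fin n) => φ ‖z‖) v w

theorem isRadialGraph_self (g : Metric n M) :
    IsRadialGraph g g Ψ (fun _ => 0) := fun v _ u w => by simp

/-- The speed of a radial curve. -/
theorem IsNormalChart.sqrt_pull_le (hΨ : IsNormalChart g R p Ψ) (hh : IsRadialGraph g h Ψ φ)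
    (hφ : Differentiable ℝ φ) {a : EuclideanSpace ℝ (Fin n)} {s : ℝ} (hs : 0 < s)
    (hv : s • a ∈ Metric.ball 0 R) (l : ℝ) :
    √(pull h Ψ (s • a) (l • a) (l • a)) ≤ |l| * ‖a‖ * (1 + |deriv φ (s * ‖a‖)|) := by
  by_cases ha : a = 0
  · subst ha; simp
  have hv' : s • a ∈ Ψ.source := by rw [hΨ.source_eq]; exact hv
  have hsa : s • a ≠ 0 := smul_ne_zero hs.ne' ha
  have hna : 0 < ‖a‖ := norm_pos_iff.2 ha
  have e : inner ℝ a a = ‖a‖ ^ 2 := real_inner_self_eq_norm_sq a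
  have h1 : pull g Ψ (s • a) (l • a) (l • a) = l ^ 2 * ‖a‖ ^ 2 := by
    have := hΨ.isNormalForm.gauss _ hv a
    rw [map_smul, smul_apply, smul_eq_mul, inner_smul_left, e] at this
    have h2 : pull g Ψ (s • a) a a = ‖a‖ ^ 2 := mul_left_cancel₀ hs.ne' this
    simp only [map_smul, smul_apply, smul_eq_mul, h2]
    ring
  have h3 : fderiv ℝ (fun z : 𝔼 => φ ‖z‖) (s • a) (l • a) = l * ‖a‖ * deriv φ (s * ‖a‖) := by
    rw [fderiv_radial hsa hφ.differentiableAt, norm_smul, Real.norm_of_nonneg hs.le,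
      inner_smul_left, inner_smul_right, e]
    simp only [conj_trivial]
    field_simp
  rw [hh _ hv', h1, h3]
  refine (Real.sqrt_le_sqrt (y := (|l| * ‖a‖ * (1 + |deriv φ (s * ‖a‖)|)) ^ 2) ?_).trans
    (Real.sqrt_sq (by positivity)).le
  set q := deriv φ (s * ‖a‖)
  have h4 : |q| ^ 2 = q ^ 2 := sq_abs q
  have h5 : |l| ^ 2 = l ^ 2 := sq_abs l
  have h6 : (|l| * ‖a‖ * (1 + |q|)) ^ 2 = l ^ 2 * ‖a‖ ^ 2 * (1 + 2 * |q| + q ^ 2) := by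
    rw [← h4, ← h5]; ring
  rw [h6]
  have h7 : 0 ≤ l ^ 2 * ‖a‖ ^ 2 * (2 * |q|) := by positivity
  nlinarith

theorem abs_smoothTransition_le (t : ℝ) : |Real.smoothTransition t| ≤ 1 := by
  rw [abs_of_nonneg (Real.smoothTransition.nonneg t)]
  exact Real.smoothTransition.le_one t

/-- Two points of a coordinate ball are joined by a path through the centre that runs along two
radii, smoothed where it turns. -/
theorem IsNormalChart.exists_path (hΨ : IsNormalChart g R p Ψ) (hh : IsRadialGraph g h Ψ φ)
    (hφ : ContDiff ℝ ∞ φ) (hanti : Antitone φ) {r : ℝ} (hr : r ≤ R)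
    {a b : EuclideanSpace ℝ (Fin n)} (ha : a ∈ Metric.ball 0 r) (hb : b ∈ Metric.ball 0 r) :
    ∃ γ : ℝ → M, ContMDiffOn 𝓘(ℝ, ℝ) (𝓡 n) 1 γ (Icc 0 1) ∧
      MapsTo γ (Icc 0 1) (Ψ '' Metric.ball 0 r) ∧ γ 0 = Ψ a ∧ γ 1 = Ψ b ∧
      pathLength h γ ≤ ENNReal.ofReal (‖a‖ + ‖b‖ + (φ 0 - φ ‖a‖) + (φ 0 - φ ‖b‖)) := by
  have hTs : ContDiff ℝ 1 Real.smoothTransition := Real.smoothTransition.contDiff (n := 1)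
  set S₁ : ℝ → ℝ := fun t => Real.smoothTransition (1 - 2 * t) with hS₁
  set S₂ : ℝ → ℝ := fun t => Real.smoothTransition (2 * t - 1) with hS₂
  have hS₁c : ContDiff ℝ 1 S₁ := hTs.comp (by fun_prop)
  have hS₂c : ContDiff ℝ 1 S₂ := hTs.comp (by fun_prop)
  have hS₁a : Antitone S₁ := fun x y hxy => Real.smoothTransition.monotone (by linarith)
  have hS₂m : Monotone S₂ := fun x y hxy => Real.smoothTransition.monotone (by linarith)
  have hS₁z (t : ℝ) (ht : 1 / 2 ≤ t) : S₁ t = 0 :=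
    Real.smoothTransition.zero_of_nonpos (by linarith)
  have hS₂z (t : ℝ) (ht : t ≤ 1 / 2) : S₂ t = 0 :=
    Real.smoothTransition.zero_of_nonpos (by linarith)
  have hS₁p (t : ℝ) (ht : t < 1 / 2) : 0 < S₁ t :=
    Real.smoothTransition.pos_of_pos (by linarith)
  have hS₂p (t : ℝ) (ht : 1 / 2 < t) : 0 < S₂ t :=
    Real.smoothTransition.pos_of_pos (by linarith)
  set c : ℝ → 𝔼 := fun t => S₁ t • a + S₂ t • b with hc
  have hcc : ContDiff ℝ 1 c := (hS₁c.smul contDiff_const).add (hS₂c.smul contDiff_const)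
  have hball (t : ℝ) : c t ∈ Metric.ball (0 : 𝔼) r := by
    rw [mem_ball_zero_iff] at *
    rcases le_total t (1 / 2) with ht | ht
    · simp only [hc, hS₂z t ht, zero_smul, add_zero, norm_smul, Real.norm_eq_abs]
      exact (mul_le_of_le_one_left (norm_nonneg a) (abs_smoothTransition_le _)).trans_lt ha
    · simp only [hc, hS₁z t ht, zero_smul, zero_add, norm_smul, Real.norm_eq_abs]
      exact (mul_le_of_le_one_left (norm_nonneg b) (abs_smoothTransition_le _)).trans_lt hb
  have hballR (t : ℝ) : c t ∈ Metric.ball (0 : 𝔼) R := Metric.ball_subset_ball hr (hball t)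
  have hsrc (t : ℝ) : c t ∈ Ψ.source := by rw [hΨ.source_eq]; exact hballR t
  have hS₁0 : S₁ 0 = 1 := by simp [hS₁]
  have hS₂1 : S₂ 1 = 1 := Real.smoothTransition.one_of_one_le (by norm_num)
  have h1 : c 0 = a := by simp [hc, hS₁0, hS₂z 0 (by norm_num)]
  have h2 : c 1 = b := by simp [hc, hS₂1, hS₁z 1 (by norm_num)]
  -- The derivative of `m` dominates the speed.
  set m : ℝ → ℝ := fun t => -(S₁ t * ‖a‖) + S₂ t * ‖b‖ + φ (S₁ t * ‖a‖) - φ (S₂ t * ‖b‖) with hm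
  have hφ1 : ContDiff ℝ 1 φ := hφ.of_le (by simp)
  have hmc : ContDiff ℝ 1 m :=
    (((hS₁c.mul contDiff_const).neg.add (hS₂c.mul contDiff_const)).add
      (hφ1.comp (hS₁c.mul contDiff_const))).sub (hφ1.comp (hS₂c.mul contDiff_const))
  have hmm : Monotone m := by
    intro x y hxy
    have k1 := mul_le_mul_of_nonneg_right (hS₁a hxy) (norm_nonneg a)
    have k2 := mul_le_mul_of_nonneg_right (hS₂m hxy) (norm_nonneg b)
    have k3 := hanti k1
    have k4 := hanti k2
    simp only [hm]
    linarith
  have hφd := hφ.differentiable (by simp)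
  have hspeed (t : ℝ) (ht : t ≠ 1 / 2) :
      √(pull h Ψ (c t) (deriv c t) (deriv c t)) ≤ deriv m t := by
    rcases lt_or_gt_of_ne ht with ht | ht
    · have e1 : c =ᶠ[𝓝 t] fun t => S₁ t • a := by
        filter_upwards [Iio_mem_nhds ht] with z hz
        simp [hc, hS₂z z (le_of_lt hz)]
      have e2 : m =ᶠ[𝓝 t] fun t => -(S₁ t * ‖a‖) + φ (S₁ t * ‖a‖) - φ 0 := by
        filter_upwards [Iio_mem_nhds ht] with z hz
        simp [hm, hS₂z z (le_of_lt hz)]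
      have d1 : HasDerivAt S₁ (deriv S₁ t) t := (hS₁c.differentiable one_ne_zero t).hasDerivAt
      have d2 : deriv c t = deriv S₁ t • a := by
        rw [e1.deriv_eq]; exact (d1.smul_const a).deriv
      have d3 : deriv m t = -(deriv S₁ t * ‖a‖) + deriv φ (S₁ t * ‖a‖) * (deriv S₁ t * ‖a‖) := by
        rw [e2.deriv_eq]
        exact (((d1.mul_const ‖a‖).neg.add
          ((hφd (S₁ t * ‖a‖)).hasDerivAt.comp t (d1.mul_const ‖a‖))).sub_const (φ 0)).deriv
      have hv : S₁ t • a ∈ Metric.ball (0 : 𝔼) R := by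
        rw [← e1.eq_of_nhds]; exact hballR t
      have k := hΨ.sqrt_pull_le hh hφd (hS₁p t ht) hv (deriv S₁ t)
      rw [d2, d3, e1.eq_of_nhds]
      refine k.trans_eq ?_
      rw [abs_of_nonpos hS₁a.deriv_nonpos, abs_of_nonpos hanti.deriv_nonpos]
      ring
    · have e1 : c =ᶠ[𝓝 t] fun t => S₂ t • b := by
        filter_upwards [Ioi_mem_nhds ht] with z hz
        simp [hc, hS₁z z (le_of_lt hz)]
      have e2 : m =ᶠ[𝓝 t] fun t => φ 0 + S₂ t * ‖b‖ - φ (S₂ t * ‖b‖) := by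
        filter_upwards [Ioi_mem_nhds ht] with z hz
        simp only [hm, hS₁z z (le_of_lt hz), zero_mul]
        ring
      have d1 : HasDerivAt S₂ (deriv S₂ t) t := (hS₂c.differentiable one_ne_zero t).hasDerivAt
      have d2 : deriv c t = deriv S₂ t • b := by
        rw [e1.deriv_eq]; exact (d1.smul_const b).deriv
      have d3 : deriv m t = deriv S₂ t * ‖b‖ - deriv φ (S₂ t * ‖b‖) * (deriv S₂ t * ‖b‖) := by
        rw [e2.deriv_eq]
        exact (((d1.mul_const ‖b‖).const_add (φ 0)).sub
          ((hφd (S₂ t * ‖b‖)).hasDerivAt.comp t (d1.mul_const ‖b‖))).deriv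
      have hv : S₂ t • b ∈ Metric.ball (0 : 𝔼) R := by
        rw [← e1.eq_of_nhds]; exact hballR t
      have k := hΨ.sqrt_pull_le hh hφd (hS₂p t ht) hv (deriv S₂ t)
      rw [d2, d3, e1.eq_of_nhds]
      refine k.trans_eq ?_
      rw [abs_of_nonneg hS₂m.deriv_nonneg, abs_of_nonpos hanti.deriv_nonpos]
      ring
  refine ⟨fun t => Ψ (c t), fun t _ => ?_, fun t _ => ⟨c t, hball t, rfl⟩, ?_, ?_, ?_⟩
  · exact (((hΨ.isParam.contMDiffAt (hsrc t)).of_le (by simp)).comp t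
      hcc.contDiffAt.contMDiffAt).contMDiffWithinAt
  · simp only [h1]
  · simp only [h2]
  · rw [pathLength_comp h (hcc.differentiable one_ne_zero)
      fun t _ => (hΨ.isParam.contMDiffAt (hsrc t)).mdifferentiableAt (by simp)]
    have hae : ∀ᵐ t ∂(MeasureTheory.volume.restrict (Icc (0 : ℝ) 1)), t ≠ 1 / 2 :=
      MeasureTheory.ae_restrict_of_ae (MeasureTheory.Measure.ae_ne _ _)
    have hdc : Continuous (deriv m) := hmc.continuous_deriv le_rfl
    calc _ ≤ ∫⁻ t in Icc (0 : ℝ) 1, ENNReal.ofReal (deriv m t) :=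
          MeasureTheory.lintegral_mono_ae (hae.mono fun t ht => ENNReal.ofReal_le_ofReal (hspeed t ht))
      _ = ENNReal.ofReal (∫ t in Icc (0 : ℝ) 1, deriv m t) :=
          (MeasureTheory.ofReal_integral_eq_lintegral_ofReal
            (hdc.continuousOn.integrableOn_Icc) (Eventually.of_forall fun t => hmm.deriv_nonneg)).symm
      _ = _ := by
          rw [MeasureTheory.integral_Icc_eq_integral_Ioc,
            ← intervalIntegral.integral_of_le zero_le_one,
            intervalIntegral.integral_deriv_eq_sub (fun t _ => hmc.differentiable one_ne_zero t)
              (hdc.intervalIntegrable _ _)]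
          congr 1
          simp only [hm, hS₁0, hS₂1, hS₂z 0 (by norm_num), hS₁z 1 (by norm_num)]
          simp only [one_mul, zero_mul]
          ring

theorem IsNormalChart.dist_le (hΨ : IsNormalChart g R p Ψ) {v : EuclideanSpace ℝ (Fin n)}
    (hv : v ∈ Metric.ball 0 R) : dist g p (Ψ v) ≤ ENNReal.ofReal ‖v‖ := by
  have hR : 0 < R := (norm_nonneg v).trans_lt (mem_ball_zero_iff.1 hv)
  obtain ⟨γ, hγ, -, h0, h1, hl⟩ := hΨ.exists_path (isRadialGraph_self g) contDiff_const
    antitone_const le_rfl (Metric.mem_ball_self hR) hv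
  rw [hΨ.map_zero] at h0
  have := dist_le_pathLength g hγ
  rw [h0, h1] at this
  simpa using this.trans hl

theorem IsNormalChart.dist_eq [T2Space M] (hΨ : IsNormalChart g R p Ψ)
    {v : EuclideanSpace ℝ (Fin n)} (hv : v ∈ Metric.ball 0 R) :
    dist g p (Ψ v) = ENNReal.ofReal ‖v‖ := by
  refine le_antisymm (hΨ.dist_le hv) (hΨ.le_dist (mem_ball_zero_iff.1 hv) ?_)
  rintro ⟨w, hw, hwv⟩
  have hvs : v ∈ Ψ.source := by rw [hΨ.source_eq]; exact hv
  have hws : w ∈ Ψ.source := by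
    rw [hΨ.source_eq]; exact Metric.ball_subset_ball (mem_ball_zero_iff.1 hv).le hw
  have := Ψ.injOn hws hvs hwv
  subst this
  exact lt_irrefl _ (mem_ball_zero_iff.1 hw)

theorem IsNormalChart.ball_eq [T2Space M] (hΨ : IsNormalChart g R p Ψ) {r : ℝ} (hr : r < R) :
    ball g p r = Ψ '' Metric.ball 0 r := by
  ext x
  constructor
  · intro hx
    by_contra hn
    exact absurd hx (not_lt.2 (hΨ.le_dist hr hn))
  · rintro ⟨v, hv, rfl⟩
    have h0 := mem_ball_zero_iff.1 hv
    exact (hΨ.dist_le (Metric.ball_subset_ball hr.le hv)).trans_lt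
      ((ENNReal.ofReal_lt_ofReal_iff ((norm_nonneg v).trans_lt h0)).2 h0)

end RadialPaths

/-! ### Scalar curvature and diameter of a well -/

section Well

variable {n : ℕ} {M : Type*} [TopologicalSpace M]
  [ChartedSpace (EuclideanSpace ℝ (Fin n)) M] [IsManifold (𝓡 n) ∞ M]

local notation "𝔼" => EuclideanSpace ℝ (Fin n)

variable {Ψ : OpenPartialHomeomorph (EuclideanSpace ℝ (Fin n)) M} {R : ℝ} {g h : Metric n M} {p : M}
  {φ : ℝ → ℝ}

theorem graphMetric_inner_of_eventually_const (g : Metric n M) {F : M → ℝ}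
    (hF : ContMDiff (𝓡 n) 𝓘(ℝ, ℝ) ∞ F) {c : ℝ} {x : M} (h : F =ᶠ[𝓝 x] fun _ => c) :
    (graphMetric g F hF).inner x = g.inner x := by
  refine ContinuousLinearMap.ext fun u => ContinuousLinearMap.ext fun w => ?_
  rw [graphMetric_inner_apply, differential_eq_zero_of_eventually_const h]
  ring

theorem scalarCurvature_congr {g h : Metric n M} {x : M}
    (hgh : ∀ᶠ y in 𝓝 x, h.inner y = g.inner y) : scalarCurvature h x = scalarCurvature g x := by
  refine coordScalar_congr ?_
  have hc : ContinuousAt (extChartAt (𝓡 n) x).symm (extChartAt (𝓡 n) x x) :=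
    continuousAt_extChartAt_symm x
  have h1 : Tendsto (extChartAt (𝓡 n) x).symm (𝓝 (extChartAt (𝓡 n) x x)) (𝓝 x) := by
    have := hc.tendsto
    rwa [extChartAt_to_inv] at this
  filter_upwards [h1.eventually hgh] with y hy
  ext i j
  simp only [gram, Matrix.of_apply, hy]

theorem scalarCurvature_graphMetric_of_eventually_const (g : Metric n M) {F : M → ℝ}
    (hF : ContMDiff (𝓡 n) 𝓘(ℝ, ℝ) ∞ F) {c : ℝ} {x : M} (h : F =ᶠ[𝓝 x] fun _ => c) :
    scalarCurvature (graphMetric g F hF) x = scalarCurvature g x :=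
  scalarCurvature_congr (h.eventually_nhds.mono fun _ hy =>
    graphMetric_inner_of_eventually_const g hF hy)

theorem isRadialGraph_graphMetric (hΨ : IsParam Ψ)
    (hF : ContMDiff (𝓡 n) 𝓘(ℝ, ℝ) ∞ (radialExtension Ψ R φ)) :
    IsRadialGraph g (graphMetric g (radialExtension Ψ R φ) hF) Ψ φ := by
  intro v hv u w
  rw [pull_apply, graphMetric_inner_apply,
    differential_radialExtension hΨ (hF.mdifferentiableAt (by simp)) hv,
    differential_radialExtension hΨ (hF.mdifferentiableAt (by simp)) hv]
  rfl

/-- A profile for which `2 φ' φ'' / (1 + φ'²)²` is bounded below as here loses only a small amount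
of scalar curvature: the term with `φ'²` pays for all but `σ r` of the one with `φ''`. -/
theorem IsNormalChart.lt_scalarCurvature (hn : 3 ≤ n) (hΨ : IsNormalChart g R p Ψ)
    (hh : IsRadialGraph g h Ψ φ) (hφ : ContDiff ℝ ∞ φ) {σ : ℝ} (hσ : 0 < σ)
    (hprof : ∀ r, 0 < r → -(6 / 7 * (deriv φ r ^ 2 / (1 + deriv φ r ^ 2)) / r) - σ * r ≤
      2 * deriv φ r * deriv (deriv φ) r / (1 + deriv φ r ^ 2) ^ 2)
    {v : EuclideanSpace ℝ (Fin n)} (hv : v ∈ Metric.ball 0 R) (hv0 : v ≠ 0) :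
    scalarCurvature g (Ψ v) - 2 * n * σ < scalarCurvature h (Ψ v) := by
  have hs : v ∈ Ψ.source := by rw [hΨ.source_eq]; exact hv
  have hle (k : ℕ) : (k : WithTop ℕ∞) ≤ (∞ : WithTop ℕ∞) := by
    exact_mod_cast (le_top : (k : ℕ∞) ≤ ⊤)
  obtain ⟨H, Q, hH, hQ, heq⟩ := hΨ.isNormalForm.coordScalar_graph hn (B' := pull h Ψ) (φ := φ)
    hv hv0 ((hΨ.isParam.contDiffAt_pull h hs).of_le (hle 2)) (hφ.contDiffAt.of_le (hle 3))
    (by filter_upwards [Ψ.open_source.mem_nhds hs] with z hz u w using hh z hz u w)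
  have e1 := hΨ.isParam.scalarCurvature_eq h hs
  have e2 := hΨ.isParam.scalarCurvature_eq g hs
  have heq' : scalarCurvature h (Ψ v) = scalarCurvature g (Ψ v) +
      Q * (deriv φ ‖v‖ ^ 2 / (1 + deriv φ ‖v‖ ^ 2)) +
      H * (2 * deriv φ ‖v‖ * deriv (deriv φ) ‖v‖ / (1 + deriv φ ‖v‖ ^ 2) ^ 2) := by
    rw [e1, e2]; exact heq
  rw [heq']
  have hr : 0 < ‖v‖ := norm_pos_iff.2 hv0
  have hpr := hprof ‖v‖ hr
  set r := ‖v‖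
  set w := deriv φ r ^ 2 / (1 + deriv φ r ^ 2)
  set w' := 2 * deriv φ r * deriv (deriv φ) r / (1 + deriv φ r ^ 2) ^ 2
  have hw : 0 ≤ w := by positivity
  have hn' : (3 : ℝ) ≤ n := by exact_mod_cast hn
  obtain ⟨hH1, hH2⟩ := abs_le.1 hH
  have hHr : 0 ≤ H := by
    by_contra hneg
    have : r * H < 0 := mul_neg_of_pos_of_neg hr (not_le.1 hneg)
    linarith
  have k1 : H * (-(6 / 7 * w / r) - σ * r) ≤ H * w' := mul_le_mul_of_nonneg_left hpr hHr
  -- `6 / 7` is the quotient of the bounds `9 / 10` for `r² Q` and `21 / 20` for `r H`.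
  have k2 : H * (6 / 7 * w / r) ≤ Q * w := by
    have k3 : H * (6 / 7 * w / r) = (r * H) * (6 / 7 * (w / r ^ 2)) := by field_simp
    have k4 : Q * w = (r ^ 2 * Q) * (w / r ^ 2) := by field_simp
    have k5 : 0 ≤ w / r ^ 2 := by positivity
    rw [k3, k4]
    nlinarith
  have k6 : H * (σ * r) < 2 * n * σ := by
    have k7 : H * (σ * r) = (r * H) * σ := by ring
    rw [k7]
    refine mul_lt_mul_of_pos_right ?_ hσ
    linarith
  nlinarith

theorem distIn_le {U : Set M} {γ : ℝ → M} (hγ : ContMDiffOn 𝓘(ℝ, ℝ) (𝓡 n) 1 γ (Icc 0 1))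
    (hU : MapsTo γ (Icc 0 1) U) : distIn g U (γ 0) (γ 1) ≤ pathLength g γ :=
  iInf_le_of_le γ (iInf_le_of_le hγ (iInf_le_of_le hU (iInf_le_of_le rfl (iInf_le_of_le rfl le_rfl))))

theorem distIn_le_diam {U : Set M} {x y : M} (hx : x ∈ U) (hy : y ∈ U) :
    distIn g U x y ≤ diam g U := by
  unfold diam
  exact le_iSup_of_le x (le_iSup_of_le hx (le_iSup_of_le y (le_iSup_of_le hy le_rfl)))

/-- The height function of a graph is `1`-Lipschitz on the graph. -/
theorem ofReal_abs_sub_le_distIn {F : M → ℝ} (hF : ContMDiff (𝓡 n) 𝓘(ℝ, ℝ) ∞ F) (U : Set M)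
    (x y : M) : ENNReal.ofReal |F y - F x| ≤ distIn (graphMetric g F hF) U x y := by
  refine le_iInf fun γ => le_iInf fun hγ => le_iInf fun _ => le_iInf fun hx => le_iInf fun hy => ?_
  subst hx hy
  refine ofReal_abs_sub_le_pathLength _ (hF.of_le (by simp)) (fun x v => ?_) hγ
  rw [graphMetric_inner_apply, ← sq]
  have : 0 ≤ g.inner x v v := by
    by_cases hv : v = 0
    · subst hv; simp
    · exact (g.pos x v hv).le
  linarith

theorem IsNormalChart.diam_le (hΨ : IsNormalChart g R p Ψ) (hh : IsRadialGraph g h Ψ φ)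
    (hφ : ContDiff ℝ ∞ φ) (hanti : Antitone φ) (hnn : ∀ r, 0 ≤ φ r) {r : ℝ} (hr : r ≤ R) :
    diam h (Ψ '' Metric.ball 0 r) ≤ ENNReal.ofReal (2 * r + 2 * φ 0) := by
  refine iSup_le fun x => iSup_le fun hx => iSup_le fun y => iSup_le fun hy => ?_
  obtain ⟨a, ha, rfl⟩ := hx
  obtain ⟨b, hb, rfl⟩ := hy
  obtain ⟨γ, hγ, hm, h0, h1, hl⟩ := hΨ.exists_path hh hφ hanti hr ha hb
  rw [← h0, ← h1]
  refine (distIn_le hγ hm).trans (hl.trans (ENNReal.ofReal_le_ofReal ?_))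
  have := mem_ball_zero_iff.1 ha
  have := mem_ball_zero_iff.1 hb
  linarith [hnn ‖a‖, hnn ‖b‖]

end Well

/-! ### Determinants -/

section Determinants

variable {n : ℕ}

local notation "𝔼" => EuclideanSpace ℝ (Fin n)

theorem det_formMatrix_pullbackForm (B : EuclideanSpace ℝ (Fin n) → EuclideanSpace ℝ (Fin n) →L[ℝ]
    EuclideanSpace ℝ (Fin n) →L[ℝ] ℝ) (τ : EuclideanSpace ℝ (Fin n) → EuclideanSpace ℝ (Fin n))
    (v : EuclideanSpace ℝ (Fin n)) :
    (formMatrix (pullbackForm B τ v)).det =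
      (fderiv ℝ τ v).det ^ 2 * (formMatrix (B (τ v))).det := by
  set b := (EuclideanSpace.basisFun (Fin n) ℝ).toBasis
  set D := LinearMap.toMatrix b b (fderiv ℝ τ v : 𝔼 →ₗ[ℝ] 𝔼) with hD
  have hDapp (i j : Fin n) : D i j = fderiv ℝ τ v (EuclideanSpace.single j 1) i := by
    rw [hD, LinearMap.toMatrix_apply]
    simp [b]
  have h1 : formMatrix (pullbackForm B τ v) = D.transpose * formMatrix (B (τ v)) * D := by
    ext i j
    rw [formMatrix, Matrix.of_apply, pullbackForm_apply, form_eq_sum, Finset.sum_comm]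
    simp only [Matrix.mul_apply, Matrix.transpose_apply, hDapp, Finset.sum_mul]
    exact Finset.sum_congr rfl fun k _ => Finset.sum_congr rfl fun l _ => by ring
  have h2 : D.det = (fderiv ℝ τ v).det := LinearMap.det_toMatrix b _
  rw [h1, Matrix.det_mul, Matrix.det_mul, Matrix.det_transpose, h2]
  ring

/-- A rank one perturbation multiplies the determinant by `1 + q` at most, if `q` bounds the
squared norm of the linear form that is added. -/
theorem abs_det_formMatrix_add_le {B B' : EuclideanSpace ℝ (Fin n) →L[ℝ]
    EuclideanSpace ℝ (Fin n) →L[ℝ] ℝ} {l : EuclideanSpace ℝ (Fin n) →L[ℝ] ℝ} {q : ℝ}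
    (hq0 : 0 ≤ q) (hB : ∀ w, w ≠ 0 → 0 < B w w) (hl : ∀ w, l w ^ 2 ≤ q * B w w)
    (hB' : ∀ u w, B' u w = B u w + l u * l w) :
    |(formMatrix B').det| ≤ |(formMatrix B).det| * (1 + q) := by
  set A := formMatrix B with hA
  set a : Fin n → ℝ := fun i => l (EuclideanSpace.single i 1) with ha
  have hdet : IsUnit A.det := isUnit_det_formMatrix (isInvertible_of_pos hB)
  have h1 : formMatrix B' = A + Matrix.replicateCol Unit a * Matrix.replicateRow Unit a := by
    ext i j
    simp [formMatrix, hB', hA, ha, Matrix.mul_apply]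
  set x : Fin n → ℝ := A⁻¹.mulVec a with hx
  set X : 𝔼 := WithLp.toLp 2 x with hX
  have hAx : A.mulVec x = a := by
    rw [hx, Matrix.mulVec_mulVec, Matrix.mul_nonsing_inv _ hdet, Matrix.one_mulVec]
  have hlX : l X = a ⬝ᵥ x := by
    have : X = ∑ i, x i • (EuclideanSpace.single i (1 : ℝ) : 𝔼) := by
      have := (EuclideanSpace.basisFun (Fin n) ℝ).sum_repr X
      simp only [EuclideanSpace.basisFun_apply, EuclideanSpace.basisFun_repr] at this
      exact this.symm
    rw [this, map_sum]
    simp [dotProduct, ha, mul_comm]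
  have hBX : B X X = a ⬝ᵥ x := by
    rw [form_eq_sum, ← hAx]
    simp only [dotProduct, Matrix.mulVec, Finset.sum_mul, hX, ← hA]
    exact Finset.sum_congr rfl fun i _ => Finset.sum_congr rfl fun j _ => by ring
  have h2 : (1 + Matrix.replicateRow Unit a * A⁻¹ * Matrix.replicateCol Unit a).det =
      1 + a ⬝ᵥ x := by
    rw [Matrix.det_unique, Matrix.add_apply, Matrix.one_apply_eq, Matrix.mul_assoc]
    congr 1
  have h0 : 0 ≤ a ⬝ᵥ x := by
    rw [← hBX]
    by_cases h : X = 0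
    · rw [h]; simp
    · exact (hB X h).le
  have hle : a ⬝ᵥ x ≤ q := by
    have h3 := hl X
    rw [hlX, hBX] at h3
    rcases h0.eq_or_lt with h | h
    · rw [← h]; exact hq0
    · by_contra hq
      nlinarith
  rw [h1, Matrix.det_add_replicateCol_mul_replicateRow hdet, h2, abs_mul,
    abs_of_nonneg (by linarith : 0 ≤ 1 + a ⬝ᵥ x)]
  gcongr

end Determinants

/-! ### The volume of a well -/

section Volume

variable {n : ℕ}

/-- The integral of the slope of a profile that descends from height `d` to `0` before radius
`δ`. -/
theorem lintegral_ball_deriv_le (hn : 1 ≤ n) {φ : ℝ → ℝ} (hφ : ContDiff ℝ ∞ φ) (hanti : Antitone φ)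
    {δ : ℝ} (hδ : 0 < δ) (h1 : ∀ r, δ ≤ r → φ r = 0) :
    ∫⁻ v : EuclideanSpace ℝ (Fin n), ENNReal.ofReal |deriv φ ‖v‖| ≤
      ENNReal.ofReal (n * MeasureTheory.volume.real (Metric.ball (0 : EuclideanSpace ℝ (Fin n)) 1) *
        (δ ^ (n - 1) * φ 0)) := by
  have : Nonempty (Fin n) := ⟨⟨0, hn⟩⟩
  have hd : Continuous (deriv φ) := hφ.continuous_deriv (by simp)
  have hz (r : ℝ) (hr : δ < r) : deriv φ r = 0 := by
    have : φ =ᶠ[𝓝 r] fun _ => 0 := by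
      filter_upwards [Ioi_mem_nhds hr] with z hz using h1 z (le_of_lt hz)
    rw [this.deriv_eq]; simp
  have hcont : Continuous fun v : EuclideanSpace ℝ (Fin n) => |deriv φ ‖v‖| :=
    (hd.comp continuous_norm).abs
  have hsupp : HasCompactSupport fun v : EuclideanSpace ℝ (Fin n) => |deriv φ ‖v‖| := by
    refine HasCompactSupport.of_support_subset_isCompact (isCompact_closedBall 0 δ) fun v hv => ?_
    by_contra hvb
    rw [mem_closedBall_zero_iff, not_le] at hvb
    exact hv (by simp [hz _ hvb])
  have hint := hcont.integrable_of_hasCompactSupport (μ := MeasureTheory.volume) hsupp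
  rw [← MeasureTheory.ofReal_integral_eq_lintegral_ofReal hint
    (Eventually.of_forall fun v => abs_nonneg _)]
  refine ENNReal.ofReal_le_ofReal ?_
  rw [MeasureTheory.integral_fun_norm_addHaar MeasureTheory.volume (fun r => |deriv φ r|)]
  simp only [finrank_euclideanSpace, Fintype.card_fin, nsmul_eq_mul, smul_eq_mul]
  rw [mul_assoc]
  refine mul_le_mul_of_nonneg_left (mul_le_mul_of_nonneg_left ?_ MeasureTheory.measureReal_nonneg)
    (Nat.cast_nonneg _)
  have h2 : ∫ y in Ioi (0 : ℝ), y ^ (n - 1) * |deriv φ y| =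
      ∫ y in Ioc (0 : ℝ) δ, y ^ (n - 1) * |deriv φ y| := by
    refine MeasureTheory.setIntegral_eq_of_subset_of_forall_sdiff_eq_zero measurableSet_Ioi
      (fun y hy => hy.1) fun y hy => ?_
    rw [hz y (not_le.1 fun h => hy.2 ⟨hy.1, h⟩)]; simp
  have hIc : Continuous fun y : ℝ => y ^ (n - 1) * |deriv φ y| := (continuous_pow _).mul hd.abs
  have hIc' : Continuous fun y : ℝ => δ ^ (n - 1) * -deriv φ y := continuous_const.mul hd.neg
  rw [h2, ← intervalIntegral.integral_of_le hδ.le]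
  calc ∫ y in (0 : ℝ)..δ, y ^ (n - 1) * |deriv φ y|
      ≤ ∫ y in (0 : ℝ)..δ, δ ^ (n - 1) * -deriv φ y := by
        refine intervalIntegral.integral_mono_on hδ.le (hIc.intervalIntegrable _ _)
          (hIc'.intervalIntegrable _ _) fun y hy => ?_
        rw [abs_of_nonpos hanti.deriv_nonpos]
        exact mul_le_mul_of_nonneg_right (pow_le_pow_left₀ hy.1 hy.2 _)
          (neg_nonneg.2 hanti.deriv_nonpos)
    _ = δ ^ (n - 1) * φ 0 := by
        rw [intervalIntegral.integral_const_mul, intervalIntegral.integral_neg,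
          intervalIntegral.integral_deriv_eq_sub
            (fun x _ => hφ.differentiable (by simp) x) (hd.intervalIntegrable _ _), h1 δ le_rfl]
        ring

variable {M : Type*} [TopologicalSpace M]
  [ChartedSpace (EuclideanSpace ℝ (Fin n)) M] [IsManifold (𝓡 n) ∞ M]

local notation "𝔼" => EuclideanSpace ℝ (Fin n)

variable {Ψ : OpenPartialHomeomorph (EuclideanSpace ℝ (Fin n)) M} {R : ℝ} {g h : Metric n M} {p : M}
  {φ : ℝ → ℝ}

/-- The volume computed in a parametrization. -/
theorem IsParam.vol_image_le (hΨ : IsParam Ψ) (h : Metric n M) {c : M}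
    (hc : Ψ.target ⊆ (chartAt (EuclideanSpace ℝ (Fin n)) c).source)
    {U : Set (EuclideanSpace ℝ (Fin n))} (hU : IsOpen U) (hUs : U ⊆ Ψ.source) :
    vol h (Ψ '' U) ≤ ∫⁻ v in U, ENNReal.ofReal (√(formMatrix (pull h Ψ v)).det) := by
  set κ := chartAt 𝔼 c with hκ
  have hpar : IsParam κ.symm := isParam_chartAt_symm c
  set τ : 𝔼 → 𝔼 := fun v => κ (Ψ v) with hτ
  have himage : extChartAt (𝓡 n) c '' (Ψ '' U) = τ '' U := by
    rw [image_image]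
    rfl
  have hsub : Ψ '' U ⊆ κ.source := by
    rintro _ ⟨v, hv, rfl⟩
    exact hc (Ψ.map_source (hUs hv))
  have hopen : IsOpen (τ '' U) := by
    have h1 : IsOpen (Ψ '' U) := Ψ.isOpen_image_of_subset_source hU hUs
    have h2 := κ.isOpen_image_of_subset_source h1 hsub
    rwa [image_image] at h2
  have hsrc (v) (hv : v ∈ U) : v ∈ Ψ.source ∧ Ψ v ∈ κ.symm.target :=
    ⟨hUs hv, hsub ⟨v, hv, rfl⟩⟩
  have hτd (v) (hv : v ∈ U) : HasFDerivWithinAt τ (fderiv ℝ τ v) U v :=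
    ((hΨ.contDiffAt_transition hpar (hsrc v hv).1 (hsrc v hv).2).differentiableAt
      (by simp)).hasFDerivAt.hasFDerivWithinAt
  have hinj : InjOn τ U := by
    intro v hv w hw hvw
    exact Ψ.injOn (hUs hv) (hUs hw) (κ.injOn (hsub ⟨v, hv, rfl⟩) (hsub ⟨w, hw, rfl⟩) hvw)
  have hchart : chartVol h c (Ψ '' U) =
      ∫⁻ v in U, ENNReal.ofReal (√(formMatrix (pull h Ψ v)).det) := by
    rw [chartVol, himage, MeasureTheory.lintegral_image_eq_lintegral_abs_det_fderiv_mul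
      MeasureTheory.volume hU.measurableSet hτd hinj]
    refine MeasureTheory.setLIntegral_congr_fun hU.measurableSet fun v hv => ?_
    have e1 : pull h Ψ v = pullbackForm (pull h κ.symm) τ v :=
      hΨ.pull_eq_pullbackForm h hpar (hsrc v hv).1 (hsrc v hv).2
    simp only [gram_eq]
    rw [← ENNReal.ofReal_mul (abs_nonneg _), e1, det_formMatrix_pullbackForm,
      Real.sqrt_mul (sq_nonneg _), Real.sqrt_sq_eq_abs]
  let A : ℕ → Set M := fun k => if k = 0 then Ψ '' U else ∅
  have hA (k : ℕ) (hk : k ≠ 0) : A k = ∅ := if_neg hk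
  have hA0 : A 0 = Ψ '' U := if_pos rfl
  unfold vol
  refine iInf_le_of_le (fun _ => c) (iInf_le_of_le A (iInf_le_of_le (fun k => ?_)
    (iInf_le_of_le (fun k => ?_) (iInf_le_of_le ?_ ?_))))
  · rcases eq_or_ne k 0 with rfl | hk
    · rw [hA0]; exact hsub
    · rw [hA k hk]; exact empty_subset _
  · rcases eq_or_ne k 0 with rfl | hk
    · rw [hA0, himage]; exact hopen.measurableSet
    · rw [hA k hk, image_empty]; exact MeasurableSet.empty
  · rw [← hA0]; exact subset_iUnion A 0
  · rw [tsum_eq_single 0 fun k hk => by simp [chartVol, hA k hk], hA0, hchart]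

theorem IsNormalChart.sqrt_det_le (hΨ : IsNormalChart g R p Ψ) (hh : IsRadialGraph g h Ψ φ)
    (hφ : ContDiff ℝ ∞ φ) {v : EuclideanSpace ℝ (Fin n)} (hv : v ∈ Metric.ball 0 R) (hv0 : v ≠ 0) :
    √(formMatrix (pull h Ψ v)).det ≤ √(n.factorial * 2 ^ n) * (1 + |deriv φ ‖v‖|) := by
  have hs : v ∈ Ψ.source := by rw [hΨ.source_eq]; exact hv
  have hnv : 0 < ‖v‖ ^ 2 := by positivity
  have h1 := abs_det_formMatrix_add_le (sq_nonneg (deriv φ ‖v‖)) (hΨ.isParam.pull_pos g hs)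
    (l := fderiv ℝ (fun z : 𝔼 => φ ‖z‖) v) (fun w => ?_) (hh v hs)
  · have h2 : |(formMatrix (pull g Ψ v)).det| ≤ n.factorial * 2 ^ n := by
      have := Matrix.det_le (A := formMatrix (pull g Ψ v)) (abv := AbsoluteValue.abs) (x := (2 : ℝ))
        fun i j => ?_
      · simpa using this
      · have h3 := hΨ.isNormalForm.close v hv (EuclideanSpace.single i 1)
          (EuclideanSpace.single j 1)
        have h4 : |(inner ℝ (EuclideanSpace.single i (1 : ℝ) : 𝔼) (EuclideanSpace.single j 1) : ℝ)|
            ≤ 1 := by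
          refine (abs_real_inner_le_norm _ _).trans ?_
          simp
        simp only [PiLp.norm_single, norm_one, mul_one] at h3
        change |pull g Ψ v (EuclideanSpace.single i 1) (EuclideanSpace.single j 1)| ≤ 2
        rw [abs_le] at h3 h4 ⊢
        constructor <;> linarith [h3.1, h3.2, h4.1, h4.2]
    have h5 : (formMatrix (pull h Ψ v)).det ≤
        (√(n.factorial * 2 ^ n) * (1 + |deriv φ ‖v‖|)) ^ 2 := by
      rw [mul_pow, Real.sq_sqrt (by positivity)]
      refine (le_abs_self _).trans (h1.trans ?_)
      have h6 : 1 + deriv φ ‖v‖ ^ 2 ≤ (1 + |deriv φ ‖v‖|) ^ 2 := by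
        rw [← sq_abs (deriv φ ‖v‖)]
        nlinarith [abs_nonneg (deriv φ ‖v‖)]
      gcongr
    exact (Real.sqrt_le_sqrt h5).trans (Real.sqrt_sq (by positivity)).le
  · rw [fderiv_radial hv0 (hφ.differentiable (by simp)).differentiableAt]
    have h2 := hΨ.sq_inner_le hv w
    have h3 : (deriv φ ‖v‖ / ‖v‖ * inner ℝ v w) ^ 2 =
        deriv φ ‖v‖ ^ 2 * ((inner ℝ v w : ℝ) ^ 2 / ‖v‖ ^ 2) := by ring
    rw [h3]
    refine mul_le_mul_of_nonneg_left ?_ (sq_nonneg _)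
    rw [div_le_iff₀ hnv]
    linarith

theorem IsNormalChart.vol_le (hn : 1 ≤ n) (hΨ : IsNormalChart g R p Ψ)
    (hh : IsRadialGraph g h Ψ φ) {c : M}
    (hc : Ψ.target ⊆ (chartAt (EuclideanSpace ℝ (Fin n)) c).source)
    (hφ : ContDiff ℝ ∞ φ) (hanti : Antitone φ)
    {δ r : ℝ} (hδ : 0 < δ) (h1 : ∀ r, δ ≤ r → φ r = 0)
    (hr : 0 < r) (hrR : r ≤ R) :
    vol h (Ψ '' Metric.ball 0 r) ≤ ENNReal.ofReal (√(n.factorial * 2 ^ n) *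
      (MeasureTheory.volume.real (Metric.ball (0 : EuclideanSpace ℝ (Fin n)) 1) *
        (r ^ n + n * (δ ^ (n - 1) * φ 0)))) := by
  have : Nonempty (Fin n) := ⟨⟨0, hn⟩⟩
  set W := MeasureTheory.volume.real (Metric.ball (0 : 𝔼) 1) with hW
  set K := √(n.factorial * 2 ^ n) with hK
  have hW0 : 0 ≤ W := MeasureTheory.measureReal_nonneg
  have hφ0 : 0 ≤ φ 0 := (h1 δ le_rfl).symm.le.trans (hanti hδ.le)
  refine (hΨ.isParam.vol_image_le h hc Metric.isOpen_ball (by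
    rw [hΨ.source_eq]; exact Metric.ball_subset_ball hrR)).trans ?_
  have hd : Continuous (deriv φ) := hφ.continuous_deriv (by simp)
  have hae : ∀ᵐ v ∂(MeasureTheory.volume.restrict (Metric.ball (0 : 𝔼) r)),
      ENNReal.ofReal (√(formMatrix (pull h Ψ v)).det) ≤
        ENNReal.ofReal K * (1 + ENNReal.ofReal |deriv φ ‖v‖|) := by
    have hne : ∀ᵐ v ∂(MeasureTheory.volume.restrict (Metric.ball (0 : 𝔼) r)), v ≠ 0 :=
      MeasureTheory.ae_restrict_of_ae (MeasureTheory.Measure.ae_ne _ _)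
    filter_upwards [hne, MeasureTheory.ae_restrict_mem Metric.isOpen_ball.measurableSet]
      with v hv0 hv
    rw [← ENNReal.ofReal_one, ← ENNReal.ofReal_add zero_le_one (abs_nonneg _),
      ← ENNReal.ofReal_mul (Real.sqrt_nonneg _)]
    exact ENNReal.ofReal_le_ofReal
      (hΨ.sqrt_det_le hh hφ (Metric.ball_subset_ball hrR hv) hv0)
  refine (MeasureTheory.lintegral_mono_ae hae).trans ?_
  rw [MeasureTheory.lintegral_const_mul _ (by fun_prop),
    MeasureTheory.lintegral_add_left measurable_const, ENNReal.ofReal_mul (Real.sqrt_nonneg _)]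
  gcongr
  rw [mul_add, ENNReal.ofReal_add (by positivity) (by positivity)]
  gcongr
  · rw [MeasureTheory.setLIntegral_const, one_mul, MeasureTheory.Measure.addHaar_ball _ _ hr.le,
      finrank_euclideanSpace, Fintype.card_fin, mul_comm, ENNReal.ofReal_mul hW0, hW,
      MeasureTheory.measureReal_def, ENNReal.ofReal_toReal MeasureTheory.measure_ball_lt_top.ne]
  · refine (MeasureTheory.setLIntegral_le_lintegral _ _).trans
      ((lintegral_ball_deriv_le hn hφ hanti hδ h1).trans_eq ?_)
    rw [← hW]
    congr 1
    ring

end Volume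

/-! ### Existence of wells -/

section Existence

variable {n : ℕ} {M : Type*} [TopologicalSpace M]
  [ChartedSpace (EuclideanSpace ℝ (Fin n)) M] [IsManifold (𝓡 n) ∞ M]

local notation "𝔼" => EuclideanSpace ℝ (Fin n)

variable {Ψ : OpenPartialHomeomorph (EuclideanSpace ℝ (Fin n)) M} {R : ℝ} {g : Metric n M} {p : M}

/-- The radius of normal coordinates is bounded below on a compact set. -/
theorem exists_isNormalChart_of_isCompact (g : Metric n M) {K : Set M} (hK : IsCompact K) :
    ∃ r > 0, ∀ p ∈ K, ∃ (R : ℝ) (c : M) (Ψ : OpenPartialHomeomorph 𝔼 M), r ≤ R ∧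
      IsNormalChart g R p Ψ ∧ Ψ.target ⊆ (chartAt 𝔼 c).source := by
  refine hK.induction_on (p := fun s => ∃ r > 0, ∀ p ∈ s, ∃ (R : ℝ) (c : M)
    (Ψ : OpenPartialHomeomorph 𝔼 M), r ≤ R ∧ IsNormalChart g R p Ψ ∧
      Ψ.target ⊆ (chartAt 𝔼 c).source) ⟨1, one_pos, by simp⟩ ?_ ?_ fun x hx => ?_
  · rintro s t hst ⟨r, hr, h⟩
    exact ⟨r, hr, fun p hp => h p (hst hp)⟩
  · rintro s t ⟨r₁, hr₁, h₁⟩ ⟨r₂, hr₂, h₂⟩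
    refine ⟨min r₁ r₂, lt_min hr₁ hr₂, fun p hp => ?_⟩
    rcases hp with hp | hp
    · obtain ⟨R, c, Ψ, hR, h⟩ := h₁ p hp
      exact ⟨R, c, Ψ, (min_le_left _ _).trans hR, h⟩
    · obtain ⟨R, c, Ψ, hR, h⟩ := h₂ p hp
      exact ⟨R, c, Ψ, (min_le_right _ _).trans hR, h⟩
  · obtain ⟨R, hR, hev⟩ := exists_isNormalChart g x
    exact ⟨_, mem_nhdsWithin_of_mem_nhds hev, R, hR, fun p ⟨Ψ, hΨ, ht⟩ =>
      ⟨R, x, Ψ, le_rfl, hΨ, ht⟩⟩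

/-- A well of height `d` in the ball of radius `δ`, whose scalar curvature exceeds that of `g`
minus `ε` everywhere. -/
theorem IsNormalChart.exists_well [T2Space M] (hn : 3 ≤ n) (hΨ : IsNormalChart g R p Ψ) {c : M}
    (hc : Ψ.target ⊆ (chartAt 𝔼 c).source) {δ d ε : ℝ} (hδ : 0 < δ) (hδR : 2 * δ < R) (hd : 0 < d)
    (hε : 0 < ε) :
    ∃ (h : Metric n M) (F : M → ℝ), IsGraphWell g h p δ F ∧
      (∀ x, x ∉ ball g p δ → h.inner x = g.inner x) ∧
      (∀ x, x ∉ ball g p δ → scalarCurvature h x = scalarCurvature g x) ∧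
      (∀ x v, g.inner x v v ≤ h.inner x v v) ∧
      (∀ x, scalarCurvature g x - ε < scalarCurvature h x) ∧
      ENNReal.ofReal d ≤ diam h (ball g p (2 * δ)) ∧
      diam h (ball g p (2 * δ)) ≤ ENNReal.ofReal (2 * (2 * δ) + 2 * d) ∧
      vol h (ball g p (2 * δ)) ≤ ENNReal.ofReal (√(n.factorial * 2 ^ n) *
        (MeasureTheory.volume.real (Metric.ball (0 : 𝔼) 1) *
          ((2 * δ) ^ n + n * (δ ^ (n - 1) * d)))) := by
  have hn0 : (0 : ℝ) < n := by exact_mod_cast (by omega : 0 < n)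
  have : Nonempty (Fin n) := ⟨⟨0, by omega⟩⟩
  -- The profile vanishes from the radius `δ / 2` on, so that the points at distance `δ` from the
  -- centre have a neighbourhood in which the height is zero.
  obtain ⟨φ, hφ, hanti, ⟨ρ, hρ, hφρ⟩, hφδ, hprof⟩ :=
    exists_profile (half_pos hδ) hd (by positivity : 0 < ε / (2 * n))
  have hφ0 : φ 0 = d := hφρ 0 hρ.le
  have h0 : ∀ r ≤ ρ, φ r = φ 0 := fun r hr => by rw [hφρ r hr, hφ0]
  have h1 : ∀ r, δ / 2 ≤ r → φ r = φ R := fun r hr => by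
    rw [hφδ r hr, hφδ R (by linarith)]
  have h1' : ∀ r, δ ≤ r → φ r = 0 := fun r hr => hφδ r (by linarith)
  have hφR : φ R = 0 := hφδ R (by linarith)
  have hnn (r : ℝ) : 0 ≤ φ r := by
    rw [← hφδ (max r (δ / 2)) (le_max_right _ _)]
    exact hanti (le_max_left _ _)
  set F := radialExtension Ψ R φ with hFdef
  have hF : ContMDiff (𝓡 n) 𝓘(ℝ, ℝ) ∞ F :=
    contMDiff_radialExtension hΨ.isParam hΨ.source_eq hφ hρ h0 (by linarith : δ / 2 < R) h1
  set h := graphMetric g F hF with hh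
  have hgraph : IsRadialGraph g h Ψ φ := isRadialGraph_graphMetric hΨ.isParam hF
  have hball : ball g p (2 * δ) = Ψ '' Metric.ball 0 (2 * δ) := hΨ.ball_eq hδR
  have hsrc {v : 𝔼} (hv : v ∈ Metric.ball (0 : 𝔼) (2 * δ)) : v ∈ Ψ.source := by
    rw [hΨ.source_eq]; exact Metric.ball_subset_ball hδR.le hv
  have hconst {x : M} (hx : x ∉ Ψ '' Metric.closedBall 0 (δ / 2)) : F =ᶠ[𝓝 x] fun _ => φ R :=
    radialExtension_eventually_const hΨ.source_eq (by linarith) h1 hx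
  have hconst' {x : M} (hx : x ∉ ball g p δ) : F =ᶠ[𝓝 x] fun _ => φ R := by
    refine hconst fun hx' => hx ?_
    rw [hΨ.ball_eq (by linarith)]
    exact image_mono (Metric.closedBall_subset_ball (by linarith)) hx'
  refine ⟨h, F, ⟨hF.contMDiffOn, ⟨φ, hanti.antitoneOn _, ⟨ρ, hρ, fun r hr => h0 r hr.2.le⟩,
    fun r hr => h1' r hr.1, ?_⟩, ?_⟩, ?_, ?_, le_graphMetric g F hF, ?_, ?_, ?_, ?_⟩
  · rw [hball]
    rintro _ ⟨v, hv, rfl⟩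
    rw [hΨ.dist_eq (Metric.ball_subset_ball hδR.le hv), ENNReal.toReal_ofReal (norm_nonneg v),
      hFdef, radialExtension_apply (hsrc hv)]
  · intro x _ v w
    rw [hh, graphMetric_inner_apply, add_comm]
  · exact fun x hx => graphMetric_inner_of_eventually_const g hF (hconst' hx)
  · exact fun x hx => scalarCurvature_graphMetric_of_eventually_const g hF (hconst' hx)
  · intro x
    by_cases hx : x ∈ Ψ '' Metric.closedBall 0 (δ / 2)
    · obtain ⟨v, hv, rfl⟩ := hx
      have hvR : v ∈ Metric.ball (0 : 𝔼) R := Metric.closedBall_subset_ball (by linarith) hv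
      have hvs : v ∈ Ψ.source := by rw [hΨ.source_eq]; exact hvR
      by_cases hv0 : v = 0
      · subst hv0
        have hev : F =ᶠ[𝓝 (Ψ 0)] fun _ => φ 0 := by
          have hct : ContinuousAt Ψ.symm (Ψ 0) := Ψ.continuousAt_symm (Ψ.map_source hvs)
          have hz : Metric.ball (0 : 𝔼) ρ ∈ 𝓝 (Ψ.symm (Ψ 0)) := by
            rw [Ψ.left_inv hvs]; exact Metric.ball_mem_nhds _ hρ
          filter_upwards [hct hz, Ψ.open_target.mem_nhds (Ψ.map_source hvs)] with y hy hyt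
          rw [hFdef, radialExtension, if_pos hyt]
          exact h0 _ (mem_ball_zero_iff.1 hy).le
        rw [hh, scalarCurvature_graphMetric_of_eventually_const g hF hev]
        linarith
      · have := hΨ.lt_scalarCurvature hn hgraph hφ (by positivity) hprof hvR hv0
        rwa [mul_div_cancel₀ _ (by positivity)] at this
    · rw [hh, scalarCurvature_graphMetric_of_eventually_const g hF (hconst hx)]
      linarith
  · obtain ⟨v, hv⟩ := exists_norm_eq 𝔼 hδ.le
    have hvb : v ∈ Metric.ball (0 : 𝔼) (2 * δ) := by rw [mem_ball_zero_iff]; linarith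
    have h0b : (0 : 𝔼) ∈ Metric.ball (0 : 𝔼) (2 * δ) := Metric.mem_ball_self (by linarith)
    rw [hball]
    refine le_trans ?_ (distIn_le_diam ⟨v, hvb, rfl⟩ ⟨0, h0b, rfl⟩)
    refine le_trans (ENNReal.ofReal_le_ofReal ?_) (ofReal_abs_sub_le_distIn hF _ _ _)
    rw [hFdef, radialExtension_apply (hsrc hvb), radialExtension_apply (hsrc h0b), norm_zero, hφ0,
      hv, h1' δ le_rfl, sub_zero]
    exact le_abs_self d
  · rw [hball, ← hφ0]
    exact hΨ.diam_le hgraph hφ hanti hnn hδR.le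
  · rw [hball, ← hφ0]
    exact hΨ.vol_le (by omega) hgraph hc hφ hanti hδ h1' (by linarith) hδR.le

end Existence

end Riem

theorem proposition4p1 {n : ℕ} (hn : 3 ≤ n) {M : Type*} [TopologicalSpace M] [T2Space M]
    [SecondCountableTopology M] [ChartedSpace (EuclideanSpace ℝ (Fin n)) M]
    [IsManifold (𝓡 n) ∞ M] (g : Riem.Metric n M) :
    ∃ C : ℝ, 0 < C ∧ ∀ K : Set M, IsCompact K → ∃ δ₀ : ℝ, 0 < δ₀ ∧
      ∀ p ∈ K, ∀ δ : ℝ, 0 < δ → δ < δ₀ → ∀ κ : ℝ,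
        (∀ x ∈ Riem.ball g p (2 * δ), κ ≤ Riem.scalarCurvature g x) →
        ∀ j : ℕ, 1 ≤ j → ∀ d : ℝ, 0 < d →
        ∃ (h : Riem.Metric n M) (F : M → ℝ),
          Riem.IsGraphWell g h p δ F ∧
          (∀ x, x ∉ Riem.ball g p (2 * δ) → h.inner x = g.inner x) ∧
          (Riem.IsCompleteMetric g → Riem.IsCompleteMetric h) ∧
          (∀ x ∈ Riem.ball g p (2 * δ), κ - 1 / (j : ℝ) < Riem.scalarCurvature h x) ∧
          (∀ x ∈ Riem.ball g p (2 * δ) \ Riem.ball g p δ, h.inner x = g.inner x) ∧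
          ENNReal.ofReal d ≤ Riem.diam h (Riem.ball g p (2 * δ)) ∧
          Riem.diam h (Riem.ball g p (2 * δ)) < ENNReal.ofReal (C * (δ + d)) ∧
          Riem.vol h (Riem.ball g p (2 * δ)) <
            ENNReal.ofReal (C * (δ ^ n + d * δ ^ (n - 1))) ∧
          ((∀ x, x ∉ Riem.ball g p (2 * δ) → κ - 1 / (j : ℝ) < Riem.scalarCurvature g x) →
            ∀ x, κ - 1 / (j : ℝ) < Riem.scalarCurvature h x) := by
  set W := MeasureTheory.volume.real (Metric.ball (0 : EuclideanSpace ℝ (Fin n)) 1)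
  set L := √(n.factorial * 2 ^ n)
  have hW : 0 ≤ W := MeasureTheory.measureReal_nonneg
  have hL : 0 ≤ L := Real.sqrt_nonneg _
  have hC : 0 < L * W * (2 ^ n + n) + 5 := by positivity
  refine ⟨L * W * (2 ^ n + n) + 5, hC, fun K hK => ?_⟩
  obtain ⟨r, hr, hchart⟩ := Riem.exists_isNormalChart_of_isCompact g hK
  refine ⟨r / 2, half_pos hr, fun p hp δ hδ hδr κ hκ j hj d hd => ?_⟩
  obtain ⟨R, c, Ψ, hR, hΨ, hc⟩ := hchart p hp
  have hj' : (0 : ℝ) < j := by exact_mod_cast hj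
  obtain ⟨h, F, hwell, hout, hout', hle, hscal, hdiam, hdiam', hvol⟩ :=
    hΨ.exists_well hn hc hδ (by linarith) hd (one_div_pos.2 hj')
  have hsub : Riem.ball g p δ ⊆ Riem.ball g p (2 * δ) := fun x hx =>
    lt_of_lt_of_le hx (ENNReal.ofReal_le_ofReal (by linarith))
  refine ⟨h, F, hwell, fun x hx => hout x fun hx' => hx (hsub hx'), Riem.isCompleteMetric_of_le hle,
    fun x hx => ?_, fun x hx => hout x hx.2, hdiam, hdiam'.trans_lt ?_, hvol.trans_lt ?_,
    fun hκ' x => ?_⟩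
  · linarith [hκ x hx, hscal x]
  · rw [ENNReal.ofReal_lt_ofReal_iff (by positivity)]
    have : 0 ≤ L * W * (2 ^ n + n) * (δ + d) := by positivity
    nlinarith
  · rw [ENNReal.ofReal_lt_ofReal_iff (by positivity), mul_pow]
    have k1 : 0 < δ ^ n := by positivity
    have k2 : 0 < d * δ ^ (n - 1) := by positivity
    have k3 : 0 ≤ L * W * (2 ^ n * (d * δ ^ (n - 1))) := by positivity
    have k4 : 0 ≤ L * W * (n * δ ^ n) := by positivity
    have k5 : (L * W * (2 ^ n + n) + 5) * (δ ^ n + d * δ ^ (n - 1)) -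
        L * (W * (2 ^ n * δ ^ n + n * (δ ^ (n - 1) * d))) =
        L * W * (2 ^ n * (d * δ ^ (n - 1))) + L * W * (n * δ ^ n) +
          5 * (δ ^ n + d * δ ^ (n - 1)) := by ring
    linarith
  · by_cases hx : x ∈ Riem.ball g p (2 * δ)
    · linarith [hκ x hx, hscal x]
    · rw [hout' x fun hx' => hx (hsub hx')]
      exact hκ' x hx
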